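/- Let $k$ be an algebraically closed field and let $A$ be a basic connected finite dimensional $k$-algebra, regarded as a connected locally bounded $k$-category with finitely many objects (the objects are the elements $e_1,\dots,e_m$ of a complete set of primitive orthogonal idempotents, and the morphisms from $e_i$ to $e_j$ are the elements of $e_jAe_i$). Here a $k$-category is locally bounded if distinct objects are not isomorphic, all endomorphism algebras of objects are local, and for each object $x$ the spaces $\bigoplus_y \mathrm{Hom}(x,y)$ and $\bigoplus_y\mathrm{Hom}(y,x)$ are finite dimensional; it is connected if its set of objects has no non-trivial partition into two parts with no non-zero morphisms between them in either direction. Modules over a $k$-category are the $k$-linear functors to $k$-vector spaces. Let $F\colon\mathcal C\to A$ be a Galois covering with group $G$, where $\mathcal C$ is a locally bounded $k$-category: $G$ acts on $\mathcal C$ by $k$-linear automorphisms, freely on objects, $F\circ g=F$ for all $g\in G$, and $F$ induces an isomorphism $\mathcal C/G\cong A$. For an $A$-module $M$, let $F.M=M\circ F$ be its pull-up. For a $\mathcal C$-module $N$, let $F_\lambda N$ be its push-down, with $(F_\lambda N)(a)=\bigoplus_{x\in F^{-1}(a)}N(x)$, and for $g\in G$ let ${}^gN=N\circ g^{-1}$.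 An $A$-module $M$ is of the first kind (with respect to $F$) if each indecomposable direct summand of $M$ is isomorphic to $F_\lambda N$ for some $\mathcal C$-module $N$. A module is basic if it is a direct sum (possibly infinite) of pairwise non-isomorphic finite dimensional indecomposable modules. A finite dimensional $A$-module $T$ is tilting if it has finite projective dimension, $\mathrm{Ext}^i_A(T,T)=0$ for all $i>0$, and there is an exact sequence $0\to A\to T_1\to\dots\to T_r\to0$ with all $T_i\in\mathrm{add}(T)$. Let $\vec{\mathcal K}_A$ be the quiver whose vertices are the isomorphism classes of basic tilting $A$-modules, with an arrow $T\to T'$ if and only if $T=X\oplus R$ and $T'=Y\oplus R$ with $X,Y$ indecomposable and there is a non-split exact sequence $0\to X\to M\to Y\to0$ with $M\in\mathrm{add}(R)$. (1) Let $T,T'$ be basic tilting $A$-modules of the first kind which lie in the same connected component of $\vec{\mathcal K}_A$. Then $F.T$ is a basic $\mathcal C$-module if and only if $F.T'$ is a basic $\mathcal C$-module. (2) Let $T$ be a basic tilting $A$-module which lies in the connected component of $\vec{\mathcal K}_A$ containing $A$, or in the one containing $DA=\mathrm{Hom}_k(A,k)$ (if $DA$ is a vertex of $\vec{\mathcal K}_A$).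 Then $T$ is of the first kind and $F.T$ is a basic $\mathcal C$-module. If moreover $\mathcal C$ is connected, $T=T_1\oplus\dots\oplus T_n$ with the $T_i$ indecomposable, and $\lambda_i\colon F_\lambda\widehat T_i\to T_i$ are isomorphisms with $\widehat T_i$ finite dimensional indecomposable $\mathcal C$-modules, then the associated covering of $\mathrm{End}_A(T)$ is a Galois covering with group $G$ whose source is connected and locally bounded. Here $\mathrm{End}_A(T)$ is the $k$-category with objects $T_1,\dots,T_n$ and morphism spaces $\mathrm{Hom}_A(T_i,T_j)$; the source of the associated covering is the $k$-category with objects the pairs $(g,i)$, written ${}^g\widehat T_i$, and morphism spaces $\mathrm{Hom}_{\mathcal C}({}^g\widehat T_i,{}^h\widehat T_j)$, on which $G$ acts by $f\mapsto{}^gf$; and the covering sends ${}^g\widehat T_i$ to $T_i$ and $f\colon{}^g\widehat T_i\to{}^h\widehat T_j$ to $\lambda_j\circ F_\lambda(f)\circ\lambda_i^{-1}$, where $F_\lambda({}^g\widehat T_i)$ is identified with $F_\lambda\widehat T_i$. -/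

import Mathlib

open CategoryTheory CategoryTheory.Limits DirectSum

universe v u u₁ u₂ w

set_option linter.unusedSectionVars false

noncomputable section

namespace GalCov

/-! ### k-categories -/

/-- A `k`-category is connected if its set of objects has no non-trivial partition into two parts
without non-zero morphisms between them. -/
def IsConnectedKCat (C : Type u₁) [Category.{v} C] [Preadditive C] : Prop :=
  ∀ S : Set C,
    (∀ x ∈ S, ∀ y ∉ S, (∀ f : x ⟶ y, f = 0) ∧ (∀ f : y ⟶ x, f = 0)) → S = ∅ ∨ S = Set.univ

/-- Locally bounded `k`-categories. -/
structure IsLocallyBounded (k : Type w) [Field k] (C : Type u₁) [Category.{v} C] [Preadditive C]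
    [Linear k C] : Prop where
  eq_of_iso : ∀ x y : C, Nonempty (x ≅ y) → x = y
  finite_out : ∀ x : C, Module.Finite k (⨁ y : C, (x ⟶ y))
  finite_in : ∀ x : C, Module.Finite k (⨁ y : C, (y ⟶ x))
  isLocalRing_end : ∀ x : C, IsLocalRing (End x)

/-! ### Modules over k-categories -/

section Modules

variable (k : Type u) [Field k] (C : Type u) [Category.{u} C] [Preadditive C] [Linear k C]

/-- The property of being a `k`-linear functor, for functors to `k`-vector spaces. -/
def isKLinear : ObjectProperty (C ⥤ ModuleCat.{u} k) :=
  fun M => M.Additive ∧ M.Linear k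

/-- The category `MOD(C)` of (left) modules over the `k`-category `C`: `k`-linear functors from `C`
to `k`-vector spaces, with natural transformations as morphisms. -/
abbrev KMod : Type (u + 1) := (isKLinear k C).FullSubcategory

variable {k C}

theorem isKLinear_of_mono {M N : C ⥤ ModuleCat.{u} k} (f : M ⟶ N) [Mono f]
    (hN : isKLinear k C N) : isKLinear k C M := by
  obtain ⟨_, _⟩ := hN
  refine ⟨⟨fun {X Y} a b => ?_⟩, ⟨fun {X Y} a r => ?_⟩⟩
  · rw [← cancel_mono (f.app Y)]
    simp only [Preadditive.add_comp, f.naturality, N.map_add, Preadditive.comp_add]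
  · rw [← cancel_mono (f.app Y)]
    simp only [Linear.smul_comp, f.naturality, N.map_smul, Linear.comp_smul]

theorem isKLinear_of_epi {M N : C ⥤ ModuleCat.{u} k} (f : M ⟶ N) [Epi f]
    (hM : isKLinear k C M) : isKLinear k C N := by
  obtain ⟨_, _⟩ := hM
  refine ⟨⟨fun {X Y} a b => ?_⟩, ⟨fun {X Y} a r => ?_⟩⟩
  · rw [← cancel_epi (f.app X)]
    simp only [Preadditive.comp_add, ← f.naturality, M.map_add, Preadditive.add_comp]
  · rw [← cancel_epi (f.app X)]
    simp only [Linear.comp_smul, ← f.naturality, M.map_smul, Linear.smul_comp]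

instance : (isKLinear k C).IsClosedUnderSubobjects where
  prop_of_mono f _ h := isKLinear_of_mono f h

instance : (isKLinear k C).IsClosedUnderQuotients where
  prop_of_epi f _ h := isKLinear_of_epi f h

theorem isKLinear_of_isZero {M : C ⥤ ModuleCat.{u} k} (h : IsZero M) : isKLinear k C M := by
  have hz : ∀ X, IsZero (M.obj X) := fun X => (Functor.isZero_iff M).1 h X
  exact ⟨⟨fun {X Y} a b => (hz X).eq_of_src _ _⟩, ⟨fun {X Y} a r => (hz X).eq_of_src _ _⟩⟩

instance : (isKLinear k C).ContainsZero where
  exists_zero := ⟨_, isZero_zero _, isKLinear_of_isZero (isZero_zero _)⟩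

instance : (isKLinear k C).IsClosedUnderBinaryProducts where
  limitsOfShape_le := by
    rintro M ⟨p⟩
    have key : ∀ {Y : C} {Z : ModuleCat.{u} k} (a b : Z ⟶ M.obj Y),
        (∀ j, a ≫ (p.π.app j).app Y = b ≫ (p.π.app j).app Y) → a = b := by
      intro Y Z a b h
      exact (isLimitOfPreserves ((evaluation C (ModuleCat.{u} k)).obj Y) p.isLimit).hom_ext h
    refine ⟨⟨fun {X Y} a b => key _ _ fun j => ?_⟩, ⟨fun {X Y} a r => key _ _ fun j => ?_⟩⟩
    · obtain ⟨_, _⟩ := p.prop_diag_obj j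
      have hn := fun {X Y : C} (f : X ⟶ Y) => (p.π.app j).naturality f
      simp only [Functor.const_obj_obj] at hn
      simp only [Preadditive.add_comp, hn, Functor.map_add, Preadditive.comp_add]
    · obtain ⟨_, _⟩ := p.prop_diag_obj j
      have hn := fun {X Y : C} (f : X ⟶ Y) => (p.π.app j).naturality f
      simp only [Functor.const_obj_obj] at hn
      simp only [Linear.smul_comp, hn, Functor.map_smul, Linear.comp_smul]

instance : (isKLinear k C).IsClosedUnderFiniteProducts := by
  apply ObjectProperty.IsClosedUnderFiniteProducts.mk'

/-- Finite dimensional modules: the total dimension is finite. -/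
def IsFinDim (M : KMod k C) : Prop :=
  Module.Finite k (⨁ x : C, M.obj.obj x)

/-- `M` lies in `ind(C)`: it is finite dimensional and indecomposable. -/
def IsInd (M : KMod k C) : Prop :=
  IsFinDim M ∧ Indecomposable M

/-- `M` is the direct sum of the family `N` along the given inclusions. -/
def IsDirectSum {I : Type w} (N : I → KMod k C) (M : KMod k C) (incl : ∀ i, N i ⟶ M) : Prop :=
  Nonempty (IsColimit (Cofan.mk M incl))

/-- `N` is a direct summand of `M`. -/
def IsSummand (N M : KMod k C) : Prop :=
  ∃ N' : KMod k C, Nonempty (M ≅ N ⊞ N')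

/-- `M` is basic: it is a direct sum of pairwise non-isomorphic finite dimensional indecomposable
modules. The index set may be infinite, since the pull-up of a finite dimensional module along an
infinite covering is only locally finite dimensional; when `M` is finite dimensional, the index
set is automatically finite. -/
def IsBasic (M : KMod k C) : Prop :=
  ∃ (I : Type u) (N : I → KMod k C) (incl : ∀ i, N i ⟶ M),
    IsDirectSum N M incl ∧ (∀ i, IsInd (N i)) ∧ ∀ i j, Nonempty (N i ≅ N j) → i = j

/-- `X` lies in `add(T)`: it is a finite direct sum of direct summands of `T`. -/
def IsAdd (T X : KMod k C) : Prop :=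
  ∃ (n : ℕ) (N : Fin n → KMod k C) (incl : ∀ i, N i ⟶ X),
    IsDirectSum N X incl ∧ ∀ i, IsSummand (N i) T

end Modules

/-! ### Tilting modules over a `k`-category with finitely many objects -/

section Tilting

variable (k : Type u) [Field k] (A : Type u) [Category.{u} A] [Preadditive A] [Linear k A]

/-- The module `A`: at `y` it is the direct sum (a product, as `A` has finitely many objects) over
all objects `x` of the spaces of morphisms from `x` to `y`. -/
def regular : KMod k A where
  obj :=
    { obj := fun y => ModuleCat.of k (∀ x : A, (x ⟶ y))
      map := fun f => ModuleCat.ofHom (LinearMap.pi fun x =>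
        (Linear.rightComp k x f) ∘ₗ LinearMap.proj x)
      map_id := fun y => by ext φ x; simp
      map_comp := fun f g => by ext φ x; simp }
  property := by
    refine ⟨⟨fun {X Y} a b => ?_⟩, ⟨fun {X Y} a r => ?_⟩⟩
    · ext φ x; simp
    · ext φ x; simp

/-- The module `DA`: at `y` it is the direct sum (a product, as `A` has finitely many objects) over
all objects `x` of the `k`-duals of the spaces of morphisms from `y` to `x`. -/
def dualRegular : KMod k A where
  obj :=
    { obj := fun y => ModuleCat.of k (∀ x : A, Module.Dual k (y ⟶ x))
      map := fun f => ModuleCat.ofHom (LinearMap.pi fun x =>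
        (Module.Dual.transpose (R := k) (Linear.leftComp k x f)) ∘ₗ LinearMap.proj x)
      map_id := fun y => by ext φ x g; simp [Module.Dual.transpose]
      map_comp := fun f g => by ext φ x h; simp [Module.Dual.transpose] }
  property := by
    refine ⟨⟨fun {X Y} a b => ?_⟩, ⟨fun {X Y} a r => ?_⟩⟩
    · ext φ x g; simp [Module.Dual.transpose]
    · ext φ x g; simp [Module.Dual.transpose]

variable {k A}

/-- `T` is selforthogonal: `Ext^i(T, T) = 0` for all `i > 0`. -/
def IsSelfOrthogonal (T : KMod k A) : Prop :=
  letI := HasExt.standard (KMod k A)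
  ∀ i : ℕ, 0 < i → Subsingleton (Abelian.Ext.{u + 1} T T i)

/-- Tilting modules of arbitrary finite projective dimension. In `coresolution`, the complex `K` is
an exact sequence `0 → A → T₁ → ⋯ → T_r → 0` with all `T_i` in `add(T)`. -/
structure IsTilting (T : KMod k A) : Prop where
  finDim : IsFinDim T
  finite_projDim : ∃ d : ℕ, HasProjectiveDimensionLE T d
  selfOrthogonal : IsSelfOrthogonal T
  coresolution : ∃ (K : CochainComplex (KMod k A) ℕ) (r : ℕ),
    K.Acyclic ∧ Nonempty (K.X 0 ≅ regular k A) ∧ (∀ i, 0 < i → i ≤ r → IsAdd T (K.X i)) ∧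
      ∀ i, r < i → IsZero (K.X i)

/-- Basic tilting modules. -/
def IsBasicTilting (T : KMod k A) : Prop :=
  IsTilting T ∧ IsBasic T

/-- There is an arrow from (the isomorphism class of) `T` to (that of) `T'` in the quiver `K_A` of
basic tilting modules: `T = X ⊕ R`, `T' = Y ⊕ R` with `X`, `Y` indecomposable, and there is a
non-split exact sequence `0 → X → M → Y → 0` with `M` in `add(R)`. -/
def HasArrow (T T' : KMod k A) : Prop :=
  IsBasicTilting T ∧ IsBasicTilting T' ∧
    ∃ X Y R : KMod k A, IsInd X ∧ IsInd Y ∧ Nonempty (T ≅ X ⊞ R) ∧ Nonempty (T' ≅ Y ⊞ R) ∧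
      ∃ S : ShortComplex (KMod k A), S.ShortExact ∧ IsEmpty S.Splitting ∧
        Nonempty (S.X₁ ≅ X) ∧ Nonempty (S.X₃ ≅ Y) ∧ IsAdd R S.X₂

/-- `T` and `T'` lie in the same connected component of `K_A`, whose vertices are the basic tilting
modules up to isomorphism. -/
def SameComponent (T T' : KMod k A) : Prop :=
  IsBasicTilting T ∧ IsBasicTilting T' ∧
    Relation.EqvGen (fun S S' => Nonempty (S ≅ S') ∨ HasArrow S S') T T'

end Tilting

/-! ### Galois coverings -/

section Covering

variable (k : Type w) [Field k]
  {C : Type u₁} [Category.{v} C] [Preadditive C] [Linear k C]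
  {A : Type u₂} [Category.{v} A] [Preadditive A] [Linear k A]

/-- The fibre of a functor at an object. -/
abbrev Fib (F : C ⥤ A) (a : A) : Type u₁ := {x : C // F.obj x = a}

open Classical in
/-- The map `⨁_{y ∈ F⁻¹(b)} Hom(x, y) → Hom(F x, b)` induced by `F`. -/
def outMap (F : C ⥤ A) [F.Additive] [F.Linear k] (x : C) (b : A) :
    (⨁ y : Fib F b, (x ⟶ y.1)) →ₗ[k] (F.obj x ⟶ b) :=
  DirectSum.toModule k (Fib F b) (F.obj x ⟶ b) fun y =>
    Linear.rightComp k (F.obj x) (eqToHom y.2) ∘ₗ F.mapLinearMap k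

open Classical in
/-- The map `⨁_{x ∈ F⁻¹(a)} Hom(x, y) → Hom(a, F y)` induced by `F`. -/
def inMap (F : C ⥤ A) [F.Additive] [F.Linear k] (a : A) (y : C) :
    (⨁ x : Fib F a, (x.1 ⟶ y)) →ₗ[k] (a ⟶ F.obj y) :=
  DirectSum.toModule k (Fib F a) (a ⟶ F.obj y) fun x =>
    Linear.leftComp k (F.obj y) (eqToHom x.2.symm) ∘ₗ F.mapLinearMap k

/-- Covering functors. -/
structure IsCovering (F : C ⥤ A) [F.Additive] [F.Linear k] : Prop where
  bijective_out : ∀ x y : C, Function.Bijective (outMap k F x (F.obj y))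
  bijective_in : ∀ x y : C, Function.Bijective (inMap k F (F.obj x) y)

variable (C) in
/-- An action of the group `G` on the `k`-category `C` by (strict) `k`-linear automorphisms, that
is, a group morphism from `G` to `Aut(C)`. -/
structure KAction (G : Type u) [Group G] where
  act : G → C ⥤ C
  additive : ∀ g, (act g).Additive
  linear : ∀ g, (act g).Linear k
  act_one : act 1 = 𝟭 C
  act_mul : ∀ g h, act (g * h) = act h ⋙ act g

attribute [instance] KAction.additive KAction.linear

variable {k} in
/-- `F`, together with the given action of `G` on `C`, is a Galois covering with group `G`: the
action is free on objects, `F ∘ g = F` for all `g`, and `F` identifies `A` with the quotient of `C`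
by `G`, i.e. `F` is a covering functor which is surjective on objects and whose fibres are the
`G`-orbits. -/
structure IsGaloisCovering {G : Type u} [Group G] (ρ : KAction k C G) (F : C ⥤ A) [F.Additive]
    [F.Linear k] : Prop where
  free : ∀ g x, (ρ.act g).obj x = x → g = 1
  comp_eq : ∀ g, ρ.act g ⋙ F = F
  surjective : Function.Surjective F.obj
  transitive : ∀ x y, F.obj x = F.obj y → ∃ g, (ρ.act g).obj x = y
  covering : IsCovering k F

open Classical in
@[simp]
theorem outMap_lof (F : C ⥤ A) [F.Additive] [F.Linear k] (x : C) (b : A) (y : Fib F b)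
    (f : x ⟶ y.1) :
    outMap k F x b (DirectSum.lof k (Fib F b) (fun y => (x ⟶ y.1)) y f) =
      F.map f ≫ eqToHom y.2 := by
  unfold outMap
  exact DirectSum.toModule_lof k (M := fun y : Fib F b => (x ⟶ y.1)) y f

end Covering

/-! ### Pull-up and push-down -/

section PullUp

variable {k : Type u} [Field k]
  {C : Type u} [Category.{u} C] [Preadditive C] [Linear k C]
  {A : Type u} [Category.{u} A] [Preadditive A] [Linear k A]

/-- The pull-up functor `M ↦ F.M = M ∘ F`. -/
def pullUp (F : C ⥤ A) [F.Additive] [F.Linear k] : KMod k A ⥤ KMod k C where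
  obj M :=
    { obj := F ⋙ M.obj
      property := by
        obtain ⟨_, _⟩ := M.property
        exact ⟨inferInstance, inferInstance⟩ }
  map f := ObjectProperty.homMk (Functor.whiskerLeft F f.hom)

/-- The action of `g` on modules: `M ↦ ᵍM = M ∘ g⁻¹`. -/
def twist {G : Type u} [Group G] (ρ : KAction k C G) (g : G) : KMod k C ⥤ KMod k C :=
  pullUp (ρ.act g⁻¹)

end PullUp

section PushDown

variable {k : Type u} [Field k]
  {C : Type u} [Category.{u} C] [Preadditive C] [Linear k C]
  {A : Type u} [Category.{u} A] [Preadditive A] [Linear k A]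
  {G : Type u} [Group G] {ρ : KAction k C G} {F : C ⥤ A} [F.Additive] [F.Linear k]

theorem IsGaloisCovering.bijective (hF : IsGaloisCovering ρ F) (x : C) (b : A) :
    Function.Bijective (outMap k F x b) := by
  obtain ⟨y, rfl⟩ := hF.surjective b
  exact hF.covering.bijective_out x y

/-- For a covering `F`, a morphism `u : F x → b` of `A` is uniquely the sum of the images of
morphisms `x → y` of `C`, where `y` runs over `F⁻¹(b)`; `liftHom` is the family of these
morphisms. -/
def liftHom (hF : IsGaloisCovering ρ F) (x : C) (b : A) :
    (F.obj x ⟶ b) ≃ₗ[k] (⨁ y : Fib F b, (x ⟶ y.1)) :=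
  (LinearEquiv.ofBijective (outMap k F x b) (hF.bijective x b)).symm

@[simp]
theorem outMap_liftHom (hF : IsGaloisCovering ρ F) (x : C) (b : A) (u : F.obj x ⟶ b) :
    outMap k F x b (liftHom hF x b u) = u :=
  (LinearEquiv.ofBijective (outMap k F x b) (hF.bijective x b)).apply_symm_apply u

theorem liftHom_eq (hF : IsGaloisCovering ρ F) (x : C) (b : A) (u : F.obj x ⟶ b)
    (s : ⨁ y : Fib F b, (x ⟶ y.1)) (h : outMap k F x b s = u) : liftHom hF x b u = s :=
  (hF.bijective x b).1 (by rw [outMap_liftHom, h])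

/-- The action of a `C`-module on morphisms, as a linear map. -/
def KMod.mapL (M : KMod k C) (x y : C) : (x ⟶ y) →ₗ[k] M.obj.obj x →ₗ[k] M.obj.obj y where
  toFun f := (M.obj.map f).hom
  map_add' f g := by
    have := M.property.1
    simp
  map_smul' r f := by
    have := M.property.1
    have := M.property.2
    simp

@[simp]
theorem KMod.mapL_apply (M : KMod k C) {x y : C} (f : x ⟶ y) (m : M.obj.obj x) :
    M.mapL x y f m = M.obj.map f m := rfl

open Classical in
/-- The map sending a family `(f_y : x → y)`, with `y` in the fibre of `b`, and `m ∈ M(x)` to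
`(M(f_y)(m))_y`. -/
def evalFam (F : C ⥤ A) (M : KMod k C) (x : C) (b : A) :
    (⨁ y : Fib F b, (x ⟶ y.1)) →ₗ[k] M.obj.obj x →ₗ[k] ⨁ y : Fib F b, M.obj.obj y.1 :=
  DirectSum.toModule k (Fib F b) _ fun y =>
    (LinearMap.llcomp k (M.obj.obj x) (M.obj.obj y.1) (⨁ y : Fib F b, M.obj.obj y.1)
      (DirectSum.lof k (Fib F b) (fun y => M.obj.obj y.1) y)) ∘ₗ M.mapL x y.1

open Classical in
@[simp]
theorem evalFam_lof (F : C ⥤ A) (M : KMod k C) (x : C) (b : A) (y : Fib F b) (f : x ⟶ y.1)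
    (m : M.obj.obj x) :
    evalFam F M x b (DirectSum.lof k (Fib F b) (fun y => (x ⟶ y.1)) y f) m =
      DirectSum.lof k (Fib F b) (fun y => M.obj.obj y.1) y (M.obj.map f m) := by
  unfold evalFam
  erw [DirectSum.toModule_lof k (M := fun y : Fib F b => (x ⟶ y.1)) y f]
  rfl

open Classical in
/-- The action of a morphism `u : a → b` of `A` on the push-down of `M`: for `x` in the fibre of
`a`, it sends `m ∈ M(x)` to the family of the `M(u_y)(m)`, where `u = ∑ F(u_y)` with
`u_y : x → y` and `y` in the fibre of `b`. -/
def pushMap (hF : IsGaloisCovering ρ F) (M : KMod k C) {a b : A} (u : a ⟶ b) :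
    (⨁ x : Fib F a, M.obj.obj x.1) →ₗ[k] ⨁ y : Fib F b, M.obj.obj y.1 :=
  DirectSum.toModule k (Fib F a) _ fun x =>
    evalFam F M x.1 b (liftHom hF x.1 b (eqToHom x.2 ≫ u))

open Classical in
@[simp]
theorem pushMap_lof (hF : IsGaloisCovering ρ F) (M : KMod k C) {a b : A} (u : a ⟶ b)
    (x : Fib F a) (m : M.obj.obj x.1) :
    pushMap hF M u (DirectSum.lof k (Fib F a) (fun x => M.obj.obj x.1) x m) =
      evalFam F M x.1 b (liftHom hF x.1 b (eqToHom x.2 ≫ u)) m := by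
  unfold pushMap
  erw [DirectSum.toModule_lof k (M := fun x : Fib F a => M.obj.obj x.1) x m]

theorem pushMap_id (hF : IsGaloisCovering ρ F) (M : KMod k C) (a : A) :
    pushMap hF M (𝟙 a) = LinearMap.id := by
  classical
  refine DirectSum.linearMap_ext _ fun x => ?_
  ext m
  have h : liftHom hF x.1 a (eqToHom x.2 ≫ 𝟙 a) =
      DirectSum.lof k (Fib F a) (fun y => (x.1 ⟶ y.1)) x (𝟙 x.1) :=
    liftHom_eq hF _ _ _ _ (by rw [outMap_lof]; simp)
  simp only [LinearMap.comp_apply]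
  erw [pushMap_lof, h, evalFam_lof]
  simp

open Classical in
/-- Precomposition of a family of morphisms with source `y` by `f : x → y`. -/
def precompFam (F : C ⥤ A) (b : A) {x y : C} :
    (x ⟶ y) →ₗ[k] (⨁ z : Fib F b, (y ⟶ z.1)) →ₗ[k] ⨁ z : Fib F b, (x ⟶ z.1) where
  toFun f := DirectSum.lmap fun z => Linear.leftComp k z.1 f
  map_add' f g := by
    refine DirectSum.linearMap_ext _ fun z => ?_
    ext h
    simp
  map_smul' r f := by
    refine DirectSum.linearMap_ext _ fun z => ?_
    ext h
    simp

open Classical in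
@[simp]
theorem precompFam_lof (F : C ⥤ A) (b : A) {x y : C} (f : x ⟶ y) (z : Fib F b) (g : y ⟶ z.1) :
    precompFam (k := k) F b f (DirectSum.lof k (Fib F b) (fun z => (y ⟶ z.1)) z g) =
      DirectSum.lof k (Fib F b) (fun z => (x ⟶ z.1)) z (f ≫ g) := by
  simp [precompFam]

theorem outMap_precompFam (F : C ⥤ A) [F.Additive] [F.Linear k] (b : A) {x y : C} (f : x ⟶ y)
    (s : ⨁ z : Fib F b, (y ⟶ z.1)) :
    outMap k F x b (precompFam (k := k) F b f s) = F.map f ≫ outMap k F y b s := by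
  classical
  induction s using DirectSum.induction_on with
  | zero => simp
  | of z g =>
    change outMap k F x b (precompFam (k := k) F b f (DirectSum.lof k _ _ z g)) =
      F.map f ≫ outMap k F y b (DirectSum.lof k _ _ z g)
    erw [precompFam_lof, outMap_lof, outMap_lof]
    simp
  | add s t hs ht => simp [hs, ht]

theorem evalFam_precompFam (F : C ⥤ A) (M : KMod k C) (b : A) {x y : C} (f : x ⟶ y)
    (s : ⨁ z : Fib F b, (y ⟶ z.1)) (m : M.obj.obj x) :
    evalFam F M x b (precompFam (k := k) F b f s) m = evalFam F M y b s (M.obj.map f m) := by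
  classical
  induction s using DirectSum.induction_on with
  | zero => simp
  | of z g =>
    change evalFam F M x b (precompFam (k := k) F b f (DirectSum.lof k _ _ z g)) m =
      evalFam F M y b (DirectSum.lof k _ _ z g) (M.obj.map f m)
    erw [precompFam_lof, evalFam_lof, evalFam_lof]
    simp
  | add s t hs ht => simp [hs, ht]

theorem pushMap_comp (hF : IsGaloisCovering ρ F) (M : KMod k C) {a b c : A} (u : a ⟶ b)
    (v : b ⟶ c) : pushMap hF M (u ≫ v) = pushMap hF M v ∘ₗ pushMap hF M u := by
  classical
  refine DirectSum.linearMap_ext _ fun x => ?_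
  ext m
  simp only [LinearMap.comp_apply]
  erw [pushMap_lof, pushMap_lof]
  let Q : (⨁ y : Fib F b, (x.1 ⟶ y.1)) →ₗ[k] ⨁ z : Fib F c, (x.1 ⟶ z.1) :=
    DirectSum.toModule k (Fib F b) _ fun y =>
      (precompFam F c).flip (liftHom hF y.1 c (eqToHom y.2 ≫ v))
  have hQ : ∀ (y : Fib F b) (f : x.1 ⟶ y.1), Q (DirectSum.lof k _ (fun y => (x.1 ⟶ y.1)) y f) =
      precompFam (k := k) F c f (liftHom hF y.1 c (eqToHom y.2 ≫ v)) := by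
    intro y f
    simp only [Q]
    erw [DirectSum.toModule_lof k (M := fun y : Fib F b => (x.1 ⟶ y.1)) y f]
    rfl
  have h1 : ∀ s, outMap k F x.1 c (Q s) = outMap k F x.1 b s ≫ v := by
    intro s
    induction s using DirectSum.induction_on with
    | zero => simp
    | of y f =>
      change outMap k F x.1 c (Q (DirectSum.lof k _ _ y f)) =
        outMap k F x.1 b (DirectSum.lof k _ _ y f) ≫ v
      erw [hQ, outMap_precompFam, outMap_liftHom, outMap_lof]
      simp
    | add s t hs ht => simp [hs, ht]
  have h2 : ∀ s, evalFam F M x.1 c (Q s) m = pushMap hF M v (evalFam F M x.1 b s m) := by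
    intro s
    induction s using DirectSum.induction_on with
    | zero => simp
    | of y f =>
      change evalFam F M x.1 c (Q (DirectSum.lof k _ _ y f)) m =
        pushMap hF M v (evalFam F M x.1 b (DirectSum.lof k _ _ y f) m)
      erw [hQ, evalFam_precompFam, evalFam_lof, pushMap_lof]
    | add s t hs ht => simp [hs, ht]
  rw [← h2]
  have h3 : liftHom hF x.1 c (eqToHom x.2 ≫ u ≫ v) =
      Q (liftHom hF x.1 b (eqToHom x.2 ≫ u)) :=
    liftHom_eq hF _ _ _ _ (by rw [h1, outMap_liftHom, Category.assoc])
  rw [h3]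

/-- The push-down of a `C`-module: `(F_λ M)(a) = ⨁_{x ∈ F⁻¹(a)} M(x)`. -/
def pushDownObj (hF : IsGaloisCovering ρ F) (M : KMod k C) : KMod k A where
  obj :=
    { obj := fun a => ModuleCat.of k (⨁ x : Fib F a, M.obj.obj x.1)
      map := fun u => ModuleCat.ofHom (pushMap hF M u)
      map_id := fun a => by rw [pushMap_id]; rfl
      map_comp := fun u v => by rw [pushMap_comp]; rfl }
  property := by
    classical
    refine ⟨⟨fun {a b} u v => ?_⟩, ⟨fun {a b} u r => ?_⟩⟩
    · refine ModuleCat.hom_ext (DirectSum.linearMap_ext _ fun x =>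
        LinearMap.ext fun m => ?_)
      change pushMap hF M (u + v) (DirectSum.lof k _ _ x m) =
        pushMap hF M u (DirectSum.lof k _ _ x m) + pushMap hF M v (DirectSum.lof k _ _ x m)
      erw [pushMap_lof, pushMap_lof, pushMap_lof]
      simp
    · refine ModuleCat.hom_ext (DirectSum.linearMap_ext _ fun x =>
        LinearMap.ext fun m => ?_)
      change pushMap hF M (r • u) (DirectSum.lof k _ _ x m) =
        r • pushMap hF M u (DirectSum.lof k _ _ x m)
      erw [pushMap_lof, pushMap_lof]
      simp

theorem evalFam_natural (F : C ⥤ A) {M N : KMod k C} (f : M ⟶ N) (x : C) (b : A)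
    (s : ⨁ y : Fib F b, (x ⟶ y.1)) (m : M.obj.obj x) :
    DirectSum.lmap (fun y : Fib F b => (f.hom.app y.1).hom) (evalFam F M x b s m) =
      evalFam F N x b s (f.hom.app x m) := by
  classical
  induction s using DirectSum.induction_on with
  | zero => simp
  | of y g =>
    change DirectSum.lmap (fun y : Fib F b => (f.hom.app y.1).hom)
        (evalFam F M x b (DirectSum.lof k _ _ y g) m) =
      evalFam F N x b (DirectSum.lof k _ _ y g) (f.hom.app x m)
    erw [evalFam_lof, evalFam_lof, DirectSum.lmap_lof]
    congr 1
    exact ConcreteCategory.congr_hom (f.hom.naturality g) m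
  | add s t hs ht => simp [hs, ht]

/-- The push-down functor `F_λ`. -/
def pushDown (hF : IsGaloisCovering ρ F) : KMod k C ⥤ KMod k A where
  obj M := pushDownObj hF M
  map {M N} f := ObjectProperty.homMk
    { app := fun a => ModuleCat.ofHom (DirectSum.lmap fun x : Fib F a => (f.hom.app x.1).hom)
      naturality := fun a b u => by
        classical
        refine ModuleCat.hom_ext (DirectSum.linearMap_ext _ fun x =>
          LinearMap.ext fun m => ?_)
        change DirectSum.lmap _ (pushMap hF M u (DirectSum.lof k (Fib F _) (fun x => M.obj.obj x.1) x m)) =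
          pushMap hF N u (DirectSum.lmap _ (DirectSum.lof k (Fib F _) (fun x => M.obj.obj x.1) x m))
        erw [pushMap_lof, DirectSum.lmap_lof, pushMap_lof]
        exact evalFam_natural F f x.1 b _ m }
  map_id M := by
    classical
    ext a : 3
    refine ModuleCat.hom_ext (DirectSum.linearMap_ext _ fun x =>
      LinearMap.ext fun m => ?_)
    change DirectSum.lmap _ (DirectSum.lof k (Fib F _) (fun x => M.obj.obj x.1) x m) = DirectSum.lof k (Fib F _) (fun x => M.obj.obj x.1) x m
    erw [DirectSum.lmap_lof]
  map_comp {M _ _} f g := by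
    classical
    ext a : 3
    refine ModuleCat.hom_ext (DirectSum.linearMap_ext _ fun x =>
      LinearMap.ext fun m => ?_)
    change DirectSum.lmap _ (DirectSum.lof k (Fib F _) (fun x => M.obj.obj x.1) x m) =
      DirectSum.lmap _ (DirectSum.lmap _ (DirectSum.lof k (Fib F _) (fun x => M.obj.obj x.1) x m))
    erw [DirectSum.lmap_lof]

instance (hF : IsGaloisCovering ρ F) : (pushDown hF).Additive where
  map_add {M N f g} := by
    classical
    ext a : 3
    refine ModuleCat.hom_ext (DirectSum.linearMap_ext _ fun x => LinearMap.ext fun m => ?_)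
    have e := fun h : M ⟶ N => DirectSum.lmap_lof (R := k)
      (f := fun x : Fib F a => (h.hom.app x.1).hom) x m
    refine (e (f + g)).trans (Eq.trans ?_ (congrArg₂ (· + ·) (e f) (e g)).symm)
    exact map_add (DirectSum.lof k (Fib F a) (fun x => N.obj.obj x.1) x) _ _

instance (hF : IsGaloisCovering ρ F) : (pushDown hF).Linear k where
  map_smul {M N} f r := by
    classical
    ext a : 3
    refine ModuleCat.hom_ext (DirectSum.linearMap_ext _ fun x => LinearMap.ext fun m => ?_)
    have e := fun h : M ⟶ N => DirectSum.lmap_lof (R := k)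
      (f := fun x : Fib F a => (h.hom.app x.1).hom) x m
    refine (e (r • f)).trans (Eq.trans ?_ (congrArg (r • ·) (e f)).symm)
    exact map_smul (DirectSum.lof k (Fib F a) (fun x => N.obj.obj x.1) x) r _

/-- The `A`-module `M` is of the first kind with respect to `F`: each of its indecomposable direct
summands is isomorphic to the push-down of a `C`-module. -/
def IsFirstKind (hF : IsGaloisCovering ρ F) (M : KMod k A) : Prop :=
  ∀ N : KMod k A, Indecomposable N → IsSummand N M →
    ∃ N' : KMod k C, Nonempty (N ≅ (pushDown hF).obj N')

/-! ### The identification of the push-downs of `ᵍM` and `M` -/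

theorem IsGaloisCovering.obj_act (hF : IsGaloisCovering ρ F) (g : G) (x : C) :
    F.obj ((ρ.act g).obj x) = F.obj x :=
  Functor.congr_obj (hF.comp_eq g) x

theorem KAction.act_inv_act (ρ : KAction k C G) (g : G) (x : C) :
    (ρ.act g⁻¹).obj ((ρ.act g).obj x) = x := by
  have h := Functor.congr_obj (ρ.act_mul g⁻¹ g) x
  rw [inv_mul_cancel, ρ.act_one] at h
  exact h.symm

theorem KAction.act_act_inv (ρ : KAction k C G) (g : G) (x : C) :
    (ρ.act g).obj ((ρ.act g⁻¹).obj x) = x := by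
  simpa using ρ.act_inv_act g⁻¹ x

/-- The action of `g` on the fibres of `F`. -/
def fibEquiv (hF : IsGaloisCovering ρ F) (g : G) (a : A) : Fib F a ≃ Fib F a where
  toFun x := ⟨(ρ.act g).obj x.1, (hF.obj_act g x.1).trans x.2⟩
  invFun x := ⟨(ρ.act g⁻¹).obj x.1, (hF.obj_act g⁻¹ x.1).trans x.2⟩
  left_inv x := Subtype.ext (ρ.act_inv_act g x.1)
  right_inv x := Subtype.ext (ρ.act_act_inv g x.1)

/-- Reindexing of a direct sum along a permutation of the index set. -/
def reindex (k : Type u) [Field k] {ι : Type u} (e : ι ≃ ι) (N : ι → Type u)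
    [∀ i, AddCommGroup (N i)] [∀ i, Module k (N i)] :
    (⨁ i, N (e.symm i)) ≃ₗ[k] ⨁ i, N i :=
  (DirectSum.lequivCongrLeft k (M := N) e).symm

theorem reindex_lof (k : Type u) [Field k] {ι : Type u} [DecidableEq ι] (e : ι ≃ ι)
    (N : ι → Type u) [∀ i, AddCommGroup (N i)] [∀ i, Module k (N i)] (i : ι) (m : N (e.symm i)) :
    reindex k e N (DirectSum.lof k ι (fun i => N (e.symm i)) i m) =
      DirectSum.lof k ι N (e.symm i) m := by
  unfold reindex
  rw [LinearEquiv.symm_apply_eq]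
  refine DFinsupp.ext fun j => ?_
  rw [DirectSum.lequivCongrLeft_apply]
  by_cases h : i = j
  · subst h
    rw [DirectSum.lof_apply, DirectSum.lof_apply]
  · have h' : e.symm i ≠ e.symm j := fun e' => h (e.symm.injective e')
    rw [DirectSum.lof_eq_of, DirectSum.lof_eq_of, DirectSum.of_eq_of_ne _ _ _ (Ne.symm h),
      DirectSum.of_eq_of_ne _ _ _ (Ne.symm h')]

/-- The identification `(F_λ ᵍM)(a) = ⨁_x M(g⁻¹ x) ≃ ⨁_x M(x) = (F_λ M)(a)`, which is the identity
from the summand with index `x` to the summand with index `g⁻¹ x`. -/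
def twistEquiv (hF : IsGaloisCovering ρ F) (g : G) (M : KMod k C) (a : A) :
    (⨁ x : Fib F a, ((twist ρ g).obj M).obj.obj x.1) ≃ₗ[k] ⨁ x : Fib F a, M.obj.obj x.1 :=
  reindex k (fibEquiv hF g a) fun x => M.obj.obj x.1

open Classical in
theorem twistEquiv_lof (hF : IsGaloisCovering ρ F) (g : G) (M : KMod k C) (a : A) (x : Fib F a)
    (m : M.obj.obj ((ρ.act g⁻¹).obj x.1)) :
    twistEquiv hF g M a
        (DirectSum.lof k (Fib F a) (fun x => ((twist ρ g).obj M).obj.obj x.1) x m) =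
      DirectSum.lof k (Fib F a) (fun x => M.obj.obj x.1) ((fibEquiv hF g a).symm x) m :=
  reindex_lof k (fibEquiv hF g a) (fun x => M.obj.obj x.1) x m

theorem map_act (hF : IsGaloisCovering ρ F) (g : G) {x y : C} (f : x ⟶ y) :
    F.map ((ρ.act g).map f) =
      eqToHom (hF.obj_act g x) ≫ F.map f ≫ eqToHom (hF.obj_act g y).symm :=
  Functor.congr_hom (hF.comp_eq g) f

open Classical in
/-- The action of `g⁻¹` on families of morphisms with source `x` and target in a fibre. -/
def actFam (hF : IsGaloisCovering ρ F) (g : G) (x : C) (b : A) :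
    (⨁ y : Fib F b, (x ⟶ y.1)) →ₗ[k] ⨁ y : Fib F b, ((ρ.act g⁻¹).obj x ⟶ y.1) :=
  DirectSum.toModule k (Fib F b) _ fun y =>
    (DirectSum.lof k (Fib F b) (fun y => ((ρ.act g⁻¹).obj x ⟶ y.1)) ((fibEquiv hF g b).symm y)) ∘ₗ
      (ρ.act g⁻¹).mapLinearMap k

open Classical in
theorem actFam_lof (hF : IsGaloisCovering ρ F) (g : G) (x : C) (b : A) (y : Fib F b)
    (f : x ⟶ y.1) :
    actFam hF g x b (DirectSum.lof k (Fib F b) (fun y => (x ⟶ y.1)) y f) =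
      DirectSum.lof k (Fib F b) (fun y => ((ρ.act g⁻¹).obj x ⟶ y.1)) ((fibEquiv hF g b).symm y)
        ((ρ.act g⁻¹).map f) := by
  unfold actFam
  erw [DirectSum.toModule_lof k (M := fun y : Fib F b => (x ⟶ y.1)) y f]
  rfl

theorem outMap_actFam (hF : IsGaloisCovering ρ F) (g : G) (x : C) (b : A)
    (s : ⨁ y : Fib F b, (x ⟶ y.1)) :
    outMap k F _ b (actFam hF g x b s) = eqToHom (hF.obj_act g⁻¹ x) ≫ outMap k F x b s := by
  classical
  have h : outMap k F _ b ∘ₗ actFam hF g x b =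
      Linear.leftComp k b (eqToHom (hF.obj_act g⁻¹ x)) ∘ₗ outMap k F x b := by
    refine DirectSum.linearMap_ext _ fun y => LinearMap.ext fun f => ?_
    have e1 := congrArg (outMap k F _ b) (actFam_lof hF g x b y f)
    have e2 := outMap_lof k F _ b ((fibEquiv hF g b).symm y) ((ρ.act g⁻¹).map f)
    have e3 := congrArg (fun t => eqToHom (hF.obj_act g⁻¹ x) ≫ t) (outMap_lof k F x b y f)
    refine (e1.trans e2).trans (Eq.trans ?_ e3.symm)
    exact (congrArg (fun t => t ≫ eqToHom ((hF.obj_act g⁻¹ y.1).trans y.2))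
      (map_act hF g⁻¹ f)).trans (by simp)
  exact LinearMap.congr_fun h s

theorem twistEquiv_evalFam (hF : IsGaloisCovering ρ F) (g : G) (M : KMod k C) (x : C) (b : A)
    (s : ⨁ y : Fib F b, (x ⟶ y.1)) (m : M.obj.obj ((ρ.act g⁻¹).obj x)) :
    twistEquiv hF g M b (evalFam F ((twist ρ g).obj M) x b s m) =
      evalFam F M ((ρ.act g⁻¹).obj x) b (actFam hF g x b s) m := by
  classical
  have h : (twistEquiv hF g M b).toLinearMap ∘ₗ
        (evalFam F ((twist ρ g).obj M) x b).flip m =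
      (evalFam F M ((ρ.act g⁻¹).obj x) b).flip m ∘ₗ actFam hF g x b := by
    refine DirectSum.linearMap_ext _ fun y => LinearMap.ext fun f => ?_
    have e1 := congrArg (twistEquiv hF g M b) (evalFam_lof F ((twist ρ g).obj M) x b y f m)
    have e2 := twistEquiv_lof hF g M b y (M.obj.map ((ρ.act g⁻¹).map f) m)
    have e3 := congrArg (fun t => evalFam F M ((ρ.act g⁻¹).obj x) b t m) (actFam_lof hF g x b y f)
    have e4 := evalFam_lof F M ((ρ.act g⁻¹).obj x) b ((fibEquiv hF g b).symm y)
      ((ρ.act g⁻¹).map f) m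
    exact (e1.trans e2).trans (e3.trans e4).symm
  exact LinearMap.congr_fun h s

/-- The canonical isomorphism between `F_λ(ᵍM)` and `F_λ(M)`. -/
def pushDownTwist (hF : IsGaloisCovering ρ F) (g : G) (M : KMod k C) :
    (pushDown hF).obj ((twist ρ g).obj M) ≅ (pushDown hF).obj M :=
  ObjectProperty.isoMk _ (NatIso.ofComponents (fun a => (twistEquiv hF g M a).toModuleIso)
    (fun {a b} u => by
      classical
      refine ModuleCat.hom_ext (DirectSum.linearMap_ext _ fun x => LinearMap.ext fun m => ?_)
      have e1 := congrArg (twistEquiv hF g M b) (pushMap_lof hF ((twist ρ g).obj M) u x m)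
      have e2 := twistEquiv_evalFam hF g M x.1 b (liftHom hF x.1 b (eqToHom x.2 ≫ u)) m
      have e3 := congrArg (pushMap hF M u) (twistEquiv_lof hF g M a x m)
      have e4 := pushMap_lof hF M u ((fibEquiv hF g a).symm x) m
      have e5 : liftHom hF ((ρ.act g⁻¹).obj x.1) b
          (eqToHom ((fibEquiv hF g a).symm x).2 ≫ u) =
            actFam hF g x.1 b (liftHom hF x.1 b (eqToHom x.2 ≫ u)) := by
        refine liftHom_eq hF _ _ _ _ ?_
        rw [outMap_actFam, outMap_liftHom]
        simp
      refine (e1.trans e2).trans (Eq.trans ?_ (e3.trans e4).symm)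
      exact congrArg (fun t => evalFam F M ((ρ.act g⁻¹).obj x.1) b t m) e5.symm))

/-! ### The covering of the endomorphism category associated with a module of the first kind -/

theorem pullUp_congr {Φ Ψ : C ⥤ C} [Φ.Additive] [Φ.Linear k] [Ψ.Additive] [Ψ.Linear k]
    (h : Φ = Ψ) : pullUp (k := k) Φ = pullUp Ψ := by
  subst h
  rfl

theorem twist_one (ρ : KAction k C G) : twist ρ 1 = 𝟭 (KMod k C) := by
  have h : ρ.act (1 : G)⁻¹ = 𝟭 C := by rw [inv_one, ρ.act_one]
  exact pullUp_congr h

theorem twist_mul (ρ : KAction k C G) (g h : G) : twist ρ (g * h) = twist ρ h ⋙ twist ρ g := by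
  have e : ρ.act (g * h)⁻¹ = ρ.act g⁻¹ ⋙ ρ.act h⁻¹ := by rw [mul_inv_rev, ρ.act_mul]
  exact pullUp_congr e

/-- The `k`-category `End_A(T)` for `T = T_1 ⊕ ⋯ ⊕ T_n`: its objects are the indices `i`, and the
morphisms from `i` to `j` are the morphisms of modules `T_i → T_j`. -/
abbrev EndCat {n : ℕ} (T : Fin n → KMod k A) : Type :=
  InducedCategory (KMod k A) T

/-- The `k`-category whose objects are the modules `ᵍT'_i` (indexed by the pairs `(g, i)`), with
the morphisms of `C`-modules between them as morphisms. -/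
abbrev CoverCat (ρ : KAction k C G) {n : ℕ} (T' : Fin n → KMod k C) : Type u :=
  InducedCategory (KMod k C) fun p : G × Fin n => (twist ρ p.1).obj (T' p.2)

/-- The canonical isomorphism `F_λ(ᵍT'_i) ≅ F_λ(T'_i) ≅ T_i`, where the second isomorphism is
given. -/
def coverIso (hF : IsGaloisCovering ρ F) {n : ℕ} {T : Fin n → KMod k A} {T' : Fin n → KMod k C}
    (lam : ∀ i, (pushDown hF).obj (T' i) ≅ T i) (p : G × Fin n) :
    (pushDown hF).obj ((twist ρ p.1).obj (T' p.2)) ≅ T p.2 :=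
  pushDownTwist hF p.1 (T' p.2) ≪≫ lam p.2

/-- The functor sending `ᵍT'_i` to `T_i` and a morphism `f : ᵍT'_i → ʰT'_j` to the morphism
`F_λ(f) : T_i → T_j`, up to the identifications `F_λ(ᵍT'_i) ≅ T_i`. -/
def coverFunctor (hF : IsGaloisCovering ρ F) {n : ℕ} {T : Fin n → KMod k A}
    {T' : Fin n → KMod k C} (lam : ∀ i, (pushDown hF).obj (T' i) ≅ T i) :
    CoverCat ρ T' ⥤ EndCat T where
  obj p := p.2
  map {p q} f := InducedCategory.homMk
    ((coverIso hF lam p).inv ≫ (pushDown hF).map f.hom ≫ (coverIso hF lam q).hom)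
  map_id p := by
    ext : 1
    simp
  map_comp f g := by
    ext : 1
    simp

instance (hF : IsGaloisCovering ρ F) {n : ℕ} {T : Fin n → KMod k A} {T' : Fin n → KMod k C}
    (lam : ∀ i, (pushDown hF).obj (T' i) ≅ T i) : (coverFunctor hF lam).Additive where
  map_add {p q f g} := by
    ext : 1
    change _ ≫ (pushDown hF).map (f.hom + g.hom) ≫ _ = (_ ≫ _ ≫ _) + (_ ≫ _ ≫ _)
    simp
    rfl

instance (hF : IsGaloisCovering ρ F) {n : ℕ} {T : Fin n → KMod k A} {T' : Fin n → KMod k C}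
    (lam : ∀ i, (pushDown hF).obj (T' i) ≅ T i) : (coverFunctor hF lam).Linear k where
  map_smul {p q} f r := by
    ext : 1
    change _ ≫ (pushDown hF).map (r • f.hom) ≫ _ = r • (_ ≫ _ ≫ _)
    simp
    rfl

theorem eqToHom_hom {n : ℕ} {T' : Fin n → KMod k C} {p q : CoverCat ρ T'} (h : p = q) :
    (eqToHom h).hom = eqToHom (congrArg (fun p : G × Fin n => (twist ρ p.1).obj (T' p.2)) h) := by
  subst h
  rfl

theorem twist_twist_obj (ρ : KAction k C G) (g h : G) (M : KMod k C) :
    (twist ρ (g * h)).obj M = (twist ρ g).obj ((twist ρ h).obj M) :=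
  Functor.congr_obj (twist_mul ρ g h) M

/-- The action of `G` on `CoverCat`: `g` sends `ʰT'_i` to `ᵍʰT'_i` and `f` to `ᵍf`. -/
def coverAction (ρ : KAction k C G) {n : ℕ} (T' : Fin n → KMod k C) :
    KAction k (CoverCat ρ T') G where
  act g :=
    { obj := fun p => (g * p.1, p.2)
      map := fun {p q} f => InducedCategory.homMk
        (eqToHom (twist_twist_obj ρ g p.1 (T' p.2)) ≫ (twist ρ g).map f.hom ≫
          eqToHom (twist_twist_obj ρ g q.1 (T' q.2)).symm)
      map_id := fun p => by
        ext : 1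
        simp
      map_comp := fun f f' => by
        ext : 1
        simp }
  additive g := ⟨fun {p q f f'} => by
    ext : 1
    have e : (twist ρ g).map (f + f').hom = (twist ρ g).map f.hom + (twist ρ g).map f'.hom := rfl
    change _ ≫ (twist ρ g).map (f + f').hom ≫ _ = (_ ≫ _ ≫ _) + (_ ≫ _ ≫ _)
    rw [e]
    simp⟩
  linear g := ⟨fun {p q} f r => by
    ext : 1
    have e : (twist ρ g).map (r • f).hom = r • (twist ρ g).map f.hom := rfl
    change _ ≫ (twist ρ g).map (r • f).hom ≫ _ = r • (_ ≫ _ ≫ _)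
    rw [e]
    simp⟩
  act_one := by
    refine CategoryTheory.Functor.ext (fun p => Prod.ext (one_mul _) rfl) fun p q f => ?_
    ext : 1
    have e := Functor.congr_hom (twist_one ρ) f.hom
    simp only [InducedCategory.comp_hom, InducedCategory.homMk_hom, eqToHom_hom, e,
      Functor.id_map, Category.assoc, eqToHom_trans, eqToHom_trans_assoc]
  act_mul g h := by
    refine CategoryTheory.Functor.ext (fun p => Prod.ext (mul_assoc _ _ _) rfl) fun p q f => ?_
    ext : 1
    have e := Functor.congr_hom (twist_mul ρ g h) f.hom
    simp only [InducedCategory.comp_hom, InducedCategory.homMk_hom, eqToHom_hom, e,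
      Functor.comp_map, Functor.map_comp, eqToHom_map, Category.assoc, eqToHom_trans,
      eqToHom_trans_assoc]

end PushDown

end GalCov

end

/-! The push-down `F_λ` behaves like an orbit functor. Twisting does not change it, `F_λ(ᵍM) ≅ F_λ
M`, and for `M` finite dimensional a morphism `F_λ M → F_λ N` is a finite sum of homogeneous
components, the one of degree `g` coming from a morphism `M → ᵍN`. Taking the component of degree
one retracts `Hom(F_λ M, F_λ N)` onto `Hom(M, N)` and is compatible with composition by morphisms of
`C`-modules. The structure `OrbitFunctor` records these facts; it is self-dual, so each statement
about exchange sequences is proved on one side only.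

Two properties of `T` are propagated: its local summands are push-downs of finite dimensional
modules `Z` (`HasPreimages`), and no such `Z` satisfies `ᵍZ ≅ ʰZ` with `g ≠ h` (`TwistFree`). The
first is being of the first kind. Given the first and that `T` is basic, the second says that `F.T`
is basic, because `F.F_λ Z` is the direct sum of all `ᵍZ` and the Krull–Schmidt–Azumaya argument
applies (`isBasic_pullUp_iff`).

Along an arrow with sequence `0 → X → M → Y → 0`, vanishing of `Ext¹` makes both maps approximations
by `add R`. If `X ≅ F_λ X'`, the map `X → M` factors through the push-down of a monomorphism `X' →
M'`, where `M'` is built from twists of preimages of summands of `R`. The push-down of the cokernel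
`Z'` and `Y` are then isomorphic modulo maps factoring through `add R`, and by locality some summand
of `Z'` has push-down `Y` (`IsExchange.exists_iso_right`). A Schanuel argument transfers
isomorphisms between twists of that summand to isomorphisms between twists of `X'`
(`IsExchange.iso_left_of_iso_right`). With duality, both properties are constant on connected
components.

They hold for `A` and `DA`: the push-downs of `Hom(x, -)` and `D Hom(-, x)` are the corresponding
modules at `F x`, twisting by `g` replaces `x` by `g x`, the action is free and distinct objects of
`C` are not isomorphic.

For endomorphism categories, the homogeneous decomposition is the covering property, and local
boundedness uses that `T` is basic with trivial stabilizers. For connectedness, the start of the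
coresolution `0 → A → T₁ → T₂` begins with a left approximation, and it lifts to a copresentation of
each `Hom(x, -)` by modules `ᵍT'_i`. If these modules split into two mutually orthogonal classes,
each `Hom(x, -)` maps non-trivially to at most one class, which partitions `C`; connectedness of `C`
makes the partition trivial. -/

noncomputable section

namespace GalCov

/-! ### Ideals of morphisms factoring through a class of objects -/

section FactorIdeal

variable {𝒟 : Type*} [Category 𝒟] [Preadditive 𝒟]

/-- The morphisms `X ⟶ Y` which are sums of morphisms factoring through objects of `Q`. -/
def factorIdeal (Q : ObjectProperty 𝒟) (X Y : 𝒟) : AddSubgroup (X ⟶ Y) :=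
  AddSubgroup.closure {φ | ∃ (R : 𝒟) (_ : Q R) (a : X ⟶ R) (b : R ⟶ Y), φ = a ≫ b}

variable {Q Q' : ObjectProperty 𝒟} {X Y Z : 𝒟}

theorem comp_mem_factorIdeal {R : 𝒟} (hR : Q R) (a : X ⟶ R) (b : R ⟶ Y) :
    a ≫ b ∈ factorIdeal Q X Y :=
  AddSubgroup.subset_closure ⟨R, hR, a, b, rfl⟩

theorem factorIdeal_comp {φ : X ⟶ Y} (hφ : φ ∈ factorIdeal Q X Y) (ψ : Y ⟶ Z) :
    φ ≫ ψ ∈ factorIdeal Q X Z := by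
  induction hφ using AddSubgroup.closure_induction with
  | mem _ h =>
    obtain ⟨R, hR, a, b, rfl⟩ := h
    rw [Category.assoc]
    exact comp_mem_factorIdeal hR _ _
  | zero => rw [zero_comp]; exact zero_mem _
  | add _ _ _ _ h₁ h₂ => rw [Preadditive.add_comp]; exact add_mem h₁ h₂
  | neg _ _ h => rw [Preadditive.neg_comp]; exact neg_mem h

theorem comp_factorIdeal (ψ : X ⟶ Y) {φ : Y ⟶ Z} (hφ : φ ∈ factorIdeal Q Y Z) :
    ψ ≫ φ ∈ factorIdeal Q X Z := by
  induction hφ using AddSubgroup.closure_induction with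
  | mem _ h =>
    obtain ⟨R, hR, a, b, rfl⟩ := h
    rw [← Category.assoc]
    exact comp_mem_factorIdeal hR _ _
  | zero => rw [comp_zero]; exact zero_mem _
  | add _ _ _ _ h₁ h₂ => rw [Preadditive.comp_add]; exact add_mem h₁ h₂
  | neg _ _ h => rw [Preadditive.comp_neg]; exact neg_mem h

/-- The condition `𝟙 X ∈ factorIdeal Q X X` encodes that `X` lies in the additive closure of `Q`:
the identity is then a finite sum of maps through objects of `Q`, so `X` is a retract of a finite
direct sum of them. In this form no direct sum has to be chosen. -/
theorem factorIdeal_of_id_left (h : 𝟙 X ∈ factorIdeal Q X X) (φ : X ⟶ Y) :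
    φ ∈ factorIdeal Q X Y := by
  simpa using factorIdeal_comp h φ

theorem factorIdeal_of_id_right (h : 𝟙 Y ∈ factorIdeal Q Y Y) (φ : X ⟶ Y) :
    φ ∈ factorIdeal Q X Y := by
  simpa using comp_factorIdeal φ h

theorem factorIdeal_le (h : ∀ R, Q R → 𝟙 R ∈ factorIdeal Q' R R) :
    factorIdeal Q X Y ≤ factorIdeal Q' X Y := by
  refine (AddSubgroup.closure_le _).2 ?_
  rintro _ ⟨R, hR, a, b, rfl⟩
  exact comp_factorIdeal a (factorIdeal_of_id_left (h R hR) b)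

theorem id_mem_factorIdeal (h : Q X) : 𝟙 X ∈ factorIdeal Q X X := by
  simpa using comp_mem_factorIdeal h (𝟙 X) (𝟙 X)

theorem id_mem_factorIdeal_of_retract (r : Retract X Y) (h : 𝟙 Y ∈ factorIdeal Q Y Y) :
    𝟙 X ∈ factorIdeal Q X X := by
  simpa using comp_factorIdeal r.i (factorIdeal_comp h r.r)

theorem id_mem_factorIdeal_biprod [HasBinaryBiproducts 𝒟] (hX : 𝟙 X ∈ factorIdeal Q X X)
    (hY : 𝟙 Y ∈ factorIdeal Q Y Y) : 𝟙 (X ⊞ Y) ∈ factorIdeal Q (X ⊞ Y) (X ⊞ Y) := by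
  rw [← biprod.total]
  exact add_mem (comp_factorIdeal _ (factorIdeal_of_id_left hX _))
    (comp_factorIdeal _ (factorIdeal_of_id_left hY _))

theorem id_mem_factorIdeal_of_isZero (h : IsZero X) : 𝟙 X ∈ factorIdeal Q X X := by
  rw [h.eq_of_src (𝟙 X) 0]
  exact zero_mem _

theorem factorIdeal_op {φ : X ⟶ Y} (hφ : φ ∈ factorIdeal Q X Y) :
    φ.op ∈ factorIdeal Q.op (Opposite.op Y) (Opposite.op X) := by
  induction hφ using AddSubgroup.closure_induction with
  | mem _ h =>
    obtain ⟨R, hR, a, b, rfl⟩ := h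
    exact comp_mem_factorIdeal (Q := Q.op) (R := Opposite.op R) hR b.op a.op
  | zero => exact zero_mem _
  | add _ _ _ _ h₁ h₂ => exact add_mem h₁ h₂
  | neg _ _ h => exact neg_mem h

theorem factorIdeal_map {𝒟' : Type*} [Category 𝒟'] [Preadditive 𝒟'] (Φ : 𝒟 ⥤ 𝒟') [Φ.Additive]
    {Q'' : ObjectProperty 𝒟'} (h : ∀ R, Q R → Q'' (Φ.obj R)) {φ : X ⟶ Y}
    (hφ : φ ∈ factorIdeal Q X Y) : Φ.map φ ∈ factorIdeal Q'' (Φ.obj X) (Φ.obj Y) := by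
  induction hφ using AddSubgroup.closure_induction with
  | mem _ h' =>
    obtain ⟨R, hR, a, b, rfl⟩ := h'
    rw [Φ.map_comp]
    exact comp_mem_factorIdeal (h R hR) _ _
  | zero => rw [Φ.map_zero]; exact zero_mem _
  | add _ _ _ _ h₁ h₂ => rw [Φ.map_add]; exact add_mem h₁ h₂
  | neg _ _ h => rw [Φ.map_neg]; exact neg_mem h

/-- If `f` extends along `g` for all maps `f` to objects of `Q`, it does so for all `f` in the ideal
defined by `Q`. -/
theorem exists_extension {M : 𝒟} (g : X ⟶ M)
    (h : ∀ R, Q R → ∀ f : X ⟶ R, ∃ f' : M ⟶ R, g ≫ f' = f) {f : X ⟶ Y}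
    (hf : f ∈ factorIdeal Q X Y) : ∃ f' : M ⟶ Y, g ≫ f' = f := by
  induction hf using AddSubgroup.closure_induction with
  | mem _ h' =>
    obtain ⟨R, hR, a, b, rfl⟩ := h'
    obtain ⟨a', rfl⟩ := h R hR a
    exact ⟨a' ≫ b, by simp⟩
  | zero => exact ⟨0, by simp⟩
  | add _ _ _ _ h₁ h₂ =>
    obtain ⟨a, rfl⟩ := h₁
    obtain ⟨b, rfl⟩ := h₂
    exact ⟨a + b, by simp⟩
  | neg _ _ h =>
    obtain ⟨a, rfl⟩ := h
    exact ⟨-a, by simp⟩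

theorem exists_lifting {M : 𝒟} (g : M ⟶ Y)
    (h : ∀ R, Q R → ∀ f : R ⟶ Y, ∃ f' : R ⟶ M, f' ≫ g = f) {f : X ⟶ Y}
    (hf : f ∈ factorIdeal Q X Y) : ∃ f' : X ⟶ M, f' ≫ g = f := by
  induction hf using AddSubgroup.closure_induction with
  | mem _ h' =>
    obtain ⟨R, hR, a, b, rfl⟩ := h'
    obtain ⟨b', rfl⟩ := h R hR b
    exact ⟨a ≫ b', by simp⟩
  | zero => exact ⟨0, by simp⟩
  | add _ _ _ _ h₁ h₂ =>
    obtain ⟨a, rfl⟩ := h₁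
    obtain ⟨b, rfl⟩ := h₂
    exact ⟨a + b, by simp⟩
  | neg _ _ h =>
    obtain ⟨a, rfl⟩ := h
    exact ⟨-a, by simp⟩

end FactorIdeal

/-! ### Objects with local endomorphism rings -/

section LocalObjects

variable {𝒟 : Type*} [Category 𝒟] [Preadditive 𝒟] {X Y Z : 𝒟}

theorem isIso_neg (a : X ⟶ Y) [IsIso a] : IsIso (-a) :=
  ⟨-inv a, by simp, by simp⟩

/-- Locality in the form used throughout: non-isomorphisms are closed under addition, so an
invertible sum of endomorphisms always has an invertible term. -/
theorem isIso_or_isIso_of_add [IsLocalRing (End X)] (a b : X ⟶ X) (h : IsIso (a + b)) :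
    IsIso a ∨ IsIso b := by
  have h' : IsUnit (show End X from a + b) := (isUnit_iff_isIso _).2 h
  rcases IsLocalRing.isUnit_or_isUnit_of_isUnit_add (R := End X) h' with h | h
  · exact Or.inl ((isUnit_iff_isIso _).1 h)
  · exact Or.inr ((isUnit_iff_isIso _).1 h)

theorem isIso_or_isIso_of_add_eq_id [IsLocalRing (End X)] (a b : X ⟶ X) (h : a + b = 𝟙 X) :
    IsIso a ∨ IsIso b :=
  isIso_or_isIso_of_add a b (h ▸ inferInstance)

theorem not_isZero_of_isLocalRing [IsLocalRing (End X)] : ¬ IsZero X := fun h =>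
  one_ne_zero (α := End X) (h.eq_of_src _ _)

theorem isLocalRing_end_of_forall (h₀ : ¬ IsZero X) (h : ∀ a : X ⟶ X, IsIso a ∨ IsIso (𝟙 X - a)) :
    IsLocalRing (End X) := by
  have : Nontrivial (End X) := ⟨1, 0, fun h => h₀ ((IsZero.iff_id_eq_zero X).2 h)⟩
  refine IsLocalRing.of_isUnit_or_isUnit_one_sub_self fun a => ?_
  exact (h a).imp (fun h => (isUnit_iff_isIso _).2 h) (fun h => (isUnit_iff_isIso _).2 h)

theorem IsIso.of_local_comp {X Y : 𝒟} [IsLocalRing (End Y)] (a : X ⟶ Y) (b : Y ⟶ X)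
    [IsIso (a ≫ b)] (hX : ¬ IsZero X) : IsIso a := by
  -- `b ≫ c ≫ a` is an idempotent, where `c` is the inverse of `a ≫ b`
  set c := inv (a ≫ b)
  have h₁ : a ≫ b ≫ c = 𝟙 X := by rw [← Category.assoc]; exact IsIso.hom_inv_id _
  rcases isIso_or_isIso_of_add_eq_id (b ≫ c ≫ a) (𝟙 Y - b ≫ c ≫ a) (by simp) with h | h
  · have hid : (b ≫ c ≫ a) ≫ (b ≫ c ≫ a) = b ≫ c ≫ a := by
      simp only [Category.assoc]; rw [reassoc_of% h₁]
    have : b ≫ c ≫ a = 𝟙 Y := by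
      rw [← cancel_epi (b ≫ c ≫ a), hid, Category.comp_id]
    exact ⟨b ≫ c, h₁, by simpa using this⟩
  -- An idempotent with invertible complement is zero; since `a` is fixed by it, `a = 0`, against `X
  -- ≠ 0`.
  · exfalso
    have : a ≫ (𝟙 Y - b ≫ c ≫ a) = 0 := by
      rw [Preadditive.comp_sub, reassoc_of% h₁, Category.comp_id, sub_self]
    have ha : a = 0 := by rwa [← cancel_mono (𝟙 Y - b ≫ c ≫ a), zero_comp]
    exact hX ((IsZero.iff_id_eq_zero X).2 (by rw [← h₁, ha, zero_comp]))

/-- A non-zero retract of an object with local endomorphism ring is isomorphic to it. -/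
theorem iso_of_retract [IsLocalRing (End Y)] (r : Retract X Y) (hX : ¬ IsZero X) :
    Nonempty (X ≅ Y) := by
  have : IsIso (r.i ≫ r.r) := by rw [r.retract]; infer_instance
  have := IsIso.of_local_comp r.i r.r hX
  exact ⟨asIso r.i⟩

/-- An object is a retract of `Y` as soon as some composition `X ⟶ Y ⟶ X` is invertible. -/
def retractOfIsIso (a : X ⟶ Y) (b : Y ⟶ X) [IsIso (a ≫ b)] : Retract X Y where
  i := a
  r := b ≫ inv (a ≫ b)
  retract := by rw [← Category.assoc]; exact IsIso.hom_inv_id _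

theorem isLocalRing_end_of_iso (e : X ≅ Y) [IsLocalRing (End Y)] : IsLocalRing (End X) := by
  refine isLocalRing_end_of_forall (fun h => not_isZero_of_isLocalRing (h.of_iso e.symm))
    fun a => ?_
  have key : ∀ b : X ⟶ X, IsIso (e.inv ≫ b ≫ e.hom) → IsIso b := fun b hb => by
    have : b = e.hom ≫ (e.inv ≫ b ≫ e.hom) ≫ e.inv := by simp
    rw [this]; infer_instance
  exact (isIso_or_isIso_of_add_eq_id (e.inv ≫ a ≫ e.hom) (e.inv ≫ (𝟙 X - a) ≫ e.hom)
    (by simp)).imp (key _) (key _)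

theorem isLocalRing_end_op [IsLocalRing (End X)] : IsLocalRing (End (Opposite.op X)) := by
  refine isLocalRing_end_of_forall
    (fun h => not_isZero_of_isLocalRing h.unop) fun a => ?_
  refine (isIso_or_isIso_of_add_eq_id a.unop (𝟙 X - a.unop) (by simp)).imp (fun h => ?_)
    fun h => ?_
  · exact (isIso_unop_iff a).1 h
  · exact (isIso_unop_iff (𝟙 (Opposite.op X) - a)).1 h

variable {Q : ObjectProperty 𝒟}

/-- If `Y` were a retract of no object of `Q`, no composition through `Q` would be invertible, and
by locality neither would any sum of such compositions. -/
theorem exists_retract_of_isIso_mem [IsLocalRing (End Y)] {φ : Y ⟶ Y}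
    (hφ : φ ∈ factorIdeal Q Y Y) (h : IsIso φ) : ∃ R, Q R ∧ Nonempty (Retract Y R) := by
  by_contra! hne
  suffices H : ∀ φ ∈ factorIdeal Q Y Y, ¬ IsIso φ from H φ hφ h
  intro φ hφ
  induction hφ using AddSubgroup.closure_induction with
  | mem _ h' =>
    obtain ⟨R, hR, a, b, rfl⟩ := h'
    exact fun _ => (hne R hR).false (retractOfIsIso a b)
  | zero =>
    exact fun h => not_isZero_of_isLocalRing (X := Y)
      ((IsZero.iff_id_eq_zero Y).2 (by rw [← IsIso.hom_inv_id (0 : Y ⟶ Y), zero_comp]))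
  | add a b _ _ h₁ h₂ => exact fun h => (isIso_or_isIso_of_add a b h).elim h₁ h₂
  | neg a _ h₁ =>
    intro h
    refine h₁ ?_
    rw [← neg_neg a]
    exact isIso_neg (-a)

theorem exists_retract_of_id_mem [IsLocalRing (End Y)] (h : 𝟙 Y ∈ factorIdeal Q Y Y) :
    ∃ R, Q R ∧ Nonempty (Retract Y R) :=
  exists_retract_of_isIso_mem h inferInstance

/-- `X` is a finite direct sum of objects of `Q` which are retracts of `X`. -/
def IsDecomposable (Q : ObjectProperty 𝒟) (X : 𝒟) : Prop :=
  𝟙 X ∈ AddSubgroup.closure {φ : X ⟶ X | ∃ (L : 𝒟) (_ : Q L) (r : Retract L X), φ = r.r ≫ r.i}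

theorem IsDecomposable.id_mem {X : 𝒟} (h : IsDecomposable Q X) :
    𝟙 X ∈ factorIdeal (fun L => Q L ∧ Nonempty (Retract L X)) X X := by
  refine AddSubgroup.closure_mono ?_ h
  rintro _ ⟨L, hL, r, rfl⟩
  exact ⟨L, ⟨hL, ⟨r⟩⟩, r.r, r.i, rfl⟩

theorem IsDecomposable.exists_retract {X : 𝒟} (h : IsDecomposable Q X) (hX : ¬ IsZero X) :
    ∃ L, Q L ∧ Nonempty (Retract L X) := by
  by_contra! hne
  refine hX ((IsZero.iff_id_eq_zero X).2 ?_)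
  have h' : {φ : X ⟶ X | ∃ (L : 𝒟) (_ : Q L) (r : Retract L X), φ = r.r ≫ r.i} = ∅ := by
    refine Set.eq_empty_of_forall_notMem ?_
    rintro _ ⟨L, hL, r, -⟩
    exact (hne L hL).false r
  have h₁ := h
  rw [IsDecomposable, h', AddSubgroup.closure_empty, AddSubgroup.mem_bot] at h₁
  exact h₁

/-- If `Y` has local endomorphism ring and `α ∘ β` is invertible, where `X` is decomposed, then some
summand of `X` occurs in the composition. -/
theorem IsDecomposable.exists_isIso {𝒟' : Type*} [Category 𝒟'] [Preadditive 𝒟'] (Φ : 𝒟 ⥤ 𝒟')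
    [Φ.Additive] {X : 𝒟} (h : IsDecomposable Q X)
    {Y : 𝒟'} [IsLocalRing (End Y)] (a : Y ⟶ Φ.obj X) (b : Φ.obj X ⟶ Y) (hab : IsIso (a ≫ b)) :
    ∃ (L : 𝒟) (_ : Q L) (r : Retract L X), IsIso (a ≫ Φ.map (r.r ≫ r.i) ≫ b) := by
  by_contra! hne
  suffices H : ∀ φ ∈ AddSubgroup.closure
      {φ : X ⟶ X | ∃ (L : 𝒟) (_ : Q L) (r : Retract L X), φ = r.r ≫ r.i},
      ¬ IsIso (a ≫ Φ.map φ ≫ b) from H _ h (by simpa using hab)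
  intro φ hφ
  induction hφ using AddSubgroup.closure_induction with
  | mem _ h' =>
    obtain ⟨L, hL, r, rfl⟩ := h'
    exact hne L hL r
  | zero =>
    intro h
    rw [Φ.map_zero, zero_comp, comp_zero] at h
    exact not_isZero_of_isLocalRing (X := Y)
      ((IsZero.iff_id_eq_zero Y).2 (by rw [← IsIso.hom_inv_id (0 : Y ⟶ Y), zero_comp]))
  | add a b _ _ h₁ h₂ =>
    intro h
    rw [Φ.map_add, Preadditive.add_comp, Preadditive.comp_add] at h
    exact (isIso_or_isIso_of_add _ _ h).elim h₁ h₂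
  | neg c _ h₁ =>
    intro h
    refine h₁ ?_
    have : a ≫ Φ.map c ≫ b = -(a ≫ Φ.map (-c) ≫ b) := by simp
    rw [this]
    exact isIso_neg _

theorem IsDecomposable.op {X : 𝒟} (h : IsDecomposable Q X) :
    IsDecomposable Q.op (Opposite.op X) := by
  suffices H : ∀ φ ∈ AddSubgroup.closure
      {φ : X ⟶ X | ∃ (L : 𝒟) (_ : Q L) (r : Retract L X), φ = r.r ≫ r.i},
      φ.op ∈ AddSubgroup.closure {φ : Opposite.op X ⟶ Opposite.op X |
        ∃ (L : 𝒟ᵒᵖ) (_ : Q.op L) (r : Retract L (Opposite.op X)), φ = r.r ≫ r.i} from H _ h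
  intro φ hφ
  induction hφ using AddSubgroup.closure_induction with
  | mem _ h' =>
    obtain ⟨L, hL, r, rfl⟩ := h'
    exact AddSubgroup.subset_closure ⟨Opposite.op L, hL, r.op, rfl⟩
  | zero => exact zero_mem _
  | add _ _ _ _ h₁ h₂ => exact add_mem h₁ h₂
  | neg _ _ h => exact neg_mem h

end LocalObjects

/-! ### Orbit functors -/

section Orbit

variable {𝒳 𝒴 : Type*} [Category 𝒳] [Category 𝒴] [Abelian 𝒳] [Abelian 𝒴]

/-- The formal properties of a push-down functor `P`: `G` acts on `𝒳`, the functor `P` is invariant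
under `G`, and the morphisms `P X ⟶ P Y` are graded by `G` for the objects `X`, `Y` satisfying `fd`,
the component of degree `1` being given by `E`. -/
structure OrbitFunctor (P : 𝒳 ⥤ 𝒴) (G : Type*) where
  t : G → 𝒳 ⥤ 𝒳
  θ : ∀ g, t g ⋙ P ≅ P
  E : ∀ {X Y : 𝒳}, (P.obj X ⟶ P.obj Y) →+ (X ⟶ Y)
  E_map_comp : ∀ {X Y Z : 𝒳} (a : X ⟶ Y) (φ : P.obj Y ⟶ P.obj Z), E (P.map a ≫ φ) = a ≫ E φ
  E_comp_map : ∀ {X Y Z : 𝒳} (φ : P.obj X ⟶ P.obj Y) (a : Y ⟶ Z), E (φ ≫ P.map a) = E φ ≫ a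
  E_id : ∀ X : 𝒳, E (𝟙 (P.obj X)) = 𝟙 X
  fd : ObjectProperty 𝒳
  -- Finite dimensionality keeps the number of homogeneous components finite; maps between arbitrary
  -- push-downs may have infinitely many.
  span_left : ∀ {X Y : 𝒳}, fd X → fd Y → ∀ φ : P.obj X ⟶ P.obj Y,
    φ ∈ AddSubgroup.closure
      {ψ | ∃ (g : G) (a : X ⟶ (t g).obj Y), ψ = P.map a ≫ (θ g).hom.app Y}
  span_right : ∀ {X Y : 𝒳}, fd X → fd Y → ∀ φ : P.obj X ⟶ P.obj Y,
    φ ∈ AddSubgroup.closure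
      {ψ | ∃ (g : G) (a : (t g).obj X ⟶ Y), ψ = (θ g).inv.app X ≫ P.map a}
  t_additive : ∀ g, (t g).Additive
  t_limits : ∀ g, PreservesFiniteLimits (t g)
  t_colimits : ∀ g, PreservesFiniteColimits (t g)
  fd_zero : ∀ {X : 𝒳}, IsZero X → fd X
  fd_biprod : ∀ {X Y : 𝒳}, fd X → fd Y → fd (X ⊞ Y)
  fd_mono : ∀ {X Y : 𝒳} (f : X ⟶ Y) [Mono f], fd Y → fd X
  fd_epi : ∀ {X Y : 𝒳} (f : X ⟶ Y) [Epi f], fd X → fd Y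
  fd_t : ∀ (g : G) {X : 𝒳}, fd X → fd ((t g).obj X)
  decomp : ∀ {X : 𝒳}, fd X → IsDecomposable (fun L => IsLocalRing (End L)) X
  -- Required in addition to `decomp`, since `P` need not send local objects to local objects.
  decomp_obj : ∀ {X : 𝒳}, fd X → ∀ {K : 𝒴}, Retract K (P.obj X) →
    IsDecomposable (fun L => IsLocalRing (End L)) K

attribute [instance] OrbitFunctor.t_additive OrbitFunctor.t_limits OrbitFunctor.t_colimits

namespace OrbitFunctor

variable {P : 𝒳 ⥤ 𝒴} {G : Type*}

theorem E_map (O : OrbitFunctor P G) {X Y : 𝒳} (a : X ⟶ Y) : O.E (P.map a) = a := by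
  simpa [O.E_id] using O.E_map_comp a (𝟙 _)

theorem map_injective (O : OrbitFunctor P G) {X Y : 𝒳} {a b : X ⟶ Y} (h : P.map a = P.map b) :
    a = b := by
  rw [← O.E_map a, h, O.E_map]

theorem fd_retract (O : OrbitFunctor P G) {X Y : 𝒳} (r : Retract X Y) (h : O.fd Y) : O.fd X := by
  have : Mono r.i := ⟨fun a b h => by simpa using congrArg (· ≫ r.r) h⟩
  exact O.fd_mono r.i h

/-- The opposite of an orbit functor. -/
def op (O : OrbitFunctor P G) : OrbitFunctor P.op G where
  t g := (O.t g).op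
  θ g := NatIso.op (O.θ g).symm
  E := 
    { toFun := fun φ => (O.E φ.unop).op
      map_zero' := by simp
      map_add' := fun a b => by simp }
  E_map_comp a φ := Quiver.Hom.unop_inj (O.E_comp_map φ.unop a.unop)
  E_comp_map φ a := Quiver.Hom.unop_inj (O.E_map_comp a.unop φ.unop)
  E_id X := Quiver.Hom.unop_inj (O.E_id X.unop)
  fd := O.fd.op
  span_left {X Y} hX hY φ := by
    suffices H : ∀ ψ ∈ AddSubgroup.closure {ψ : P.obj Y.unop ⟶ P.obj X.unop | ∃ (g : G)
        (a : (O.t g).obj Y.unop ⟶ X.unop), ψ = (O.θ g).inv.app Y.unop ≫ P.map a},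
        ψ.op ∈ AddSubgroup.closure {ψ : P.op.obj X ⟶ P.op.obj Y | ∃ (g : G)
        (a : X ⟶ (O.t g).op.obj Y), ψ = P.op.map a ≫ (NatIso.op (O.θ g).symm).hom.app Y} from
      H _ (O.span_right hY hX φ.unop)
    intro ψ hψ
    induction hψ using AddSubgroup.closure_induction with
    | mem _ h =>
      obtain ⟨g, a, rfl⟩ := h
      exact AddSubgroup.subset_closure ⟨g, a.op, rfl⟩
    | zero => exact zero_mem _
    | add _ _ _ _ h₁ h₂ => exact add_mem h₁ h₂
    | neg _ _ h => exact neg_mem h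
  span_right {X Y} hX hY φ := by
    suffices H : ∀ ψ ∈ AddSubgroup.closure {ψ : P.obj Y.unop ⟶ P.obj X.unop | ∃ (g : G)
        (a : Y.unop ⟶ (O.t g).obj X.unop), ψ = P.map a ≫ (O.θ g).hom.app X.unop},
        ψ.op ∈ AddSubgroup.closure {ψ : P.op.obj X ⟶ P.op.obj Y | ∃ (g : G)
        (a : (O.t g).op.obj X ⟶ Y), ψ = (NatIso.op (O.θ g).symm).inv.app X ≫ P.op.map a} from
      H _ (O.span_left hY hX φ.unop)
    intro ψ hψ
    induction hψ using AddSubgroup.closure_induction with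
    | mem _ h =>
      obtain ⟨g, a, rfl⟩ := h
      exact AddSubgroup.subset_closure ⟨g, a.op, rfl⟩
    | zero => exact zero_mem _
    | add _ _ _ _ h₁ h₂ => exact add_mem h₁ h₂
    | neg _ _ h => exact neg_mem h
  t_additive g := inferInstance
  t_limits g := preservesFiniteLimits_op (O.t g)
  t_colimits g := preservesFiniteColimits_op (O.t g)
  fd_zero h := O.fd_zero h.unop
  fd_biprod {X Y} hX hY := by
    -- The object underlying a biproduct in the opposite category is a biproduct only up to
    -- isomorphism; one half of that isomorphism is enough.
    have r : Retract (X ⊞ Y).unop (X.unop ⊞ Y.unop) :=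
      { i := biprod.lift (biprod.inl : X ⟶ _).unop (biprod.inr : Y ⟶ _).unop
        r := biprod.desc (biprod.fst : _ ⟶ X).unop (biprod.snd : _ ⟶ Y).unop
        retract := by
          rw [biprod.lift_desc, ← unop_comp, ← unop_comp, ← unop_add, biprod.total, unop_id] }
    exact O.fd_retract r (O.fd_biprod hX hY)
  fd_mono f _ h := O.fd_epi f.unop h
  fd_epi f _ h := O.fd_mono f.unop h
  fd_t g _ h := O.fd_t g h
  decomp {X} h := by
    have := (O.decomp h).op
    refine AddSubgroup.closure_mono ?_ this
    rintro _ ⟨L, hL, r, rfl⟩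
    have : IsLocalRing (End L.unop) := hL
    exact ⟨L, isLocalRing_end_op (X := L.unop), r, rfl⟩
  decomp_obj {X} h K r := by
    have := (O.decomp_obj h (K := K.unop) ⟨r.r.unop, r.i.unop, by
      rw [← unop_comp, r.retract, unop_id]⟩).op
    refine AddSubgroup.closure_mono ?_ this
    rintro _ ⟨L, hL, r, rfl⟩
    have : IsLocalRing (End L.unop) := hL
    exact ⟨L, isLocalRing_end_op (X := L.unop), r, rfl⟩


/-- The class of the objects `P R` with `R` in `𝓡`. -/
def _root_.GalCov.imageProp (P : 𝒳 ⥤ 𝒴) (𝓡 : ObjectProperty 𝒳) : ObjectProperty 𝒴 :=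
  fun Y => ∃ R, 𝓡 R ∧ Y = P.obj R

variable {𝓡 : ObjectProperty 𝒳}

/-- A map `P X ⟶ P R` is a sum of components `P a ≫ θ` with `a : X ⟶ t g R`, so it factors through
the image of a map from `X` to the biproduct of the twists involved. This is how approximations in
`𝒴` are brought back to `𝒳`. -/
theorem exists_factor [P.Additive] (O : OrbitFunctor P G) (h𝓡 : ∀ R, 𝓡 R → O.fd R)
    (ht : ∀ g R, 𝓡 R → 𝓡 ((O.t g).obj R)) {X : 𝒳} (hX : O.fd X) {M : 𝒴} {φ : P.obj X ⟶ M}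
    (hφ : φ ∈ factorIdeal (imageProp P 𝓡) (P.obj X) M) :
    ∃ (M' : 𝒳) (f : X ⟶ M') (w : P.obj M' ⟶ M), O.fd M' ∧ 𝟙 M' ∈ factorIdeal 𝓡 M' M' ∧
      P.map f ≫ w = φ := by
  have hzero : ∀ {M : 𝒴}, ∃ (M' : 𝒳) (f : X ⟶ M') (w : P.obj M' ⟶ M),
      O.fd M' ∧ 𝟙 M' ∈ factorIdeal 𝓡 M' M' ∧ P.map f ≫ w = 0 := fun {M} =>
    ⟨(HasZeroObject.zero' 𝒳).zero, 0, 0, O.fd_zero (isZero_zero _),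
      id_mem_factorIdeal_of_isZero (isZero_zero _), by simp⟩
  have hadd : ∀ {M : 𝒴} {φ ψ : P.obj X ⟶ M},
      (∃ (M' : 𝒳) (f : X ⟶ M') (w : P.obj M' ⟶ M),
        O.fd M' ∧ 𝟙 M' ∈ factorIdeal 𝓡 M' M' ∧ P.map f ≫ w = φ) →
      (∃ (M' : 𝒳) (f : X ⟶ M') (w : P.obj M' ⟶ M),
        O.fd M' ∧ 𝟙 M' ∈ factorIdeal 𝓡 M' M' ∧ P.map f ≫ w = ψ) →
      ∃ (M' : 𝒳) (f : X ⟶ M') (w : P.obj M' ⟶ M),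
        O.fd M' ∧ 𝟙 M' ∈ factorIdeal 𝓡 M' M' ∧ P.map f ≫ w = φ + ψ := by
    rintro M _ _ ⟨M₁, f₁, w₁, h₁, h₁', rfl⟩ ⟨M₂, f₂, w₂, h₂, h₂', rfl⟩
    refine ⟨M₁ ⊞ M₂, biprod.lift f₁ f₂, P.map biprod.fst ≫ w₁ + P.map biprod.snd ≫ w₂,
      O.fd_biprod h₁ h₂, id_mem_factorIdeal_biprod h₁' h₂', ?_⟩
    rw [Preadditive.comp_add, ← Category.assoc, ← Category.assoc, ← P.map_comp, ← P.map_comp,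
      biprod.lift_fst, biprod.lift_snd]
  have hneg : ∀ {M : 𝒴} {φ : P.obj X ⟶ M},
      (∃ (M' : 𝒳) (f : X ⟶ M') (w : P.obj M' ⟶ M),
        O.fd M' ∧ 𝟙 M' ∈ factorIdeal 𝓡 M' M' ∧ P.map f ≫ w = φ) →
      ∃ (M' : 𝒳) (f : X ⟶ M') (w : P.obj M' ⟶ M),
        O.fd M' ∧ 𝟙 M' ∈ factorIdeal 𝓡 M' M' ∧ P.map f ≫ w = -φ := by
    rintro M _ ⟨M₁, f₁, w₁, h₁, h₁', rfl⟩
    exact ⟨M₁, f₁, -w₁, h₁, h₁', by simp⟩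
  induction hφ using AddSubgroup.closure_induction with
  | mem _ h =>
    obtain ⟨_, ⟨R, hR, rfl⟩, a, b, rfl⟩ := h
    have key : ∃ (M' : 𝒳) (f : X ⟶ M') (w : P.obj M' ⟶ P.obj R),
        O.fd M' ∧ 𝟙 M' ∈ factorIdeal 𝓡 M' M' ∧ P.map f ≫ w = a := by
      have ha := O.span_left hX (h𝓡 R hR) a
      induction ha using AddSubgroup.closure_induction with
      | mem _ h =>
        obtain ⟨g, a, rfl⟩ := h
        exact ⟨_, a, (O.θ g).hom.app R, O.fd_t g (h𝓡 R hR), id_mem_factorIdeal (ht g R hR), rfl⟩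
      | zero => exact hzero
      | add _ _ _ _ h₁ h₂ => exact hadd h₁ h₂
      | neg _ _ h => exact hneg h
    obtain ⟨M', f, w, h₁, h₂, rfl⟩ := key
    exact ⟨M', f, w ≫ b, h₁, h₂, by simp⟩
  | zero => exact hzero
  | add _ _ _ _ h₁ h₂ => exact hadd h₁ h₂
  | neg _ _ h => exact hneg h

/-- Splitting the first factor of a composition through `P R` into homogeneous components, `E` turns
each term into a composition through a twist of `R`, which is again in `𝓡`. -/
theorem E_mem_factorIdeal (O : OrbitFunctor P G) (h𝓡 : ∀ R, 𝓡 R → O.fd R)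
    (ht : ∀ g R, 𝓡 R → 𝓡 ((O.t g).obj R)) {X Y : 𝒳} (hX : O.fd X) {φ : P.obj X ⟶ P.obj Y}
    (hφ : φ ∈ factorIdeal (imageProp P 𝓡) (P.obj X) (P.obj Y)) :
    O.E φ ∈ factorIdeal 𝓡 X Y := by
  induction hφ using AddSubgroup.closure_induction with
  | mem _ h =>
    obtain ⟨_, ⟨R, hR, rfl⟩, a, b, rfl⟩ := h
    have ha := O.span_left hX (h𝓡 R hR) a
    induction ha using AddSubgroup.closure_induction with
    | mem _ h =>
      obtain ⟨g, a, rfl⟩ := h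
      rw [Category.assoc, O.E_map_comp]
      exact comp_mem_factorIdeal (ht g R hR) _ _
    | zero => rw [zero_comp, map_zero]; exact zero_mem _
    | add _ _ _ _ h₁ h₂ => rw [Preadditive.add_comp, map_add]; exact add_mem h₁ h₂
    | neg _ _ h => rw [Preadditive.neg_comp, map_neg]; exact neg_mem h
  | zero => rw [map_zero]; exact zero_mem _
  | add _ _ _ _ h₁ h₂ => rw [map_add]; exact add_mem h₁ h₂
  | neg _ _ h => rw [map_neg]; exact neg_mem h

/-- The identity of `X` is `E (r.i ≫ r.r)`. Decomposing `r.i` writes it as a sum of endomorphisms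
factoring through twists of `Y`, and locality of `X` selects an invertible one. -/
theorem exists_retract_twist (O : OrbitFunctor P G) {X Y : 𝒳} (hX : O.fd X) (hY : O.fd Y)
    [IsLocalRing (End X)] (r : Retract (P.obj X) (P.obj Y)) :
    ∃ g, Nonempty (Retract X ((O.t g).obj Y)) := by
  by_contra! hne
  suffices H : ∀ a ∈ AddSubgroup.closure {ψ : P.obj X ⟶ P.obj Y | ∃ (g : G)
      (a : X ⟶ (O.t g).obj Y), ψ = P.map a ≫ (O.θ g).hom.app Y}, ¬ IsIso (O.E (a ≫ r.r)) by
    refine H _ (O.span_left hX hY r.i) ?_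
    rw [r.retract, O.E_id]
    infer_instance
  intro a ha
  induction ha using AddSubgroup.closure_induction with
  | mem _ h =>
    obtain ⟨g, a, rfl⟩ := h
    rw [Category.assoc, O.E_map_comp]
    exact fun _ => (hne g).false (retractOfIsIso a (O.E ((O.θ g).hom.app Y ≫ r.r)))
  | zero =>
    intro h
    rw [zero_comp, map_zero] at h
    exact not_isZero_of_isLocalRing (X := X)
      ((IsZero.iff_id_eq_zero X).2 (by rw [← IsIso.hom_inv_id (0 : X ⟶ X), zero_comp]))
  | add _ _ _ _ h₁ h₂ =>
    intro h
    rw [Preadditive.add_comp, map_add] at h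
    exact (isIso_or_isIso_of_add _ _ h).elim h₁ h₂
  | neg a _ h₁ =>
    intro h
    refine h₁ ?_
    rw [Preadditive.neg_comp, map_neg] at h
    rw [← neg_neg (O.E (a ≫ r.r))]
    exact isIso_neg _

/-- Here it is `P X` that is local, so an invertible term is selected already in `𝒴`; `E` then
carries the retraction it provides back to `𝒳`. -/
theorem exists_twist_retract (O : OrbitFunctor P G) {X Y : 𝒳} (hX : O.fd X) (hY : O.fd Y)
    [IsLocalRing (End (P.obj X))] (r : Retract (P.obj X) (P.obj Y)) :
    ∃ g, Nonempty (Retract ((O.t g).obj X) Y) := by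
  by_contra! hne
  suffices H : ∀ a ∈ AddSubgroup.closure {ψ : P.obj X ⟶ P.obj Y | ∃ (g : G)
      (a : (O.t g).obj X ⟶ Y), ψ = (O.θ g).inv.app X ≫ P.map a}, ¬ IsIso (a ≫ r.r) by
    refine H _ (O.span_right hX hY r.i) ?_
    rw [r.retract]
    infer_instance
  intro a ha
  induction ha using AddSubgroup.closure_induction with
  | mem _ h =>
    obtain ⟨g, a, rfl⟩ := h
    intro h
    refine (hne g).false
      { i := a, r := O.E (r.r ≫ inv (((O.θ g).inv.app X ≫ P.map a) ≫ r.r) ≫ (O.θ g).inv.app X)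
        retract := ?_ }
    rw [← O.E_map_comp]
    have e : P.map a ≫ r.r ≫ inv (((O.θ g).inv.app X ≫ P.map a) ≫ r.r) ≫ (O.θ g).inv.app X =
        𝟙 _ := by
      rw [← cancel_epi ((O.θ g).inv.app X)]
      have := IsIso.hom_inv_id (((O.θ g).inv.app X ≫ P.map a) ≫ r.r)
      simp only [Category.assoc] at this ⊢
      rw [reassoc_of% this]
      exact (Category.comp_id _).symm
    exact (congrArg O.E e).trans (O.E_id _)
  | zero =>
    intro h
    rw [zero_comp] at h
    exact not_isZero_of_isLocalRing (X := P.obj X) ((IsZero.iff_id_eq_zero _).2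
      (by rw [← IsIso.hom_inv_id (0 : P.obj X ⟶ P.obj X), zero_comp]))
  | add _ _ _ _ h₁ h₂ =>
    intro h
    rw [Preadditive.add_comp] at h
    exact (isIso_or_isIso_of_add _ _ h).elim h₁ h₂
  | neg a _ h₁ =>
    intro h
    refine h₁ ?_
    rw [Preadditive.neg_comp] at h
    rw [← neg_neg (a ≫ r.r)]
    exact isIso_neg _

/-- `P` reflects isomorphisms, as `E` maps an inverse of `P.map a` to an inverse of `a`. -/
theorem isLocalRing_of_map (O : OrbitFunctor P G) [P.Additive] (X : 𝒳)
    [IsLocalRing (End (P.obj X))] : IsLocalRing (End X) := by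
  have key : ∀ a : X ⟶ X, IsIso (P.map a) → IsIso a := fun a h =>
    ⟨O.E (inv (P.map a)), by rw [← O.E_map_comp, IsIso.hom_inv_id, O.E_id],
      by rw [← O.E_comp_map, IsIso.inv_hom_id, O.E_id]⟩
  refine isLocalRing_end_of_forall (fun h => ?_) fun a => ?_
  · exact not_isZero_of_isLocalRing (P.map_isZero h)
  · exact (isIso_or_isIso_of_add_eq_id (P.map a) (P.map (𝟙 X - a)) (by simp)).imp (key _) (key _)

/-- A preimage of a local object is therefore unique up to the action of `G`. -/
theorem exists_iso_twist (O : OrbitFunctor P G) [P.Additive] {X Y : 𝒳} (hX : O.fd X)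
    (hY : O.fd Y) [IsLocalRing (End (P.obj X))] (e : P.obj X ≅ P.obj Y) :
    ∃ g, Nonempty (X ≅ (O.t g).obj Y) := by
  have := O.isLocalRing_of_map X
  obtain ⟨g, ⟨r⟩⟩ := O.exists_retract_twist hX hY (Retract.ofIso e)
  have : IsLocalRing (End (P.obj ((O.t g).obj Y))) :=
    isLocalRing_end_of_iso ((O.θ g).app Y ≪≫ e.symm)
  have := O.isLocalRing_of_map ((O.t g).obj Y)
  exact ⟨g, iso_of_retract r not_isZero_of_isLocalRing⟩

end OrbitFunctor
end Orbit

/-! ### Exchange sequences and orbit functors -/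

section Exchange

variable {𝒳 𝒴 : Type*} [Category 𝒳] [Category 𝒴] [Abelian 𝒳] [Abelian 𝒴]
  {P : 𝒳 ⥤ 𝒴} {G : Type*}

/-- A non-split short exact sequence `0 → X → M → Y → 0` with `X` and `Y` local, `M` in the additive
closure of the objects `P R` for `R` in `𝓡`, which is both a left and a right approximation with
respect to these objects. -/
structure IsExchange (O : OrbitFunctor P G) (𝓡 : ObjectProperty 𝒳) (S : ShortComplex 𝒴) :
    Prop where
  fd : ∀ R, 𝓡 R → O.fd R
  twist : ∀ g R, 𝓡 R → 𝓡 ((O.t g).obj R)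
  local_obj : ∀ R, 𝓡 R → IsLocalRing (End (P.obj R))
  exact : S.ShortExact
  nonsplit : IsEmpty S.Splitting
  mem : 𝟙 S.X₂ ∈ factorIdeal (imageProp P 𝓡) S.X₂ S.X₂
  left : ∀ R, 𝓡 R → ∀ h : S.X₁ ⟶ P.obj R, ∃ l : S.X₂ ⟶ P.obj R, S.f ≫ l = h
  right : ∀ R, 𝓡 R → ∀ h : P.obj R ⟶ S.X₃, ∃ l : P.obj R ⟶ S.X₂, l ≫ S.g = h
  local_left : IsLocalRing (End S.X₁)
  local_right : IsLocalRing (End S.X₃)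

variable {O : OrbitFunctor P G} {𝓡 : ObjectProperty 𝒳} {S : ShortComplex 𝒴}

theorem imageProp_op : (imageProp P 𝓡).op = imageProp P.op 𝓡.op := by
  ext Y
  constructor
  · rintro ⟨R, hR, h⟩
    exact ⟨Opposite.op R, hR, congrArg Opposite.op h⟩
  · rintro ⟨R, hR, h⟩
    exact ⟨R.unop, hR, congrArg Opposite.unop h⟩

/-- The two approximation properties are exchanged by duality, so results about the left term follow
from those about the right term. -/
theorem IsExchange.op (h : IsExchange O 𝓡 S) : IsExchange O.op 𝓡.op S.op where
  fd R hR := h.fd R.unop hR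
  twist g R hR := h.twist g R.unop hR
  local_obj R hR := by
    have := h.local_obj R.unop hR
    exact isLocalRing_end_op (X := P.obj R.unop)
  exact := h.exact.op
  nonsplit := ⟨fun s => h.nonsplit.false
    { r := s.s.unop
      s := s.r.unop
      f_r := Quiver.Hom.op_inj s.s_g
      s_g := Quiver.Hom.op_inj s.f_r
      id := Quiver.Hom.op_inj ((add_comm _ _).trans s.id) }⟩
  mem := by
    rw [← imageProp_op]
    exact factorIdeal_op h.mem
  left R hR f := by
    obtain ⟨l, hl⟩ := h.right R.unop hR f.unop
    exact ⟨l.op, Quiver.Hom.unop_inj hl⟩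
  right R hR f := by
    obtain ⟨l, hl⟩ := h.left R.unop hR f.unop
    exact ⟨l.op, Quiver.Hom.unop_inj hl⟩
  local_left := by
    have := h.local_right
    exact isLocalRing_end_op (X := S.X₃)
  local_right := by
    have := h.local_left
    exact isLocalRing_end_op (X := S.X₁)

/-- Otherwise the right approximation property would lift the identity of `S.X₃` along `S.g` and
split the sequence. -/
theorem IsExchange.not_mem (h : IsExchange O 𝓡 S) :
    𝟙 S.X₃ ∉ factorIdeal (imageProp P 𝓡) S.X₃ S.X₃ := by
  intro hY
  have h₁ : ∀ R, imageProp P 𝓡 R → ∀ f : R ⟶ S.X₃, ∃ f' : R ⟶ S.X₂, f' ≫ S.g = f := by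
    rintro _ ⟨R, hR, rfl⟩
    exact h.right R hR
  obtain ⟨s, hs⟩ := exists_lifting S.g h₁ hY
  have := h.exact.mono_f
  exact h.nonsplit.false (ShortComplex.Splitting.ofExactOfSection S h.exact.exact s hs this)

/-- A sequence of `𝒳` whose image is, up to summands in the additive closure of the objects `P R`
for `R` in `𝓡`, a given exchange sequence. -/
structure LiftedSequence (O : OrbitFunctor P G) (𝓡 : ObjectProperty 𝒳) (S : ShortComplex 𝒴)
    (X : 𝒳) where
  M : 𝒳
  Z : 𝒳
  f : X ⟶ M
  p : M ⟶ Z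
  w : f ≫ p = 0
  exact : (ShortComplex.mk f p w).ShortExact
  fdM : O.fd M
  fdZ : O.fd Z
  mem : 𝟙 M ∈ factorIdeal 𝓡 M M
  α : P.obj Z ⟶ S.X₃
  β : S.X₃ ⟶ P.obj Z
  hαβ : 𝟙 _ - α ≫ β ∈ factorIdeal (imageProp P 𝓡) (P.obj Z) (P.obj Z)
  hβα : 𝟙 _ - β ≫ α ∈ factorIdeal (imageProp P 𝓡) S.X₃ S.X₃
  nonsplit : ∀ r : P.obj M ⟶ P.obj X, P.map f ≫ r ≠ 𝟙 _
  right : ∀ R, 𝓡 R → ∀ h : P.obj R ⟶ P.obj Z, ∃ l : P.obj R ⟶ P.obj M, l ≫ P.map p = h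

variable [P.Additive] [PreservesFiniteLimits P] [PreservesFiniteColimits P]

/-- Factor `P X ≅ S.X₁ ⟶ S.X₂` through some `P.map f` and take the cokernel of `f`. The maps `S.f`
and `P.map f` factor through each other, and two such presentations have cokernels isomorphic modulo
the ideal of `𝓡`. -/
theorem IsExchange.nonempty_liftedSequence (h : IsExchange O 𝓡 S) {X : 𝒳} (hX : O.fd X)
    (e : P.obj X ≅ S.X₁) : Nonempty (LiftedSequence O 𝓡 S X) := by
  have hmono := h.exact.mono_f
  have hepi := h.exact.epi_g
  have hleft : ∀ R, imageProp P 𝓡 R → ∀ f : S.X₁ ⟶ R, ∃ f' : S.X₂ ⟶ R, S.f ≫ f' = f := by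
    rintro _ ⟨R, hR, rfl⟩
    exact h.left R hR
  obtain ⟨M, f, w, hfd, hM, hfw⟩ :=
    O.exists_factor h.fd h.twist hX (factorIdeal_of_id_right h.mem (e.hom ≫ S.f))
  have : P.Faithful := ⟨fun h => O.map_injective h⟩
  have hPf : Mono (P.map f) := mono_of_mono_fac hfw
  have hf : Mono f := P.mono_of_mono_map hPf
  have hS' : (ShortComplex.mk f (cokernel.π f) (cokernel.condition f)).ShortExact :=
    { exact := ShortComplex.exact_cokernel f }
  have hPS := hS'.map_of_exact P
  have hepi' : Epi (P.map (cokernel.π f)) := hPS.epi_g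
  have := hPS.epi_g
  have hPM : 𝟙 (P.obj M) ∈ factorIdeal (imageProp P 𝓡) (P.obj M) (P.obj M) := by
    have := factorIdeal_map P (Q'' := imageProp P 𝓡) (fun R hR => ⟨R, hR, rfl⟩) hM
    rwa [P.map_id] at this
  -- `S.f` is a left approximation, which gives a comparison `v` opposite to `w`; both comparisons
  -- fix the images of `P X`.
  obtain ⟨v, hv⟩ := exists_extension S.f hleft (factorIdeal_of_id_right hPM (e.inv ≫ P.map f))
  have hwv : P.map f ≫ w ≫ v = P.map f := by
    rw [reassoc_of% hfw, hv, Iso.hom_inv_id_assoc]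
  have hvw : S.f ≫ v ≫ w = S.f := by
    rw [reassoc_of% hv, hfw, Iso.inv_hom_id_assoc]
  obtain ⟨α, hα⟩ : ∃ α : P.obj (cokernel f) ⟶ S.X₃, P.map (cokernel.π f) ≫ α = w ≫ S.g :=
    ⟨hPS.exact.desc (w ≫ S.g) (by
      change P.map f ≫ w ≫ S.g = 0
      rw [reassoc_of% hfw, S.zero, comp_zero]), hPS.exact.g_desc _ _⟩
  obtain ⟨β, hβ⟩ : ∃ β : S.X₃ ⟶ P.obj (cokernel f), S.g ≫ β = v ≫ P.map (cokernel.π f) :=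
    ⟨h.exact.exact.desc (v ≫ P.map (cokernel.π f)) (by
      rw [reassoc_of% hv, ← P.map_comp, cokernel.condition, P.map_zero, comp_zero]),
      h.exact.exact.g_desc _ _⟩
  -- Since `v ≫ w` fixes `S.f`, its difference from the identity factors through the cokernel. The
  -- map `s` obtained here, and `s'` below, exhibit the errors `𝟙 - β ≫ α` and `𝟙 - α ≫ β` as maps
  -- through the middle terms.
  obtain ⟨s, hs⟩ : ∃ s : S.X₃ ⟶ S.X₂, S.g ≫ s = 𝟙 _ - v ≫ w :=
    ⟨h.exact.exact.desc (𝟙 _ - v ≫ w) (by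
      rw [Preadditive.comp_sub, hvw, Category.comp_id, sub_self]),
      h.exact.exact.g_desc _ _⟩
  obtain ⟨s', hs'⟩ : ∃ s' : P.obj (cokernel f) ⟶ P.obj M,
      P.map (cokernel.π f) ≫ s' = 𝟙 _ - w ≫ v :=
    ⟨hPS.exact.desc (𝟙 _ - w ≫ v) (by
      change P.map f ≫ (𝟙 _ - w ≫ v) = 0
      rw [Preadditive.comp_sub, hwv, Category.comp_id, sub_self]),
      hPS.exact.g_desc _ _⟩
  have hβα : 𝟙 _ - β ≫ α = s ≫ S.g := by
    rw [← cancel_epi S.g, Preadditive.comp_sub, Category.comp_id, reassoc_of% hβ, hα,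
      reassoc_of% hs, Preadditive.sub_comp, Category.id_comp, Category.assoc]
  have hαβ : 𝟙 _ - α ≫ β = s' ≫ P.map (cokernel.π f) := by
    rw [← cancel_epi (P.map (cokernel.π f)), Preadditive.comp_sub, Category.comp_id,
      reassoc_of% hα, hβ, reassoc_of% hs', Preadditive.sub_comp, Category.id_comp, Category.assoc]
  refine ⟨⟨M, cokernel f, f, cokernel.π f, cokernel.condition f, hS', hfd,
    O.fd_epi (cokernel.π f) hfd, hM, α, β, ?_, ?_, ?_, ?_⟩⟩
  · rw [hαβ]
    exact comp_factorIdeal _ (factorIdeal_of_id_left hPM _)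
  · rw [hβα]
    exact comp_factorIdeal _ (factorIdeal_of_id_left h.mem _)
  · intro r hr
    refine h.nonsplit.false (ShortComplex.Splitting.ofExactOfRetraction S h.exact.exact
      (v ≫ r ≫ e.hom) ?_ hepi)
    rw [reassoc_of% hv, reassoc_of% hr, Iso.inv_hom_id]
  · intro R hR l
    obtain ⟨m, hm⟩ := h.right R hR (l ≫ α)
    -- The first term lifts `l ≫ α ≫ β`; the second corrects it by `l ≫ (𝟙 - α ≫ β)`.
    refine ⟨m ≫ v + l ≫ s', ?_⟩
    rw [Preadditive.add_comp, Category.assoc, Category.assoc, ← hβ, reassoc_of% hm, ← hαβ,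
      Preadditive.comp_sub, Category.comp_id]
    abel

/-- If not, `𝟙 - β ≫ α` would be an invertible element of the ideal, which places the local object
`S.X₃` in the additive closure excluded by `IsExchange.not_mem`. -/
theorem IsExchange.isIso_βα (h : IsExchange O 𝓡 S) {X : 𝒳} (L : LiftedSequence O 𝓡 S X) :
    IsIso (L.β ≫ L.α) := by
  have := h.local_right
  rcases isIso_or_isIso_of_add_eq_id (L.β ≫ L.α) (𝟙 _ - L.β ≫ L.α) (by simp) with h' | h'
  · exact h'
  · obtain ⟨R, hR, ⟨r⟩⟩ := exists_retract_of_isIso_mem L.hβα h'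
    exact absurd (id_mem_factorIdeal_of_retract r (id_mem_factorIdeal hR)) h.not_mem

/-- If the left term of an exchange sequence is in the image of `P`, then so is the right term. -/
theorem IsExchange.exists_iso_right (h : IsExchange O 𝓡 S) {X : 𝒳} (hX : O.fd X)
    (e : P.obj X ≅ S.X₁) : ∃ Z, O.fd Z ∧ Nonempty (P.obj Z ≅ S.X₃) := by
  obtain ⟨L⟩ := h.nonempty_liftedSequence hX e
  have := h.local_right
  -- Locality of `S.X₃` allows `L.Z` to be replaced by one local summand `Z`, with `S.X₃` still a
  -- retract of `P Z`. It remains to see that the complement of `S.X₃` in `P Z` is zero.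
  obtain ⟨Z, hZ, r, hr⟩ := (O.decomp L.fdZ).exists_isIso P L.β L.α (h.isIso_βα L)
  have hfdZ : O.fd Z := O.fd_retract r L.fdZ
  obtain ⟨a, ha⟩ : ∃ a, a = L.β ≫ P.map r.r := ⟨_, rfl⟩
  obtain ⟨b, hb⟩ : ∃ b, b = P.map r.i ≫ L.α := ⟨_, rfl⟩
  have hab : IsIso (a ≫ b) := by
    rw [P.map_comp] at hr
    simpa [ha, hb] using hr
  set c := inv (a ≫ b)
  have habc : a ≫ b ≫ c = 𝟙 _ := by rw [← Category.assoc]; exact IsIso.hom_inv_id _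
  have hcab : c ≫ a ≫ b = 𝟙 _ := IsIso.inv_hom_id _
  -- The idempotent onto the complement of `S.X₃`. It lies in the ideal because `b ≫ a` is the
  -- identity modulo the ideal and `ε ≫ b = 0`.
  set ε := 𝟙 (P.obj Z) - b ≫ c ≫ a with hε
  have hεb : ε ≫ b = 0 := by
    have : (b ≫ c ≫ a) ≫ b = b := by
      rw [Category.assoc, Category.assoc, hcab, Category.comp_id]
    rw [hε, Preadditive.sub_comp, Category.id_comp, this, sub_self]
  have hεε : ε ≫ ε = ε := by
    conv_lhs => rw [hε, Preadditive.comp_sub, Category.comp_id, reassoc_of% hεb, zero_comp, sub_zero]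
  have hba : 𝟙 _ - b ≫ a ∈ factorIdeal (imageProp P 𝓡) (P.obj Z) (P.obj Z) := by
    have : 𝟙 _ - b ≫ a = P.map r.i ≫ (𝟙 _ - L.α ≫ L.β) ≫ P.map r.r := by
      rw [Preadditive.sub_comp, Preadditive.comp_sub, Category.id_comp, ← P.map_comp, r.retract,
        P.map_id, ha, hb]
      simp only [Category.assoc]
    rw [this]
    exact comp_factorIdeal _ (factorIdeal_comp L.hαβ _)
  have hεmem : ε ∈ factorIdeal (imageProp P 𝓡) (P.obj Z) (P.obj Z) := by
    have : ε = ε ≫ (𝟙 _ - b ≫ a) := by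
      rw [Preadditive.comp_sub, Category.comp_id, reassoc_of% hεb, zero_comp, sub_zero]
    rw [this]
    exact comp_factorIdeal _ hba
  have hε0 : ε = 0 := by
    by_contra hne
    obtain ⟨K, i, q, hiq, hqi⟩ := IsIdempotentComplete.idempotents_split _ ε hεε
    have hK : ¬ IsZero K := fun hK => hne (by rw [← hqi, hK.eq_of_tgt q 0, zero_comp])
    obtain ⟨K', hK', ⟨rK⟩⟩ := (O.decomp_obj hfdZ ⟨i, q, hiq⟩).exists_retract hK
    have hKmem : 𝟙 K ∈ factorIdeal (imageProp P 𝓡) K K := by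
      have : 𝟙 K = i ≫ ε ≫ q := by rw [← hqi, Category.assoc, reassoc_of% hiq, hiq]
      rw [this]
      exact comp_factorIdeal _ (factorIdeal_comp hεmem _)
    have : IsLocalRing (End K') := hK'
    obtain ⟨_, ⟨R, hR, rfl⟩, ⟨rR⟩⟩ :=
      exists_retract_of_id_mem (id_mem_factorIdeal_of_retract rK hKmem)
    have := h.local_obj R hR
    obtain ⟨e₁⟩ := iso_of_retract rR not_isZero_of_isLocalRing
    -- A local summand of the complement is isomorphic to some `P R`, so a twist of `R` is a retract
    -- of `Z`, hence isomorphic to it. Then `P Z` and its retract `S.X₃` lie in the additive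
    -- closure, a contradiction.
    obtain ⟨g, ⟨r₁⟩⟩ := O.exists_twist_retract (h.fd R hR) hfdZ
      (((Retract.ofIso e₁.symm).trans rK).trans ⟨i, q, hiq⟩)
    have : IsLocalRing (End (P.obj ((O.t g).obj R))) := h.local_obj _ (h.twist g R hR)
    have hloc := O.isLocalRing_of_map ((O.t g).obj R)
    have : IsLocalRing (End Z) := hZ
    obtain ⟨e₂⟩ := iso_of_retract r₁ not_isZero_of_isLocalRing
    refine h.not_mem (id_mem_factorIdeal_of_retract
      ((Retract.mk a (b ≫ c) habc).trans (Retract.ofIso (P.mapIso e₂.symm))) ?_)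
    exact id_mem_factorIdeal ⟨_, h.twist g R hR, rfl⟩
  refine ⟨Z, hfdZ, ⟨⟨b ≫ c, a, ?_, habc⟩⟩⟩
  rw [Category.assoc]
  exact (sub_eq_zero.1 hε0).symm

/-- As `S.X₃` is a retract of `P L.Z`, the object `Z` is a retract of a twist of `L.Z`. The
idempotent onto its complement becomes, on `S.X₃`, idempotent modulo the ideal. By locality it or
its complement is in the ideal, and the latter would force `Z` into the additive closure. -/
theorem IsExchange.exists_retract (h : IsExchange O 𝓡 S) {X : 𝒳} (L : LiftedSequence O 𝓡 S X)
    {Z : 𝒳} (hZ : O.fd Z) (κ : P.obj Z ≅ S.X₃) :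
    ∃ (l : G) (r : Retract Z ((O.t l).obj L.Z)),
      𝟙 _ - r.r ≫ r.i ∈ factorIdeal 𝓡 ((O.t l).obj L.Z) ((O.t l).obj L.Z) := by
  have := h.local_right
  have : IsLocalRing (End (P.obj Z)) := isLocalRing_end_of_iso κ
  have := O.isLocalRing_of_map Z
  have := h.isIso_βα L
  obtain ⟨l, ⟨r⟩⟩ := O.exists_retract_twist hZ L.fdZ
    ((Retract.ofIso κ).trans (retractOfIsIso L.β L.α))
  refine ⟨l, r, ?_⟩
  set θ := (O.θ l).app L.Z
  set α : P.obj ((O.t l).obj L.Z) ⟶ S.X₃ := θ.hom ≫ L.α with hα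
  set β : S.X₃ ⟶ P.obj ((O.t l).obj L.Z) := L.β ≫ θ.inv with hβ
  have hαβ : 𝟙 _ - α ≫ β ∈ factorIdeal (imageProp P 𝓡) _ _ := by
    have : 𝟙 _ - α ≫ β = θ.hom ≫ (𝟙 _ - L.α ≫ L.β) ≫ θ.inv := by
      rw [Preadditive.sub_comp, Preadditive.comp_sub, Category.id_comp, Iso.hom_inv_id, hα, hβ]
      simp only [Category.assoc]
      rfl
    rw [this]
    exact comp_factorIdeal _ (factorIdeal_comp L.hαβ _)
  have hβα : 𝟙 _ - β ≫ α ∈ factorIdeal (imageProp P 𝓡) _ _ := by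
    have : 𝟙 _ - β ≫ α = 𝟙 _ - L.β ≫ L.α := by simp [hα, hβ]
    rw [this]
    exact L.hβα
  -- `α` and `β` are mutually inverse modulo the ideal, so `P.map ε` can be recovered from `β ≫
  -- P.map ε ≫ α`; its component of degree one is `ε`.
  have key : ∀ ε : (O.t l).obj L.Z ⟶ (O.t l).obj L.Z,
      β ≫ P.map ε ≫ α ∈ factorIdeal (imageProp P 𝓡) _ _ → ε ∈ factorIdeal 𝓡 _ _ := by
    intro ε hε
    rw [← O.E_map ε]
    refine O.E_mem_factorIdeal h.fd h.twist (O.fd_t l L.fdZ) ?_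
    have : P.map ε = (𝟙 _ - α ≫ β) ≫ P.map ε + (α ≫ β) ≫ P.map ε ≫ (𝟙 _ - α ≫ β) +
        α ≫ (β ≫ P.map ε ≫ α) ≫ β := by
      simp
    rw [this]
    exact add_mem (add_mem (factorIdeal_comp hαβ _)
      (comp_factorIdeal _ (comp_factorIdeal _ hαβ))) (comp_factorIdeal _ (factorIdeal_comp hε _))
  set ε : (O.t l).obj L.Z ⟶ (O.t l).obj L.Z := 𝟙 _ - r.r ≫ r.i with hε
  have hεε : ε ≫ ε = ε := by simp [hε]
  set a := β ≫ P.map ε ≫ α with ha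
  have haa : a ≫ (𝟙 _ - a) ∈ factorIdeal (imageProp P 𝓡) _ _ := by
    have : a ≫ (𝟙 _ - a) = β ≫ P.map ε ≫ (𝟙 _ - α ≫ β) ≫ P.map ε ≫ α := by
      have e : P.map ε ≫ P.map ε ≫ α = P.map ε ≫ α := by
        rw [← Category.assoc, ← P.map_comp, hεε]
      simp only [ha, Preadditive.comp_sub, Preadditive.sub_comp, Category.comp_id,
        Category.id_comp, Category.assoc, e]
    rw [this]
    exact comp_factorIdeal _ (comp_factorIdeal _ (factorIdeal_comp hαβ _))
  rcases isIso_or_isIso_of_add_eq_id a (𝟙 _ - a) (by simp) with h' | h'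
  · exfalso
    have h1a : 𝟙 _ - a ∈ factorIdeal (imageProp P 𝓡) _ _ := by
      have := comp_factorIdeal (inv a) haa
      rwa [IsIso.inv_hom_id_assoc] at this
    have hri : r.r ≫ r.i ∈ factorIdeal 𝓡 _ _ := by
      refine key _ ?_
      have : β ≫ P.map (r.r ≫ r.i) ≫ α = (𝟙 _ - a) - (𝟙 _ - β ≫ α) := by
        rw [ha, hε, P.map_sub, P.map_id, Preadditive.sub_comp, Preadditive.comp_sub]
        simp
      rw [this]
      exact sub_mem h1a hβα
    have hZmem : 𝟙 Z ∈ factorIdeal 𝓡 Z Z := by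
      have : 𝟙 Z = r.i ≫ (r.r ≫ r.i) ≫ r.r := by simp
      rw [this]
      exact comp_factorIdeal _ (factorIdeal_comp hri _)
    have hPZ := factorIdeal_map P (Q'' := imageProp P 𝓡) (fun R hR => ⟨R, hR, rfl⟩) hZmem
    rw [P.map_id] at hPZ
    exact h.not_mem (id_mem_factorIdeal_of_retract (Retract.ofIso κ.symm) hPZ)
  · refine key _ ?_
    have := factorIdeal_comp haa (inv (𝟙 _ - a))
    rwa [Category.assoc, IsIso.hom_inv_id, Category.comp_id] at this

/-- Schanuel's lemma for right approximations which are minimal up to summands. -/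
theorem retract_of_approximations {X₁ X₂ M₁ M₂ Z₁ Z₂ W₁ W₂ : 𝒳} {f₁ : X₁ ⟶ M₁} {p₁ : M₁ ⟶ Z₁}
    {w₁ : f₁ ≫ p₁ = 0} (h₁ : (ShortComplex.mk f₁ p₁ w₁).ShortExact)
    {f₂ : X₂ ⟶ M₂} {p₂ : M₂ ⟶ Z₂} {w₂ : f₂ ≫ p₂ = 0}
    (h₂ : (ShortComplex.mk f₂ p₂ w₂).ShortExact)
    (hM₁ : 𝟙 M₁ ∈ factorIdeal 𝓡 M₁ M₁) (hM₂ : 𝟙 M₂ ∈ factorIdeal 𝓡 M₂ M₂)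
    (hp₁ : ∀ R, 𝓡 R → ∀ h : R ⟶ Z₁, ∃ l : R ⟶ M₁, l ≫ p₁ = h)
    (hp₂ : ∀ R, 𝓡 R → ∀ h : R ⟶ Z₂, ∃ l : R ⟶ M₂, l ≫ p₂ = h)
    (r₁ : Retract W₁ Z₁) (r₂ : Retract W₂ Z₂) (φ : W₁ ≅ W₂)
    (hr₁ : 𝟙 _ - r₁.r ≫ r₁.i ∈ factorIdeal 𝓡 Z₁ Z₁) [IsLocalRing (End X₁)]
    (hf₁ : ∀ r : M₁ ⟶ X₁, f₁ ≫ r ≠ 𝟙 _) : Nonempty (Retract X₁ X₂) := by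
  have : Mono f₁ := h₁.mono_f
  have : Mono f₂ := h₂.mono_f
  set ζ : Z₁ ⟶ Z₂ := r₁.r ≫ φ.hom ≫ r₂.i with hζ
  set η : Z₂ ⟶ Z₁ := r₂.r ≫ φ.inv ≫ r₁.i with hη
  have hζη : ζ ≫ η = r₁.r ≫ r₁.i := by simp [hζ, hη]
  -- `m` and `m'` lift `ζ` and `η` to the middle terms, and `n` lifts the error `𝟙 - ζ ≫ η`, which
  -- lies in the ideal. Hence `𝟙 - m ≫ m' - p₁ ≫ n` takes values in the kernel `X₁`.
  obtain ⟨m, hm⟩ := exists_lifting p₂ hp₂ (factorIdeal_of_id_left hM₁ (p₁ ≫ ζ))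
  obtain ⟨m', hm'⟩ := exists_lifting p₁ hp₁ (factorIdeal_of_id_left hM₂ (p₂ ≫ η))
  obtain ⟨n, hn⟩ := exists_lifting p₁ hp₁ hr₁
  obtain ⟨c, hc⟩ : ∃ c : M₁ ⟶ X₁, c ≫ f₁ = 𝟙 _ - m ≫ m' - p₁ ≫ n :=
    ⟨h₁.exact.lift (𝟙 _ - m ≫ m' - p₁ ≫ n) (by
      change (𝟙 _ - m ≫ m' - p₁ ≫ n) ≫ p₁ = 0
      simp only [Preadditive.sub_comp, Category.assoc, hm', hn, reassoc_of% hm, hζη,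
        Preadditive.comp_sub, Category.id_comp, Category.comp_id]
      abel), h₁.exact.lift_f _ _⟩
  obtain ⟨x, hx⟩ : ∃ x : X₁ ⟶ X₂, x ≫ f₂ = f₁ ≫ m :=
    ⟨h₂.exact.lift (f₁ ≫ m) (by
      change (f₁ ≫ m) ≫ p₂ = 0
      rw [Category.assoc, hm, reassoc_of% w₁, zero_comp]), h₂.exact.lift_f _ _⟩
  obtain ⟨x', hx'⟩ : ∃ x' : X₂ ⟶ X₁, x' ≫ f₁ = f₂ ≫ m' :=
    ⟨h₁.exact.lift (f₂ ≫ m') (by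
      change (f₂ ≫ m') ≫ p₁ = 0
      rw [Category.assoc, hm', reassoc_of% w₂, zero_comp]), h₁.exact.lift_f _ _⟩
  have hxx : x ≫ x' + f₁ ≫ c = 𝟙 _ := by
    rw [← cancel_mono f₁, Preadditive.add_comp, Category.assoc, Category.assoc, hx', hc,
      reassoc_of% hx, Preadditive.comp_sub, Preadditive.comp_sub, reassoc_of% w₁, zero_comp]
    simp
  -- Either `X₁` is a retract of `X₂`, or `f₁ ≫ c` is invertible and `f₁` splits.
  rcases isIso_or_isIso_of_add_eq_id _ _ hxx with h | h
  · exact ⟨retractOfIsIso x x'⟩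
  · refine absurd ?_ (hf₁ (c ≫ inv (f₁ ≫ c)))
    rw [← Category.assoc, IsIso.hom_inv_id]

/-- The lift exists after applying `P`; transporting it along `Θ` and taking the component of degree
one returns it to `𝒳`. -/
theorem LiftedSequence.right_map {X : 𝒳} (L : LiftedSequence O 𝓡 S X) (Φ : 𝒳 ⥤ 𝒳) (Θ : Φ ⋙ P ≅ P) {R : 𝒳} (hR : 𝓡 R) (h : R ⟶ Φ.obj L.Z) :
    ∃ l : R ⟶ Φ.obj L.M, l ≫ Φ.map L.p = h := by
  obtain ⟨m, hm⟩ := L.right R hR (P.map h ≫ Θ.hom.app L.Z)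
  refine ⟨O.E (m ≫ Θ.inv.app L.M), ?_⟩
  rw [← O.E_comp_map, ← O.E_map h]
  congr 1
  have := Θ.inv.naturality L.p
  simp only [Functor.comp_map] at this
  rw [Category.assoc, ← this, reassoc_of% hm, Iso.hom_inv_id_app]
  exact Category.comp_id _

theorem LiftedSequence.nonsplit_map {X : 𝒳} (L : LiftedSequence O 𝓡 S X)
    (Φ : 𝒳 ⥤ 𝒳) (Θ : Φ ⋙ P ≅ P) (r : Φ.obj L.M ⟶ Φ.obj X) : Φ.map L.f ≫ r ≠ 𝟙 _ := by
  intro hr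
  refine L.nonsplit (Θ.inv.app L.M ≫ P.map r ≫ Θ.hom.app X) ?_
  have := Θ.inv.naturality L.f
  simp only [Functor.comp_map] at this
  rw [reassoc_of% this, ← Category.assoc (P.map _), ← P.map_comp, hr, P.map_id]
  simp

/-- For an exchange sequence whose outer terms are `P X` and `P Z`, isomorphisms between twists of
`Z` yield isomorphisms between twists of `X`. -/
theorem IsExchange.iso_left_of_iso_right (h : IsExchange O 𝓡 S) {X Z : 𝒳} (hX : O.fd X)
    (e : P.obj X ≅ S.X₁) (hZ : O.fd Z) (κ : P.obj Z ≅ S.X₃) {g g' : G}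
    (φ : (O.t g).obj Z ≅ (O.t g').obj Z) :
    ∃ l, Nonempty ((O.t g).obj ((O.t l).obj X) ≅ (O.t g').obj ((O.t l).obj X)) := by
  obtain ⟨L⟩ := h.nonempty_liftedSequence hX e
  obtain ⟨l, r, hr⟩ := h.exists_retract L hZ κ
  refine ⟨l, ?_⟩
  -- Both twists are applied after the twist by `l`, because it is `t l L.Z` that is known to
  -- contain `Z` as a summand.
  let Θ : ∀ g, (O.t l ⋙ O.t g) ⋙ P ≅ P := fun g =>
    Functor.associator _ _ _ ≪≫ Functor.isoWhiskerLeft (O.t l) (O.θ g) ≪≫ O.θ l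
  have hloc : ∀ g, IsLocalRing (End ((O.t g).obj ((O.t l).obj X))) := fun g => by
    have := h.local_left
    have : IsLocalRing (End (P.obj ((O.t g).obj ((O.t l).obj X)))) :=
      isLocalRing_end_of_iso ((Θ g).app X ≪≫ e)
    exact O.isLocalRing_of_map _
  have hex : ∀ g, (ShortComplex.mk ((O.t l ⋙ O.t g).map L.f) ((O.t l ⋙ O.t g).map L.p)
      (by rw [← Functor.map_comp, L.w, Functor.map_zero])).ShortExact := fun g =>
    L.exact.map_of_exact (O.t l ⋙ O.t g)
  have hmem : ∀ g, 𝟙 ((O.t l ⋙ O.t g).obj L.M) ∈ factorIdeal 𝓡 _ _ := fun g => by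
    have := factorIdeal_map (O.t l ⋙ O.t g) (Q'' := 𝓡)
      (fun R hR => h.twist g _ (h.twist l R hR)) L.mem
    rwa [CategoryTheory.Functor.map_id] at this
  have hr' : 𝟙 _ - (r.map (O.t g)).r ≫ (r.map (O.t g)).i ∈ factorIdeal 𝓡 _ _ := by
    have := factorIdeal_map (O.t g) (Q'' := 𝓡) (h.twist g) hr
    rwa [Functor.map_sub, CategoryTheory.Functor.map_id, Functor.map_comp] at this
  have hloc₁ := hloc g
  have hloc₂ := hloc g'
  obtain ⟨r⟩ := retract_of_approximations (𝓡 := 𝓡) (X₁ := (O.t g).obj ((O.t l).obj X))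
    (X₂ := (O.t g').obj ((O.t l).obj X)) (hex g) (hex g') (hmem g) (hmem g')
    (fun R hR => L.right_map (O.t l ⋙ O.t g) (Θ g) hR)
    (fun R hR => L.right_map (O.t l ⋙ O.t g') (Θ g') hR)
    (r.map (O.t g)) (r.map (O.t g')) φ hr' (L.nonsplit_map (O.t l ⋙ O.t g) (Θ g))
  exact iso_of_retract r not_isZero_of_isLocalRing

theorem IsExchange.exists_iso_left (h : IsExchange O 𝓡 S) {Z : 𝒳} (hZ : O.fd Z)
    (e : P.obj Z ≅ S.X₃) : ∃ X, O.fd X ∧ Nonempty (P.obj X ≅ S.X₁) := by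
  have : PreservesFiniteLimits P.op := preservesFiniteLimits_op P
  have : PreservesFiniteColimits P.op := preservesFiniteColimits_op P
  obtain ⟨X, hX, ⟨e'⟩⟩ := h.op.exists_iso_right (X := Opposite.op Z) hZ e.symm.op
  exact ⟨X.unop, hX, ⟨e'.unop.symm⟩⟩

theorem IsExchange.iso_right_of_iso_left (h : IsExchange O 𝓡 S) {X Z : 𝒳} (hX : O.fd X)
    (e : P.obj X ≅ S.X₁) (hZ : O.fd Z) (κ : P.obj Z ≅ S.X₃) {g g' : G}
    (φ : (O.t g).obj X ≅ (O.t g').obj X) :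
    ∃ l, Nonempty ((O.t g).obj ((O.t l).obj Z) ≅ (O.t g').obj ((O.t l).obj Z)) := by
  have : PreservesFiniteLimits P.op := preservesFiniteLimits_op P
  have : PreservesFiniteColimits P.op := preservesFiniteColimits_op P
  obtain ⟨l, ⟨e'⟩⟩ := h.op.iso_left_of_iso_right (X := Opposite.op Z) (Z := Opposite.op X)
    hZ κ.symm.op hX e.symm.op (g := g) (g' := g') φ.symm.op
  exact ⟨l, ⟨e'.unop.symm⟩⟩

end Exchange

/-! ### Generalities on modules over `k`-categories -/

section KModBasics

variable {k : Type u} [Field k] {C : Type u} [Category.{u} C] [Preadditive C] [Linear k C]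
  {L M N : KMod k C}

/-- The component of a morphism of modules, as a linear map. -/
def KMod.ap (f : M ⟶ N) (x : C) : M.obj.obj x →ₗ[k] N.obj.obj x := (f.hom.app x).hom

theorem KMod.hom_ext {f g : M ⟶ N} (h : ∀ x m, KMod.ap f x m = KMod.ap g x m) : f = g := by
  ext x : 3
  exact ModuleCat.hom_ext (LinearMap.ext (h x))

@[simp]
theorem KMod.ap_id (x : C) (m : M.obj.obj x) : KMod.ap (𝟙 M) x m = m := rfl

@[simp]
theorem KMod.ap_comp (f : L ⟶ M) (g : M ⟶ N) (x : C) (m : L.obj.obj x) :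
    KMod.ap (f ≫ g) x m = KMod.ap g x (KMod.ap f x m) := rfl

@[simp]
theorem KMod.ap_add (f g : M ⟶ N) (x : C) (m : M.obj.obj x) :
    KMod.ap (f + g) x m = KMod.ap f x m + KMod.ap g x m := rfl

@[simp]
theorem KMod.ap_zero (x : C) (m : M.obj.obj x) : KMod.ap (0 : M ⟶ N) x m = 0 := rfl

theorem KMod.ap_map (f : M ⟶ N) {x y : C} (u : x ⟶ y) (m : M.obj.obj x) :
    KMod.ap f y (M.obj.map u m) = N.obj.map u (KMod.ap f x m) :=
  ConcreteCategory.congr_hom (f.hom.naturality u) m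

/-- The morphism of modules with given components. -/
def KMod.ofAp (φ : ∀ x, M.obj.obj x →ₗ[k] N.obj.obj x)
    (h : ∀ {x y : C} (u : x ⟶ y) (m : M.obj.obj x), φ y (M.obj.map u m) = N.obj.map u (φ x m)) :
    M ⟶ N :=
  ObjectProperty.homMk
    { app := fun x => ModuleCat.ofHom (φ x)
      naturality := fun _ _ u => ModuleCat.hom_ext (LinearMap.ext (h u)) }

theorem KMod.map_id_apply (x : C) (m : M.obj.obj x) : M.obj.map (𝟙 x) m = m := by
  rw [M.obj.map_id]; rfl

theorem KMod.map_comp_apply {x y z : C} (f : x ⟶ y) (g : y ⟶ z) (m : M.obj.obj x) :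
    M.obj.map (f ≫ g) m = M.obj.map g (M.obj.map f m) := by
  rw [M.obj.map_comp]; rfl

theorem KMod.ap_inv_hom (e : M ≅ N) (x : C) (m : M.obj.obj x) :
    KMod.ap e.inv x (KMod.ap e.hom x m) = m := by
  rw [← KMod.ap_comp, e.hom_inv_id, KMod.ap_id]

theorem KMod.ap_hom_inv (e : M ≅ N) (x : C) (m : N.obj.obj x) :
    KMod.ap e.hom x (KMod.ap e.inv x m) = m := by
  rw [← KMod.ap_comp, e.inv_hom_id, KMod.ap_id]

theorem KMod.isIso_of_bijective (f : M ⟶ N) (h : ∀ x, Function.Bijective (KMod.ap f x)) :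
    IsIso f := by
  let e := fun x => LinearEquiv.ofBijective (KMod.ap f x) (h x)
  have he : ∀ x m, e x m = KMod.ap f x m := fun _ _ => rfl
  refine ⟨KMod.ofAp (fun x => (e x).symm.toLinearMap) fun {x y} u m => ?_, ?_, ?_⟩
  · change (e y).symm (N.obj.map u m) = M.obj.map u ((e x).symm m)
    rw [LinearEquiv.symm_apply_eq, he, KMod.ap_map, ← he, LinearEquiv.apply_symm_apply]
  · exact KMod.hom_ext fun x m => (e x).symm_apply_apply m
  · exact KMod.hom_ext fun x m => (e x).apply_symm_apply m

theorem KMod.isZero_iff : IsZero M ↔ ∀ x (m : M.obj.obj x), m = 0 := by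
  rw [IsZero.iff_id_eq_zero]
  refine ⟨fun h x m => ?_, fun h => KMod.hom_ext fun x _ => (h x _).trans (h x _).symm⟩
  rw [← KMod.ap_id x m, h, KMod.ap_zero]

variable (k C) in
/-- The functor evaluating modules at an object. -/
def KMod.ev (x : C) : KMod k C ⥤ ModuleCat.{u} k :=
  (isKLinear k C).ι ⋙ (evaluation C (ModuleCat.{u} k)).obj x

instance : ((isKLinear k C).ι).PreservesHomology where
  preservesKernels _ _ f := ObjectProperty.preservesKernels_ι _ f
  preservesCokernels _ _ f := ObjectProperty.preservesCokernels_ι _ f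

instance (x : C) : (KMod.ev k C x).Additive where
  map_add := rfl

instance (x : C) : (KMod.ev k C x).PreservesHomology := by
  have : PreservesFiniteLimits (isKLinear k C).ι :=
    Functor.preservesFiniteLimits_of_preservesHomology _
  have : PreservesFiniteColimits (isKLinear k C).ι :=
    Functor.preservesFiniteColimits_of_preservesHomology _
  unfold KMod.ev
  infer_instance

/-- Evaluations preserve homology and jointly detect zero modules, so exactness can be tested at
each object. -/
theorem KMod.exact_iff (S : ShortComplex (KMod k C)) :
    S.Exact ↔ ∀ x (m : S.X₂.obj.obj x), KMod.ap S.g x m = 0 → ∃ l, KMod.ap S.f x l = m := by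
  have key : ∀ x, (S.map (KMod.ev k C x)).Exact ↔
      ∀ m : S.X₂.obj.obj x, KMod.ap S.g x m = 0 → ∃ l, KMod.ap S.f x l = m := fun x =>
    ShortComplex.moduleCat_exact_iff _
  refine ⟨fun h x => (key x).1 (h.map (KMod.ev k C x)), fun h => ?_⟩
  rw [ShortComplex.exact_iff_isZero_homology, KMod.isZero_iff]
  intro x m
  have h₁ := (ShortComplex.exact_iff_isZero_homology _).1 ((key x).2 (h x))
  have h₂ := h₁.of_iso (S.mapHomologyIso (KMod.ev k C x)).symm
  have h₃ := (IsZero.iff_id_eq_zero _).1 h₂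
  exact ConcreteCategory.congr_hom h₃ m

theorem KMod.mono_iff (f : M ⟶ N) : Mono f ↔ ∀ x, Function.Injective (KMod.ap f x) := by
  constructor
  · intro _ x
    exact (ModuleCat.mono_iff_injective ((KMod.ev k C x).map f)).1 inferInstance
  · intro h
    refine ⟨fun a b hab => KMod.hom_ext fun x m => h x ?_⟩
    rw [← KMod.ap_comp, ← KMod.ap_comp, hab]

theorem KMod.epi_iff (f : M ⟶ N) : Epi f ↔ ∀ x, Function.Surjective (KMod.ap f x) := by
  constructor
  · intro _ x
    exact (ModuleCat.epi_iff_surjective ((KMod.ev k C x).map f)).1 inferInstance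
  · intro h
    refine ⟨fun a b hab => KMod.hom_ext fun x m => ?_⟩
    obtain ⟨m, rfl⟩ := h x m
    rw [← KMod.ap_comp, ← KMod.ap_comp, hab]

end KModBasics

/-! ### Total spaces and finite dimensional modules -/

section Total

variable {k : Type u} [Field k] {C : Type u} [Category.{u} C] [Preadditive C] [Linear k C]
  {L M N : KMod k C}

/-- The total space of a module. -/
abbrev KMod.Tot (M : KMod k C) : Type u := ⨁ x : C, M.obj.obj x

/-- The map induced on total spaces. -/
def KMod.totMap (f : M ⟶ N) : M.Tot →ₗ[k] N.Tot := DirectSum.lmap fun x => KMod.ap f x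

theorem KMod.totMap_apply (f : M ⟶ N) (m : M.Tot) (x : C) :
    KMod.totMap f m x = KMod.ap f x (m x) := DirectSum.lmap_apply _ _ _

theorem KMod.totMap_id : KMod.totMap (𝟙 M) = LinearMap.id :=
  LinearMap.ext fun m => DFinsupp.ext fun x => KMod.totMap_apply _ _ _

theorem KMod.totMap_comp (f : L ⟶ M) (g : M ⟶ N) :
    KMod.totMap (f ≫ g) = KMod.totMap g ∘ₗ KMod.totMap f :=
  LinearMap.ext fun m => DFinsupp.ext fun x => by
    simp [KMod.totMap_apply]

theorem KMod.totMap_add (f g : M ⟶ N) :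
    KMod.totMap (f + g) = KMod.totMap f + KMod.totMap g :=
  LinearMap.ext fun m => DFinsupp.ext fun x => by
    change _ = KMod.totMap f m x + KMod.totMap g m x
    simp [KMod.totMap_apply]

theorem KMod.totMap_smul (r : k) (f : M ⟶ N) :
    KMod.totMap (r • f) = r • KMod.totMap f :=
  LinearMap.ext fun m => DFinsupp.ext fun x => by
    change _ = r • KMod.totMap f m x
    rw [KMod.totMap_apply, KMod.totMap_apply]
    rfl

theorem KMod.totMap_injective {f g : M ⟶ N} (h : KMod.totMap f = KMod.totMap g) : f = g := by
  classical
  refine KMod.hom_ext fun x m => ?_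
  have := congrArg (fun z : N.Tot => z x) (LinearMap.congr_fun h (DirectSum.lof k C _ x m))
  simpa [KMod.totMap_apply, DirectSum.lof_apply] using this

theorem IsFinDim.of_injective (f : M.Tot →ₗ[k] N.Tot) (hf : Function.Injective f)
    (h : IsFinDim N) : IsFinDim M :=
  have : Module.Finite k N.Tot := h
  Module.Finite.of_injective f hf

theorem IsFinDim.of_mono (f : M ⟶ N) [Mono f] (h : IsFinDim N) : IsFinDim M := by
  refine IsFinDim.of_injective (KMod.totMap f) (fun a b hab => DFinsupp.ext fun x => ?_) h
  refine (KMod.mono_iff f).1 inferInstance x ?_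
  rw [← KMod.totMap_apply, hab, KMod.totMap_apply]

theorem IsFinDim.of_epi (f : M ⟶ N) [Epi f] (h : IsFinDim M) : IsFinDim N := by
  classical
  have : Module.Finite k M.Tot := h
  refine Module.Finite.of_surjective (KMod.totMap f) fun n => ?_
  induction n using DirectSum.induction_on with
  | zero => exact ⟨0, map_zero _⟩
  | of x n =>
    obtain ⟨m, rfl⟩ := (KMod.epi_iff f).1 inferInstance x n
    exact ⟨DirectSum.lof k C _ x m, DirectSum.lmap_lof _ _ _⟩
  | add a b ha hb =>
    obtain ⟨a, rfl⟩ := ha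
    obtain ⟨b, rfl⟩ := hb
    exact ⟨a + b, map_add _ _ _⟩

theorem IsFinDim.of_iso (e : M ≅ N) (h : IsFinDim M) : IsFinDim N := h.of_epi e.hom

theorem IsFinDim.of_retract (r : Retract M N) (h : IsFinDim N) : IsFinDim M := by
  have : Epi r.r := inferInstance
  exact h.of_epi r.r

theorem isFinDim_of_isZero (h : IsZero M) : IsFinDim M := by
  have : Subsingleton M.Tot :=
    ⟨fun a b => DFinsupp.ext fun x => ((KMod.isZero_iff.1 h) x _).trans (KMod.isZero_iff.1 h x _).symm⟩
  exact Module.Finite.of_finite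

/-- The total space of a direct sum. -/
def KMod.totBiprod (M N : KMod k C) : (M ⊞ N : KMod k C).Tot ≃ₗ[k] M.Tot × N.Tot :=
  LinearEquiv.ofLinearMap
    ((KMod.totMap (biprod.fst : M ⊞ N ⟶ M)).prod (KMod.totMap (biprod.snd : M ⊞ N ⟶ N)))
    ((KMod.totMap (biprod.inl : M ⟶ M ⊞ N)).coprod (KMod.totMap (biprod.inr : N ⟶ M ⊞ N)))
    (by
      refine LinearMap.prod_ext ?_ ?_
      · refine LinearMap.ext fun m => Prod.ext ?_ ?_
        · change KMod.totMap biprod.fst (KMod.totMap biprod.inl m + KMod.totMap biprod.inr 0) = m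
          rw [map_zero, add_zero, ← LinearMap.comp_apply, ← KMod.totMap_comp, biprod.inl_fst,
            KMod.totMap_id]
          rfl
        · change KMod.totMap biprod.snd (KMod.totMap biprod.inl m + KMod.totMap biprod.inr 0) = 0
          rw [map_zero, add_zero, ← LinearMap.comp_apply, ← KMod.totMap_comp, biprod.inl_snd]
          exact DFinsupp.ext fun x => KMod.totMap_apply _ _ _
      · refine LinearMap.ext fun m => Prod.ext ?_ ?_
        · change KMod.totMap biprod.fst (KMod.totMap biprod.inl 0 + KMod.totMap biprod.inr m) = 0
          rw [map_zero, zero_add, ← LinearMap.comp_apply, ← KMod.totMap_comp, biprod.inr_fst]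
          exact DFinsupp.ext fun x => KMod.totMap_apply _ _ _
        · change KMod.totMap biprod.snd (KMod.totMap biprod.inl 0 + KMod.totMap biprod.inr m) = m
          rw [map_zero, zero_add, ← LinearMap.comp_apply, ← KMod.totMap_comp, biprod.inr_snd,
            KMod.totMap_id]
          rfl)
    (by
      rw [LinearMap.coprod_comp_prod, ← KMod.totMap_comp, ← KMod.totMap_comp, ← KMod.totMap_add,
        biprod.total, KMod.totMap_id])

theorem IsFinDim.biprod (hM : IsFinDim M) (hN : IsFinDim N) : IsFinDim (M ⊞ N) := by
  have : Module.Finite k M.Tot := hM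
  have : Module.Finite k N.Tot := hN
  exact Module.Finite.equiv (KMod.totBiprod M N).symm

/-- The endomorphisms of a module act on the total space. -/
def KMod.totHom (M N : KMod k C) : (M ⟶ N) →ₗ[k] M.Tot →ₗ[k] N.Tot where
  toFun := KMod.totMap
  map_add' := KMod.totMap_add
  map_smul' := KMod.totMap_smul

theorem finite_hom (hM : IsFinDim M) (hN : IsFinDim N) : Module.Finite k (M ⟶ N) := by
  have : Module.Finite k M.Tot := hM
  have : Module.Finite k N.Tot := hN
  exact Module.Finite.of_injective (KMod.totHom M N) fun _ _ h => KMod.totMap_injective h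

end Total

/-! ### Fitting's lemma and decompositions into local modules -/

section KrullSchmidt

/-- Fitting's lemma. Write the minimal polynomial of `f` as `X ^ n * q` with `q` prime to `X`, and
`a * X ^ n + b * q = 1`. Then `b * q` evaluates to an idempotent at `f`: if it is `0` then `f` is
invertible, if it is `1` then `f ^ n = 0`. -/
theorem isUnit_or_isUnit_one_sub_of_idempotents {k B : Type*} [Field k] [Ring B] [Algebra k B]
    [Module.Finite k B] (h : ∀ e : B, e * e = e → e = 0 ∨ e = 1) (f : B) :
    IsUnit f ∨ IsUnit (1 - f) := by
  have hf : IsIntegral k f := Algebra.IsIntegral.isIntegral f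
  obtain ⟨q, hq, hq'⟩ := Polynomial.exists_eq_pow_rootMultiplicity_mul_and_not_dvd (minpoly k f)
    (minpoly.ne_zero hf) 0
  set n := (minpoly k f).rootMultiplicity 0
  rw [Polynomial.C_0, sub_zero] at hq hq'
  have hcop : IsCoprime (Polynomial.X : Polynomial k) q :=
    (Polynomial.irreducible_X.coprime_iff_not_dvd).2 hq'
  obtain ⟨a, b, hab⟩ := hcop.pow_left (m := n)
  set φ := Polynomial.aeval (R := k) f
  have h0 : φ (Polynomial.X ^ n * q) = 0 := by rw [← hq]; exact minpoly.aeval k f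
  have hcomm : ∀ p, φ p * f = f * φ p := fun p => by
    have h1 := congrArg φ (mul_comm p Polynomial.X)
    rwa [map_mul, map_mul, Polynomial.aeval_X] at h1
  have hunit : ∀ p, φ p * f = 1 → IsUnit f := fun p hp =>
    ⟨⟨f, φ p, by rw [← hcomm, hp], hp⟩, rfl⟩
  rcases Nat.eq_zero_or_pos n with hn | hn
  -- If `n = 0` then `q` annihilates `f`, and coprimality of `X` and `q` gives an inverse directly.
  · left
    obtain ⟨a, b, hab⟩ := hcop
    have h1 := congrArg φ hab
    rw [hn, pow_zero, one_mul] at h0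
    rw [map_add, map_mul, map_mul, h0, mul_zero, add_zero, map_one, Polynomial.aeval_X] at h1
    exact hunit a h1
  have hid : φ (b * q) * φ (b * q) = φ (b * q) := by
    have h1 : φ (b * q) * φ (a * Polynomial.X ^ n) = 0 := by
      rw [← map_mul, show b * q * (a * Polynomial.X ^ n) = b * a * (Polynomial.X ^ n * q) by ring,
        map_mul, h0, mul_zero]
    have h2 := congrArg (fun p => φ (b * q) * φ p) hab
    simp only [map_add, mul_add, map_one, mul_one] at h2
    rwa [h1, zero_add] at h2
  have h1 := congrArg φ hab
  rw [map_add, map_one] at h1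
  rcases h _ hid with he | he
  · left
    rw [he, add_zero] at h1
    -- The Bézout relation now reads `a(f) f ^ n = 1`, so one factor `f` is split off; `n > 0` here.
    refine hunit (a * Polynomial.X ^ (n - 1)) ?_
    have h2 : φ (a * Polynomial.X ^ (n - 1)) * φ Polynomial.X = φ (a * Polynomial.X ^ n) := by
      rw [← map_mul, mul_assoc, ← pow_succ, Nat.sub_add_cancel hn]
    rwa [Polynomial.aeval_X, h1] at h2
  · right
    refine IsNilpotent.isUnit_one_sub ⟨n, ?_⟩
    have h2 : φ (Polynomial.X ^ n) * φ (b * q) = 0 := by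
      rw [← map_mul, show Polynomial.X ^ n * (b * q) = b * (Polynomial.X ^ n * q) by ring, map_mul,
        h0, mul_zero]
    rwa [he, mul_one, map_pow, Polynomial.aeval_X] at h2

variable {𝒟 : Type*} [Category 𝒟] [Abelian 𝒟]

/-- The images of `e` and `𝟙 - e` form a direct sum decomposition of `X`. -/
theorem idempotent_of_indecomposable {X : 𝒟} (h : Indecomposable X) (e : X ⟶ X) (he : e ≫ e = e) :
    e = 0 ∨ e = 𝟙 X := by
  obtain ⟨K, i, q, hiq, hqi⟩ := IsIdempotentComplete.idempotents_split _ e he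
  obtain ⟨K', i', q', hiq', hqi'⟩ :=
    IsIdempotentComplete.idempotents_split _ (𝟙 X - e) (by simp [he])
  have : Mono i := mono_of_mono_fac hiq
  have : Mono i' := mono_of_mono_fac hiq'
  have h₁ : i ≫ q' = 0 := by
    rw [← cancel_mono i', Category.assoc, hqi', Preadditive.comp_sub, ← hqi, reassoc_of% hiq]
    simp
  have h₂ : i' ≫ q = 0 := by
    rw [← cancel_mono i, Category.assoc, hqi]
    have : i' ≫ (𝟙 X - e) = i' := by rw [← hqi', reassoc_of% hiq']
    rw [← this, Category.assoc, Preadditive.sub_comp, he]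
    simp
  have iso : X ≅ K ⊞ K' :=
    { hom := biprod.lift q q'
      inv := biprod.desc i i'
      hom_inv_id := by rw [biprod.lift_desc, hqi, hqi']; simp
      inv_hom_id := by
        ext <;> simp [hiq, hiq', h₁, h₂] }
  rcases h.2 K K' iso with h | h
  · left
    rw [← hqi, h.eq_of_tgt q 0, zero_comp]
  · right
    rw [h.eq_of_tgt q' 0, zero_comp] at hqi'
    exact (sub_eq_zero.1 hqi'.symm).symm

theorem indecomposable_of_isLocalRing {X : 𝒟} [IsLocalRing (End X)] : Indecomposable X := by
  refine ⟨not_isZero_of_isLocalRing, fun Y Z a => ?_⟩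
  have h : a.hom ≫ (biprod.fst ≫ biprod.inl) ≫ a.inv +
      a.hom ≫ (biprod.snd ≫ biprod.inr) ≫ a.inv = 𝟙 X := by
    rw [← Preadditive.comp_add, ← Preadditive.add_comp, biprod.total]
    simp
  rcases isIso_or_isIso_of_add_eq_id _ _ h with h | h
  · right
    rw [IsZero.iff_id_eq_zero]
    have : biprod.inr ≫ a.inv = (0 : Z ⟶ X) := by
      rw [← cancel_mono (a.hom ≫ (biprod.fst ≫ biprod.inl) ≫ a.inv)]
      simp
    have h' : (biprod.inr : Z ⟶ Y ⊞ Z) = 0 := by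
      rw [← cancel_mono a.inv, this, zero_comp]
    rw [← biprod.inr_snd (X := Y) (Y := Z), h', zero_comp]
  · left
    rw [IsZero.iff_id_eq_zero]
    have : biprod.inl ≫ a.inv = (0 : Y ⟶ X) := by
      rw [← cancel_mono (a.hom ≫ (biprod.snd ≫ biprod.inr) ≫ a.inv)]
      simp
    have h' : (biprod.inl : Y ⟶ Y ⊞ Z) = 0 := by
      rw [← cancel_mono a.inv, this, zero_comp]
    rw [← biprod.inl_fst (X := Y) (Y := Z), h', zero_comp]

variable {k : Type u} [Field k] {C : Type u} [Category.{u} C] [Preadditive C] [Linear k C]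
  {M N : KMod k C}

theorem IsInd.isLocalRing (h : IsInd M) : IsLocalRing (End M) := by
  have : Module.Finite k (End M) := finite_hom h.1 h.1
  refine isLocalRing_end_of_forall h.2.1 fun a => ?_
  have := isUnit_or_isUnit_one_sub_of_idempotents (k := k) (B := End M)
    (fun e he => idempotent_of_indecomposable h.2 e he) a
  exact this.imp (fun h => (isUnit_iff_isIso _).1 h) (fun h => (isUnit_iff_isIso _).1 h)

theorem isInd_of_isLocalRing (h : IsFinDim M) [IsLocalRing (End M)] : IsInd M :=
  ⟨h, indecomposable_of_isLocalRing⟩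

theorem IsDecomposable.of_iso_biprod {Q : ObjectProperty 𝒟} {X Y Z : 𝒟} (e : X ≅ Y ⊞ Z)
    (hY : IsDecomposable Q Y) (hZ : IsDecomposable Q Z) : IsDecomposable Q X := by
  have key : ∀ {W : 𝒟} (r : Retract W X), IsDecomposable Q W →
      r.r ≫ r.i ∈ AddSubgroup.closure
        {φ : X ⟶ X | ∃ (L : 𝒟) (_ : Q L) (r : Retract L X), φ = r.r ≫ r.i} := by
    intro W r hW
    suffices H : ∀ φ ∈ AddSubgroup.closure
        {φ : W ⟶ W | ∃ (L : 𝒟) (_ : Q L) (r : Retract L W), φ = r.r ≫ r.i},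
        r.r ≫ φ ≫ r.i ∈ AddSubgroup.closure
        {φ : X ⟶ X | ∃ (L : 𝒟) (_ : Q L) (r : Retract L X), φ = r.r ≫ r.i} by
      simpa using H _ hW
    intro φ hφ
    induction hφ using AddSubgroup.closure_induction with
    | mem _ h =>
      obtain ⟨L, hL, s, rfl⟩ := h
      exact AddSubgroup.subset_closure ⟨L, hL, s.trans r, by simp⟩
    | zero => rw [zero_comp, comp_zero]; exact zero_mem _
    | add _ _ _ _ h₁ h₂ =>
      rw [Preadditive.add_comp, Preadditive.comp_add]; exact add_mem h₁ h₂
    | neg _ _ h => rw [Preadditive.neg_comp, Preadditive.comp_neg]; exact neg_mem h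
  let r₁ : Retract Y X := ⟨biprod.inl ≫ e.inv, e.hom ≫ biprod.fst, by simp⟩
  let r₂ : Retract Z X := ⟨biprod.inr ≫ e.inv, e.hom ≫ biprod.snd, by simp⟩
  have : 𝟙 X = r₁.r ≫ r₁.i + r₂.r ≫ r₂.i := by
    have h : 𝟙 X = e.hom ≫ (biprod.fst ≫ biprod.inl + biprod.snd ≫ biprod.inr) ≫ e.inv := by
      rw [biprod.total]; simp
    rw [h, Preadditive.add_comp, Preadditive.comp_add]
    simp [r₁, r₂]
  rw [IsDecomposable, this]
  exact add_mem (key r₁ hY) (key r₂ hZ)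

/-- Induction on the total dimension: an indecomposable module is local by Fitting's lemma, and
otherwise both summands of a proper decomposition have smaller dimension. -/
theorem IsFinDim.isDecomposable (h : IsFinDim M) :
    IsDecomposable (fun L : KMod k C => IsLocalRing (End L)) M := by
  obtain ⟨n, hn⟩ : ∃ n, Module.finrank k M.Tot = n := ⟨_, rfl⟩
  induction n using Nat.strong_induction_on generalizing M with
  | _ n ih =>
    by_cases h₀ : IsZero M
    · rw [IsDecomposable, h₀.eq_of_src (𝟙 M) 0]
      exact zero_mem _
    by_cases h₁ : Indecomposable M
    · exact AddSubgroup.subset_closure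
        ⟨M, IsInd.isLocalRing ⟨h, h₁⟩, Retract.refl M, by simp⟩
    · obtain ⟨Y, Z, e, hY, hZ⟩ : ∃ (Y Z : KMod k C) (_ : M ≅ Y ⊞ Z), ¬ IsZero Y ∧ ¬ IsZero Z := by
        by_contra! hne
        exact h₁ ⟨h₀, fun Y Z e => or_iff_not_imp_left.2 (hne Y Z e)⟩
      have hpos : ∀ {W : KMod k C}, IsFinDim W → ¬ IsZero W → 0 < Module.finrank k W.Tot := by
        intro W hW hW'
        have : Module.Finite k W.Tot := hW
        rw [Module.finrank_pos_iff]
        by_contra hs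
        rw [not_nontrivial_iff_subsingleton] at hs
        refine hW' ((IsZero.iff_id_eq_zero W).2 (KMod.totMap_injective ?_))
        exact LinearMap.ext fun m => Subsingleton.elim _ _
      have hfY : IsFinDim Y := h.of_retract ⟨biprod.inl ≫ e.inv, e.hom ≫ biprod.fst, by simp⟩
      have hfZ : IsFinDim Z := h.of_retract ⟨biprod.inr ≫ e.inv, e.hom ≫ biprod.snd, by simp⟩
      have : Module.Finite k Y.Tot := hfY
      have : Module.Finite k Z.Tot := hfZ
      have hdim : n = Module.finrank k Y.Tot + Module.finrank k Z.Tot := by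
        rw [← hn, ← Module.finrank_prod, ← (KMod.totBiprod Y Z).finrank_eq]
        refine LinearEquiv.finrank_eq (LinearEquiv.ofLinearMap (KMod.totMap e.hom)
          (KMod.totMap e.inv) ?_ ?_)
        · rw [← KMod.totMap_comp, e.inv_hom_id, KMod.totMap_id]
        · rw [← KMod.totMap_comp, e.hom_inv_id, KMod.totMap_id]
      have := hpos hfY hY
      have := hpos hfZ hZ
      exact .of_iso_biprod e (ih _ (by omega) hfY rfl) (ih _ (by omega) hfZ rfl)

end KrullSchmidt

/-! ### Elements of push-downs -/

section PushElements

variable {k : Type u} [Field k]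
  {C : Type u} [Category.{u} C] [Preadditive C] [Linear k C]
  {A : Type u} [Category.{u} A] [Preadditive A] [Linear k A]
  {G : Type u} [Group G] {ρ : KAction k C G} {F : C ⥤ A} [F.Additive] [F.Linear k]
  (hF : IsGaloisCovering ρ F) {L M N : KMod k C}

open Classical in
/-- The inclusion of `N(x)` into `(F_λ N)(a)`. -/
def pinc (N : KMod k C) {a : A} (x : Fib F a) :
    N.obj.obj x.1 →ₗ[k] ((pushDown hF).obj N).obj.obj a :=
  DirectSum.lof k (Fib F a) (fun x => N.obj.obj x.1) x

/-- The projection of `(F_λ N)(a)` onto `N(x)`. -/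
def pcomp (N : KMod k C) {a : A} (x : Fib F a) :
    ((pushDown hF).obj N).obj.obj a →ₗ[k] N.obj.obj x.1 :=
  DirectSum.component k (Fib F a) (fun x => N.obj.obj x.1) x

@[simp]
theorem pcomp_pinc {a : A} (x : Fib F a) (m : N.obj.obj x.1) :
    pcomp hF N x (pinc hF N x m) = m := by
  classical
  exact DirectSum.component.lof_self k (M := fun x : Fib F a => N.obj.obj x.1) x m

theorem pcomp_pinc_ne {a : A} {x y : Fib F a} (h : x ≠ y) (m : N.obj.obj x.1) :
    pcomp hF N y (pinc hF N x m) = 0 := by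
  classical
  exact DirectSum.of_eq_of_ne (β := fun x : Fib F a => N.obj.obj x.1) _ _ _ (Ne.symm h)

theorem push_ext {a : A} {z z' : ((pushDown hF).obj N).obj.obj a}
    (h : ∀ x, pcomp hF N x z = pcomp hF N x z') : z = z' :=
  DFinsupp.ext h

theorem push_induction {a : A} {p : ((pushDown hF).obj N).obj.obj a → Prop}
    (h₀ : p 0) (h₁ : ∀ x m, p (pinc hF N x m)) (h₂ : ∀ z z', p z → p z' → p (z + z'))
    (z : ((pushDown hF).obj N).obj.obj a) : p z := by
  classical
  exact DirectSum.induction_on (β := fun x : Fib F a => N.obj.obj x.1) z h₀ h₁ h₂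

theorem push_linearMap_ext {V : Type*} [AddCommGroup V] [Module k V] {a : A}
    {φ ψ : ((pushDown hF).obj N).obj.obj a →ₗ[k] V}
    (h : ∀ x m, φ (pinc hF N x m) = ψ (pinc hF N x m)) : φ = ψ := by
  refine LinearMap.ext fun z => ?_
  induction z using push_induction hF with
  | h₀ => rw [map_zero, map_zero]
  | h₁ x m => exact h x m
  | h₂ z z' h₁ h₂ => rw [map_add, map_add, h₁, h₂]

theorem finite_pcomp_ne_zero {a : A} (z : ((pushDown hF).obj N).obj.obj a) :
    {x : Fib F a | pcomp hF N x z ≠ 0}.Finite :=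
  DFinsupp.finite_support (β := fun x : Fib F a => N.obj.obj x.1) z

@[simp]
theorem ap_push_pinc (f : M ⟶ N) {a : A} (x : Fib F a) (m : M.obj.obj x.1) :
    KMod.ap ((pushDown hF).map f) a (pinc hF M x m) = pinc hF N x (KMod.ap f x.1 m) := by
  classical
  exact DirectSum.lmap_lof (f := fun x : Fib F a => (f.hom.app x.1).hom) x m

@[simp]
theorem pcomp_ap_push (f : M ⟶ N) {a : A} (x : Fib F a) (z : ((pushDown hF).obj M).obj.obj a) :
    pcomp hF N x (KMod.ap ((pushDown hF).map f) a z) = KMod.ap f x.1 (pcomp hF M x z) :=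
  DirectSum.lmap_apply (fun x : Fib F a => (f.hom.app x.1).hom) z x

theorem map_pinc {a b : A} (x : Fib F a) (y : Fib F b) (f : x.1 ⟶ y.1) (m : N.obj.obj x.1) :
    ((pushDown hF).obj N).obj.map (eqToHom x.2.symm ≫ F.map f ≫ eqToHom y.2) (pinc hF N x m) =
      pinc hF N y (N.obj.map f m) := by
  classical
  have h₁ := pushMap_lof hF N (eqToHom x.2.symm ≫ F.map f ≫ eqToHom y.2) x m
  have h₂ : liftHom hF x.1 b (eqToHom x.2 ≫ eqToHom x.2.symm ≫ F.map f ≫ eqToHom y.2) =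
      DirectSum.lof k (Fib F b) (fun y => (x.1 ⟶ y.1)) y f :=
    liftHom_eq hF _ _ _ _ (by rw [outMap_lof]; simp)
  rw [h₂] at h₁
  exact h₁.trans (evalFam_lof F N x.1 b y f m)

theorem fib_exists (x : C) (y : Fib F (F.obj x)) :
    ∃ g, y = ⟨(ρ.act g).obj x, hF.obj_act g x⟩ := by
  obtain ⟨g, hg⟩ := hF.transitive x y.1 y.2.symm
  exact ⟨g, Subtype.ext hg.symm⟩

theorem IsGaloisCovering.act_injective (hF : IsGaloisCovering ρ F) {g h : G} {x : C}
    (e : (ρ.act g).obj x = (ρ.act h).obj x) : g = h := by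
  have : (ρ.act (h⁻¹ * g)).obj x = x := by
    rw [ρ.act_mul]
    change (ρ.act h⁻¹).obj ((ρ.act g).obj x) = x
    rw [e, ρ.act_inv_act]
  exact (inv_mul_eq_one.1 (hF.free _ _ this)).symm

/-- On the summand at `g x`, the morphism `F.map f` acts as `g f` and lands in the summand at `g y`.
By freeness this meets the summand at `y` only for `g = 1`. -/
theorem pcomp_map {x y : C} (f : x ⟶ y) (z : ((pushDown hF).obj N).obj.obj (F.obj x)) :
    pcomp hF N ⟨y, rfl⟩ (((pushDown hF).obj N).obj.map (F.map f) z) =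
      N.obj.map f (pcomp hF N ⟨x, rfl⟩ z) := by
  induction z using push_induction hF with
  | h₀ => simp
  | h₂ z z' h₁ h₂ => simp only [map_add, h₁, h₂]
  | h₁ x' m =>
    obtain ⟨g, rfl⟩ := fib_exists hF x x'
    have e := map_pinc hF ⟨(ρ.act g).obj x, hF.obj_act g x⟩ ⟨(ρ.act g).obj y, hF.obj_act g y⟩
      ((ρ.act g).map f) m
    have e' : eqToHom (hF.obj_act g x).symm ≫ F.map ((ρ.act g).map f) ≫ eqToHom (hF.obj_act g y) =
        F.map f := by
      rw [map_act hF g f]; simp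
    rw [e'] at e
    rw [e]
    by_cases hg : g = 1
    -- `ρ.act 1` is the identity only up to a propositional equality, so the claim is generalised to
    -- arbitrary fibre elements before substituting.
    · have key : ∀ (x' : Fib F (F.obj x)) (y' : Fib F (F.obj y)) (f' : x'.1 ⟶ y'.1)
          (m : N.obj.obj x'.1) (hx : x'.1 = x) (hy : y'.1 = y)
          (_ : f' = eqToHom hx ≫ f ≫ eqToHom hy.symm),
          pcomp hF N ⟨y, rfl⟩ (pinc hF N y' (N.obj.map f' m)) =
            N.obj.map f (pcomp hF N ⟨x, rfl⟩ (pinc hF N x' m)) := by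
        rintro ⟨x', hx'⟩ ⟨y', hy'⟩ f' m (rfl : x' = x) (rfl : y' = y) rfl
        rw [pcomp_pinc, pcomp_pinc]
        simp
      subst hg
      exact key _ _ _ m (Functor.congr_obj ρ.act_one x) (Functor.congr_obj ρ.act_one y)
        (Functor.congr_hom ρ.act_one f)
    · rw [pcomp_pinc_ne hF (fun h => hg (hF.free g y (Subtype.ext_iff.1 h))),
        pcomp_pinc_ne hF (fun h => hg (hF.free g x (Subtype.ext_iff.1 h))), map_zero]

theorem twistIso_hom_pinc (g : G) (M : KMod k C) {a : A} (x : Fib F a)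
    (m : ((twist ρ g).obj M).obj.obj x.1) :
    KMod.ap (pushDownTwist hF g M).hom a (pinc hF ((twist ρ g).obj M) x m) =
      pinc hF M ((fibEquiv hF g a).symm x) m := by
  classical
  exact twistEquiv_lof hF g M a x m

theorem pcomp_twistIso_hom (g : G) (M : KMod k C) {a : A} (x : Fib F a)
    (z : ((pushDown hF).obj ((twist ρ g).obj M)).obj.obj a) :
    pcomp hF M ((fibEquiv hF g a).symm x) (KMod.ap (pushDownTwist hF g M).hom a z) =
      pcomp hF ((twist ρ g).obj M) x z := by
  induction z using push_induction hF with
  | h₀ => simp only [map_zero]; rfl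
  | h₂ z z' h₁ h₂ =>
    rw [map_add, map_add, h₁, h₂]
    exact (map_add (pcomp hF ((twist ρ g).obj M) x) z z').symm
  | h₁ y m =>
    refine (congrArg (pcomp hF M ((fibEquiv hF g a).symm x)) (twistIso_hom_pinc hF g M y m)).trans ?_
    by_cases h : y = x
    · subst h
      exact (pcomp_pinc hF (N := M) ((fibEquiv hF g a).symm y) m).trans
        (pcomp_pinc hF (N := (twist ρ g).obj M) _ _).symm
    · exact (pcomp_pinc_ne hF (N := M)
        (fun e => h ((fibEquiv hF g a).symm.injective e)) m).trans
        (pcomp_pinc_ne hF (N := (twist ρ g).obj M) h m).symm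

theorem pcomp_twistIso_inv (g : G) (M : KMod k C) {a : A} (x : Fib F a)
    (z : ((pushDown hF).obj M).obj.obj a) :
    pcomp hF ((twist ρ g).obj M) x (KMod.ap (pushDownTwist hF g M).inv a z) =
      pcomp hF M ((fibEquiv hF g a).symm x) z := by
  rw [← pcomp_twistIso_hom, KMod.ap_hom_inv]

theorem twistIso_natural (g : G) (f : M ⟶ N) :
    (pushDown hF).map ((twist ρ g).map f) ≫ (pushDownTwist hF g N).hom =
      (pushDownTwist hF g M).hom ≫ (pushDown hF).map f := by
  refine KMod.hom_ext fun a => LinearMap.congr_fun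
    (f := KMod.ap ((pushDown hF).map ((twist ρ g).map f) ≫ (pushDownTwist hF g N).hom) a)
    (g := KMod.ap ((pushDownTwist hF g M).hom ≫ (pushDown hF).map f) a)
    (push_linearMap_ext hF fun x m => ?_)
  rw [KMod.ap_comp, KMod.ap_comp, ap_push_pinc]
  refine (twistIso_hom_pinc hF g N x _).trans (Eq.trans ?_
    (congrArg (KMod.ap ((pushDown hF).map f) a) (twistIso_hom_pinc hF g M x m)).symm)
  exact (ap_push_pinc hF f ((fibEquiv hF g a).symm x) m).symm

/-- The component of degree `1` of a morphism between push-downs. -/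
def degreeOne : ((pushDown hF).obj M ⟶ (pushDown hF).obj N) →+ (M ⟶ N) where
  toFun φ := KMod.ofAp
    (fun x => pcomp hF N ⟨x, rfl⟩ ∘ₗ KMod.ap φ (F.obj x) ∘ₗ pinc hF M ⟨x, rfl⟩)
    fun {x y} f m => by
      have h := map_pinc hF (N := M) ⟨x, rfl⟩ ⟨y, rfl⟩ f m
      have e : eqToHom (rfl : F.obj x = F.obj x) ≫ F.map f ≫ eqToHom (rfl : F.obj y = F.obj y) =
        F.map f := by simp
      erw [e] at h
      change pcomp hF N ⟨y, rfl⟩ (KMod.ap φ (F.obj y) (pinc hF M ⟨y, rfl⟩ (M.obj.map f m))) = _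
      rw [← h, KMod.ap_map, pcomp_map]
      rfl
  map_zero' := KMod.hom_ext fun x m => map_zero (pcomp hF N ⟨x, rfl⟩)
  map_add' φ ψ := KMod.hom_ext fun x m => map_add (pcomp hF N ⟨x, rfl⟩) _ _

theorem ap_degreeOne (φ : (pushDown hF).obj M ⟶ (pushDown hF).obj N) (x : C)
    (m : M.obj.obj x) :
    KMod.ap (degreeOne hF φ) x m =
      pcomp hF N ⟨x, rfl⟩ (KMod.ap φ (F.obj x) (pinc hF M ⟨x, rfl⟩ m)) := rfl

/-- A version of `ap_degreeOne` for arbitrary elements of fibres. -/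
theorem ap_degreeOne' (φ : (pushDown hF).obj M ⟶ (pushDown hF).obj N) {a : A} (x : Fib F a)
    (m : M.obj.obj x.1) :
    KMod.ap (degreeOne hF φ) x.1 m = pcomp hF N x (KMod.ap φ a (pinc hF M x m)) := by
  obtain ⟨x, rfl⟩ := x
  rfl

theorem degreeOne_map_comp (f : L ⟶ M) (φ : (pushDown hF).obj M ⟶ (pushDown hF).obj N) :
    degreeOne hF ((pushDown hF).map f ≫ φ) = f ≫ degreeOne hF φ := by
  refine KMod.hom_ext fun x m => ?_
  rw [ap_degreeOne, KMod.ap_comp, ap_push_pinc, KMod.ap_comp, ap_degreeOne]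

theorem degreeOne_comp_map (φ : (pushDown hF).obj L ⟶ (pushDown hF).obj M) (f : M ⟶ N) :
    degreeOne hF (φ ≫ (pushDown hF).map f) = degreeOne hF φ ≫ f := by
  refine KMod.hom_ext fun x m => ?_
  rw [ap_degreeOne, KMod.ap_comp, pcomp_ap_push, KMod.ap_comp, ap_degreeOne]

theorem degreeOne_id : degreeOne hF (𝟙 ((pushDown hF).obj M)) = 𝟙 M := by
  refine KMod.hom_ext fun x m => ?_
  rw [ap_degreeOne, KMod.ap_id, pcomp_pinc, KMod.ap_id]

end PushElements

/-! ### The push-down functor as an orbit functor -/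

section PushOrbit

variable {k : Type u} [Field k]
  {C : Type u} [Category.{u} C] [Preadditive C] [Linear k C]
  {A : Type u} [Category.{u} A] [Preadditive A] [Linear k A]
  {G : Type u} [Group G] {ρ : KAction k C G} {F : C ⥤ A} [F.Additive] [F.Linear k]
  (hF : IsGaloisCovering ρ F) {L M N : KMod k C}

instance {C' : Type u} [Category.{u} C'] [Preadditive C'] [Linear k C'] (Φ : C' ⥤ C)
    [Φ.Additive] [Φ.Linear k] : (pullUp (k := k) Φ).Additive where
  map_add := rfl

instance (g : G) : (twist ρ g).Additive := inferInstanceAs (pullUp (ρ.act g⁻¹)).Additive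

theorem preservesFinite_of_exact {𝒟 𝒟' : Type*} [Category 𝒟] [Category 𝒟'] [Abelian 𝒟]
    [Abelian 𝒟'] (Φ : 𝒟 ⥤ 𝒟') [Φ.Additive]
    (h : ∀ S : ShortComplex 𝒟, S.Exact → (S.map Φ).Exact) :
    PreservesFiniteLimits Φ ∧ PreservesFiniteColimits Φ :=
  ((Functor.exact_tfae Φ).out 1 3).1 h

theorem pullUp_preservesFinite {C' : Type u} [Category.{u} C'] [Preadditive C'] [Linear k C']
    (Φ : C' ⥤ C) [Φ.Additive] [Φ.Linear k] :
    PreservesFiniteLimits (pullUp (k := k) Φ) ∧ PreservesFiniteColimits (pullUp (k := k) Φ) :=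
  preservesFinite_of_exact _ fun S hS =>
    (KMod.exact_iff _).2 fun x => (KMod.exact_iff S).1 hS (Φ.obj x)

/-- Exactness is checked componentwise; an element of a fibre has finite support, so preimages of
its components form a finite sum. -/
theorem pushDown_preservesFinite :
    PreservesFiniteLimits (pushDown hF) ∧ PreservesFiniteColimits (pushDown hF) := by
  classical
  refine preservesFinite_of_exact _ fun S hS => (KMod.exact_iff _).2
    fun a (z : ((pushDown hF).obj S.X₂).obj.obj a) hz => ?_
  replace hz : KMod.ap ((pushDown hF).map S.g) a z = 0 := hz
  have h : ∀ x : Fib F a, ∃ l, KMod.ap S.f x.1 l = pcomp hF S.X₂ x z := fun x => by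
    refine (KMod.exact_iff S).1 hS x.1 _ ?_
    rw [← pcomp_ap_push]
    rw [hz, map_zero]
  choose l hl using h
  have hfin := finite_pcomp_ne_zero hF z
  suffices H : ∃ l : ((pushDown hF).obj S.X₁).obj.obj a, KMod.ap ((pushDown hF).map S.f) a l = z
    from H
  refine ⟨∑ x ∈ hfin.toFinset, pinc hF S.X₁ x (l x), push_ext hF fun y => ?_⟩
  refine (pcomp_ap_push hF S.f y _).trans ?_
  rw [map_sum]
  by_cases hy : pcomp hF S.X₂ y z = 0
  · rw [Finset.sum_eq_zero, map_zero, hy]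
    intro x hx
    refine pcomp_pinc_ne hF (fun e => ?_) _
    subst e
    simp [hy] at hx
  · rw [Finset.sum_eq_single y, pcomp_pinc, hl]
    · exact fun x _ hx => pcomp_pinc_ne hF hx _
    · intro h
      simp [hy] at h

instance : PreservesFiniteLimits (pushDown hF) := (pushDown_preservesFinite hF).1
instance : PreservesFiniteColimits (pushDown hF) := (pushDown_preservesFinite hF).2

theorem IsFinDim.twist (g : G) (h : IsFinDim M) : IsFinDim ((twist ρ g).obj M) := by
  let e : C ≃ C :=
    { toFun := (ρ.act g).obj
      invFun := (ρ.act g⁻¹).obj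
      left_inv := ρ.act_inv_act g
      right_inv := ρ.act_act_inv g }
  have : Module.Finite k M.Tot := h
  exact Module.Finite.equiv (reindex k e fun x => M.obj.obj x).symm

open Classical in
/-- The canonical map from the total space of `N` to that of its push-down. -/
def pushTot (N : KMod k C) : N.Tot →ₗ[k] ((pushDown hF).obj N).Tot :=
  DirectSum.toModule k C _ fun x =>
    DirectSum.lof k A (fun a => ((pushDown hF).obj N).obj.obj a) (F.obj x) ∘ₗ pinc hF N ⟨x, rfl⟩

open Classical in
theorem pushTot_lof (x : C) (m : N.obj.obj x) :
    pushTot hF N (DirectSum.lof k C (fun x => N.obj.obj x) x m) =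
      DirectSum.lof k A (fun a => ((pushDown hF).obj N).obj.obj a) (F.obj x)
        (pinc hF N ⟨x, rfl⟩ m) :=
  DirectSum.toModule_lof k (M := fun x => N.obj.obj x) x m

/-- The push-down only regroups the total space along the fibres of `F`: `pushTot` is injective,
since its coordinates are recovered by `pcomp`, and surjective, since every summand of a fibre is
reached. -/
theorem isFinDim_pushDown_iff : IsFinDim ((pushDown hF).obj N) ↔ IsFinDim N := by
  classical
  constructor
  · intro h
    have : Module.Finite k ((pushDown hF).obj N).Tot := h
    refine Module.Finite.of_injective (pushTot hF N) fun z z' hz => DFinsupp.ext fun x => ?_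
    have key : ∀ x, DirectSum.component k C (fun x => N.obj.obj x) x =
        pcomp hF N ⟨x, rfl⟩ ∘ₗ
          DirectSum.component k A (fun a => ((pushDown hF).obj N).obj.obj a) (F.obj x) ∘ₗ
            pushTot hF N := by
      intro x
      refine DirectSum.linearMap_ext _ fun y => LinearMap.ext fun m => ?_
      simp only [LinearMap.comp_apply]
      erw [pushTot_lof]
      by_cases hxy : y = x
      · subst hxy
        erw [DirectSum.component.lof_self, DirectSum.component.lof_self, pcomp_pinc]
      · erw [DirectSum.component.of, dif_neg hxy]
        by_cases hF' : F.obj y = F.obj x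
        · have e : ∀ (a : A) (ha : F.obj y = a), DirectSum.component k A
              (fun a => ((pushDown hF).obj N).obj.obj a) a
              (DirectSum.lof k A (fun a => ((pushDown hF).obj N).obj.obj a) (F.obj y)
                (pinc hF N ⟨y, rfl⟩ m)) = pinc hF N ⟨y, ha⟩ m := by
            rintro _ rfl
            exact DirectSum.component.lof_self _ _ _
          rw [e _ hF']
          exact (pcomp_pinc_ne hF (N := N) (x := ⟨y, hF'⟩) (y := ⟨x, rfl⟩)
            (fun h => hxy (Subtype.ext_iff.1 h)) m).symm
        · erw [DirectSum.component.of, dif_neg hF', map_zero]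
    exact (LinearMap.congr_fun (key x) z).trans
      ((congrArg (fun t => pcomp hF N ⟨x, rfl⟩ (t (F.obj x))) hz).trans
        (LinearMap.congr_fun (key x) z').symm)
  · intro h
    have : Module.Finite k N.Tot := h
    refine Module.Finite.of_surjective (pushTot hF N) fun z => ?_
    induction z using DirectSum.induction_on with
    | zero => exact ⟨0, map_zero _⟩
    | add _ _ h₁ h₂ =>
      obtain ⟨a, rfl⟩ := h₁
      obtain ⟨b, rfl⟩ := h₂
      exact ⟨a + b, map_add _ _ _⟩
    | of a z =>
      induction z using push_induction hF with
      | h₀ => exact ⟨0, by simp⟩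
      | h₁ x m =>
        obtain ⟨x, rfl⟩ := x
        exact ⟨_, pushTot_lof hF x m⟩
      | h₂ z z' h₁ h₂ =>
        obtain ⟨a, ha⟩ := h₁
        obtain ⟨b, hb⟩ := h₂
        exact ⟨a + b, by rw [map_add, map_add, ha, hb]⟩

/-- If a pointwise finite family of linear maps has finite dimensional source, then it is finite. -/
theorem finite_ne_zero_of_pointwise {V ι : Type*} {W : ι → Type*} [AddCommGroup V] [Module k V]
    [Module.Finite k V] [∀ i, AddCommGroup (W i)] [∀ i, Module k (W i)] (l : ∀ i, V →ₗ[k] W i)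
    (h : ∀ v, {i | l i v ≠ 0}.Finite) : {i | l i ≠ 0}.Finite := by
  obtain ⟨s, hs⟩ := (Module.Finite.fg_top : (⊤ : Submodule k V).FG)
  refine (s.finite_toSet.biUnion fun v _ => h v).subset fun i hi => ?_
  by_contra hne
  refine hi (LinearMap.ext_on hs fun v hv => ?_)
  by_contra hv'
  exact hne (Set.mem_biUnion hv hv')

/-- A morphism `φ : F_λ M → F_λ N` is a finite sum of members of a family `(ψ_g)` as soon as each
matrix entry of `φ` is a matrix entry of exactly one `ψ_g`, the corresponding entries of the other
members of the family being zero. -/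
theorem mem_closure_of_entries (hM : IsFinDim M) (φ : (pushDown hF).obj M ⟶ (pushDown hF).obj N)
    (ψ : G → ((pushDown hF).obj M ⟶ (pushDown hF).obj N)) (R : ∀ a, G → Fib F a → Fib F a → Prop)
    (hR : ∀ a x y, ∃! g, R a g x y)
    (h₁ : ∀ a g x y m, R a g x y → pcomp hF N y (KMod.ap (ψ g) a (pinc hF M x m)) =
      pcomp hF N y (KMod.ap φ a (pinc hF M x m)))
    (h₂ : ∀ a g x y m, ¬ R a g x y → pcomp hF N y (KMod.ap (ψ g) a (pinc hF M x m)) = 0) :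
    φ ∈ AddSubgroup.closure (Set.range ψ) := by
  classical
  -- The total space of `F_λ M` is finite dimensional, so it suffices that each vector is
  -- annihilated by almost all `ψ g`.
  have hfin : {g | ψ g ≠ 0}.Finite := by
    have : Module.Finite k ((pushDown hF).obj M).Tot := (isFinDim_pushDown_iff hF).2 hM
    have hpt := finite_ne_zero_of_pointwise (k := k) (V := ((pushDown hF).obj M).Tot)
      (fun g => KMod.totMap (ψ g)) fun z => ?_
    · refine hpt.subset fun g hg h => hg (KMod.totMap_injective (h.trans ?_))
      exact (LinearMap.ext fun m => DFinsupp.ext fun x => KMod.totMap_apply _ _ _).symm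
    · induction z using DirectSum.induction_on with
      | zero => simp
      | add z z' h h' =>
        refine (h.union h').subset fun g hg => ?_
        by_contra hne
        simp only [Set.mem_union, Set.mem_ofPred_eq, not_or, not_not] at hne
        exact hg (by rw [map_add, hne.1, hne.2, add_zero])
      | of a z =>
        induction z using push_induction hF with
        | h₀ => simp
        | h₂ z z' h h' =>
          refine (h.union h').subset fun g hg => ?_
          by_contra hne
          simp only [Set.mem_union, Set.mem_ofPred_eq, not_or, not_not] at hne
          exact hg (by rw [map_add, map_add, hne.1, hne.2, add_zero])
        | h₁ x m =>
          -- On the summand at `x`, a non-zero value of `ψ g` needs a non-zero entry of `φ` at some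
          -- `y`, and `γ y` is the only degree that contains this entry.
          choose γ hγ hγ' using fun y => hR a x y
          refine ((finite_pcomp_ne_zero hF (KMod.ap φ a (pinc hF M x m))).image γ).subset ?_
          intro g hg
          by_contra hne
          refine hg ?_
          have e : KMod.ap (ψ g) a (pinc hF M x m) = 0 := by
            refine push_ext hF fun y => ?_
            rw [map_zero]
            by_cases hy : R a g x y
            · rw [h₁ a g x y m hy]
              by_contra hy'
              exact hne ⟨y, hy', (hγ' y g hy).symm⟩
            · exact h₂ a g x y m hy
          refine (DirectSum.lmap_lof (R := k) (f := fun x => KMod.ap (ψ g) x) a _).trans ?_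
          erw [e, map_zero]
  have hφ : φ = ∑ g ∈ hfin.toFinset, ψ g := by
    have hsum : ∀ (s : Finset G) a (z : ((pushDown hF).obj M).obj.obj a),
        KMod.ap (∑ g ∈ s, ψ g) a z = ∑ g ∈ s, KMod.ap (ψ g) a z := by
      intro s a z
      induction s using Finset.induction_on with
      | empty => rfl
      | insert g s hg ih => rw [Finset.sum_insert hg, Finset.sum_insert hg, KMod.ap_add, ih]
    refine KMod.hom_ext fun a => LinearMap.congr_fun (f := KMod.ap φ a)
      (g := KMod.ap (∑ g ∈ hfin.toFinset, ψ g) a) (push_linearMap_ext hF fun x m =>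
        push_ext hF fun y => ?_)
    rw [hsum, map_sum]
    obtain ⟨g, hg, hg'⟩ := hR a x y
    rw [Finset.sum_eq_single g, h₁ a g x y m hg]
    · exact fun g' _ hne => h₂ a g' x y m fun h => hne (hg' g' h)
    · intro h
      have : ψ g = 0 := by simpa using h
      rw [this, KMod.ap_zero, map_zero]
  rw [hφ]
  exact sum_mem fun g _ => AddSubgroup.subset_closure ⟨g, rfl⟩

/-- `G` acts simply transitively on each fibre. -/
theorem existsUnique_fibEquiv_symm {a : A} (x y : Fib F a) :
    ∃! g, (fibEquiv hF g a).symm x = y := by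
  obtain ⟨g, hg⟩ := hF.transitive x.1 y.1 (x.2.trans y.2.symm)
  refine ⟨g⁻¹, Subtype.ext ?_, fun g' h => ?_⟩
  · change (ρ.act (g⁻¹)⁻¹).obj x.1 = y.1
    rw [inv_inv, hg]
  · have h' : (ρ.act g'⁻¹).obj x.1 = y.1 := congrArg Subtype.val h
    rw [← hF.act_injective (h'.trans hg.symm), inv_inv]

theorem ap_push_twist (g : G) (f : M ⟶ (twist ρ g).obj N) {a : A} (x : Fib F a)
    (m : M.obj.obj x.1) :
    KMod.ap ((pushDown hF).map f ≫ (pushDownTwist hF g N).hom) a (pinc hF M x m) =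
      pinc hF N ((fibEquiv hF g a).symm x) (KMod.ap f x.1 m) := by
  rw [KMod.ap_comp, ap_push_pinc]
  exact twistIso_hom_pinc hF g N x _

theorem pcomp_ap_twist_push (g : G) (f : (twist ρ g).obj M ⟶ N) {a : A} (y : Fib F a)
    (z : ((pushDown hF).obj M).obj.obj a) :
    pcomp hF N y (KMod.ap ((pushDownTwist hF g M).inv ≫ (pushDown hF).map f) a z) =
      KMod.ap f y.1 (pcomp hF M ((fibEquiv hF g a).symm y) z) := by
  rw [KMod.ap_comp, pcomp_ap_push]
  exact congrArg (KMod.ap f y.1) (pcomp_twistIso_inv hF g M y z)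

/-- The component of degree `g` collects the entries from `x` to `g⁻¹ x`; by simple transitivity
each matrix entry of `φ` belongs to exactly one degree. -/
theorem pushDown_span_left (hM : IsFinDim M) (φ : (pushDown hF).obj M ⟶ (pushDown hF).obj N) :
    φ ∈ AddSubgroup.closure {ψ | ∃ (g : G) (f : M ⟶ (twist ρ g).obj N),
      ψ = (pushDown hF).map f ≫ (pushDownTwist hF g N).hom} := by
  have key : ∀ g a (x : Fib F a) m,
      KMod.ap (degreeOne hF (φ ≫ (pushDownTwist hF g N).inv)) x.1 m =
        pcomp hF N ((fibEquiv hF g a).symm x) (KMod.ap φ a (pinc hF M x m)) := by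
    intro g a x m
    rw [ap_degreeOne', KMod.ap_comp]
    exact pcomp_twistIso_inv hF g N x _
  refine AddSubgroup.closure_mono ?_ (mem_closure_of_entries hF hM φ
    (fun g => (pushDown hF).map (degreeOne hF (φ ≫ (pushDownTwist hF g N).inv)) ≫
      (pushDownTwist hF g N).hom) (fun a g x y => (fibEquiv hF g a).symm x = y)
    (fun a x y => existsUnique_fibEquiv_symm hF x y) ?_ ?_)
  · rintro _ ⟨g, rfl⟩
    exact ⟨g, _, rfl⟩
  · rintro a g x _ m rfl
    rw [ap_push_twist]
    exact (pcomp_pinc hF _ _).trans (key g a x m)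
  · intro a g x y m h
    rw [ap_push_twist]
    exact pcomp_pinc_ne hF h _

/-- The same decomposition, with the entries indexed by their target. -/
theorem pushDown_span_right (hM : IsFinDim M) (φ : (pushDown hF).obj M ⟶ (pushDown hF).obj N) :
    φ ∈ AddSubgroup.closure {ψ | ∃ (g : G) (f : (twist ρ g).obj M ⟶ N),
      ψ = (pushDownTwist hF g M).inv ≫ (pushDown hF).map f} := by
  have key : ∀ g a (y : Fib F a) m,
      KMod.ap (degreeOne hF ((pushDownTwist hF g M).hom ≫ φ)) y.1 m =
        pcomp hF N y (KMod.ap φ a (pinc hF M ((fibEquiv hF g a).symm y) m)) := by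
    intro g a y m
    rw [ap_degreeOne', KMod.ap_comp]
    exact congrArg (fun t => pcomp hF N y (KMod.ap φ a t)) (twistIso_hom_pinc hF g M y m)
  refine AddSubgroup.closure_mono ?_ (mem_closure_of_entries hF hM φ
    (fun g => (pushDownTwist hF g M).inv ≫
      (pushDown hF).map (degreeOne hF ((pushDownTwist hF g M).hom ≫ φ)))
    (fun a g x y => (fibEquiv hF g a).symm y = x)
    (fun a x y => existsUnique_fibEquiv_symm hF y x) ?_ ?_)
  · rintro _ ⟨g, rfl⟩
    exact ⟨g, _, rfl⟩
  · rintro a g _ y m rfl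
    rw [pcomp_ap_twist_push, pcomp_pinc]
    exact key g a y m
  · intro a g x y m h
    rw [pcomp_ap_twist_push, pcomp_pinc_ne hF (Ne.symm h)]
    exact map_zero _

/-- The natural isomorphism between `F_λ ᵍ(-)` and `F_λ`. -/
def twistNatIso (g : G) : twist ρ g ⋙ pushDown hF ≅ pushDown hF :=
  NatIso.ofComponents (fun M => pushDownTwist hF g M) fun f => twistIso_natural hF g f

/-- The push-down functor is an orbit functor. -/
def pushOrbit : OrbitFunctor (pushDown hF) G where
  t := twist ρ
  θ := twistNatIso hF
  E := degreeOne hF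
  E_map_comp := degreeOne_map_comp hF
  E_comp_map := degreeOne_comp_map hF
  E_id _ := degreeOne_id hF
  fd := IsFinDim
  span_left hX _ φ := pushDown_span_left hF hX φ
  span_right hX _ φ := pushDown_span_right hF hX φ
  t_additive _ := inferInstance
  t_limits g := (pullUp_preservesFinite (k := k) (ρ.act g⁻¹)).1
  t_colimits g := (pullUp_preservesFinite (k := k) (ρ.act g⁻¹)).2
  fd_zero := isFinDim_of_isZero
  fd_biprod := IsFinDim.biprod
  fd_mono f _ h := h.of_mono f
  fd_epi f _ h := h.of_epi f
  fd_t g _ h := h.twist g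
  decomp h := h.isDecomposable
  decomp_obj h _ r := (IsFinDim.of_retract r ((isFinDim_pushDown_iff hF).2 h)).isDecomposable

end PushOrbit

/-! ### Direct sums of modules -/

section DirectSums

variable {k : Type u} [Field k] {C : Type u} [Category.{u} C] [Preadditive C] [Linear k C]
  {M : KMod k C}

/-- The direct sum of a family of modules. -/
def dsum {I : Type u} (N : I → KMod k C) : KMod k C where
  obj :=
    { obj := fun x => ModuleCat.of k (⨁ i, (N i).obj.obj x)
      map := fun f => ModuleCat.ofHom (DirectSum.lmap fun i => ((N i).obj.map f).hom)
      map_id := fun x => ModuleCat.hom_ext (LinearMap.ext fun z => DFinsupp.ext fun i =>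
        (DirectSum.lmap_apply (fun i => ((N i).obj.map (𝟙 x)).hom) z i).trans
          (KMod.map_id_apply _ _))
      map_comp := fun f g => ModuleCat.hom_ext (LinearMap.ext fun z => DFinsupp.ext fun i => by
        change DirectSum.lmap (fun i => ((N i).obj.map (f ≫ g)).hom) z i =
          DirectSum.lmap (fun i => ((N i).obj.map g).hom)
            (DirectSum.lmap (fun i => ((N i).obj.map f).hom) z) i
        simp only [DirectSum.lmap_apply]
        exact KMod.map_comp_apply f g _) }
  property := by
    refine ⟨⟨fun {X Y} a b => ?_⟩, ⟨fun {X Y} a r => ?_⟩⟩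
    · refine ModuleCat.hom_ext (LinearMap.ext fun z => DFinsupp.ext fun i => ?_)
      have := (N i).property.1
      change DirectSum.lmap (fun i => ((N i).obj.map (a + b)).hom) z i =
        DirectSum.lmap (fun i => ((N i).obj.map a).hom) z i +
          DirectSum.lmap (fun i => ((N i).obj.map b).hom) z i
      simp only [DirectSum.lmap_apply, Functor.map_add]
      rfl
    · refine ModuleCat.hom_ext (LinearMap.ext fun z => DFinsupp.ext fun i => ?_)
      have := (N i).property.1
      have := (N i).property.2
      change DirectSum.lmap (fun i => ((N i).obj.map (r • a)).hom) z i =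
        r • DirectSum.lmap (fun i => ((N i).obj.map a).hom) z i
      simp only [DirectSum.lmap_apply, Functor.map_smul]
      rfl

variable {I : Type u} {N : I → KMod k C}

open Classical in
/-- The inclusions into the direct sum. -/
def dsumIncl (N : I → KMod k C) (i : I) : N i ⟶ dsum N :=
  KMod.ofAp (fun x => DirectSum.lof k I (fun i => (N i).obj.obj x) i) fun u m =>
    (DirectSum.lmap_lof (f := fun i => ((N i).obj.map u).hom) i m).symm

/-- The projections from the direct sum. -/
def dsumProj (N : I → KMod k C) (i : I) : dsum N ⟶ N i :=
  KMod.ofAp (fun x => DirectSum.component k I (fun i => (N i).obj.obj x) i) fun u m =>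
    DirectSum.lmap_apply (fun i => ((N i).obj.map u).hom) m i

theorem dsumIncl_proj (i : I) : dsumIncl N i ≫ dsumProj N i = 𝟙 _ := by
  classical
  exact KMod.hom_ext fun x m =>
    DirectSum.component.lof_self k (M := fun i => (N i).obj.obj x) i m

theorem dsumIncl_proj_ne {i j : I} (h : i ≠ j) : dsumIncl N i ≫ dsumProj N j = 0 := by
  classical
  exact KMod.hom_ext fun x m =>
    DirectSum.of_eq_of_ne (β := fun i => (N i).obj.obj x) _ _ _ (Ne.symm h)

theorem dsum_induction {x : C} {p : (dsum N).obj.obj x → Prop} (h₀ : p 0)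
    (h₁ : ∀ i m, p (KMod.ap (dsumIncl N i) x m)) (h₂ : ∀ z z', p z → p z' → p (z + z'))
    (z : (dsum N).obj.obj x) : p z := by
  classical
  exact DirectSum.induction_on (β := fun i => (N i).obj.obj x) z h₀ h₁ h₂

theorem dsum_ext {x : C} {z z' : (dsum N).obj.obj x}
    (h : ∀ i, KMod.ap (dsumProj N i) x z = KMod.ap (dsumProj N i) x z') : z = z' :=
  DFinsupp.ext h

theorem dsum_finite {x : C} (z : (dsum N).obj.obj x) :
    {i | KMod.ap (dsumProj N i) x z ≠ 0}.Finite :=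
  DFinsupp.finite_support (β := fun i => (N i).obj.obj x) z

open Classical in
/-- The components of the morphism out of the direct sum defined by a family. -/
def dsumDescL (f : ∀ i, N i ⟶ M) (x : C) : (dsum N).obj.obj x →ₗ[k] M.obj.obj x :=
  DirectSum.toModule k I (M.obj.obj x) fun i => KMod.ap (f i) x

theorem dsumDescL_incl (f : ∀ i, N i ⟶ M) (x : C) (i : I) (m : (N i).obj.obj x) :
    dsumDescL f x (KMod.ap (dsumIncl N i) x m) = KMod.ap (f i) x m := by
  classical
  exact DirectSum.toModule_lof k (M := fun i => (N i).obj.obj x) (φ := fun i => KMod.ap (f i) x) i m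

/-- The morphism out of the direct sum defined by a family. -/
def dsumDesc (f : ∀ i, N i ⟶ M) : dsum N ⟶ M :=
  KMod.ofAp (dsumDescL f) <| by
    intro x y u z
    induction z using dsum_induction with
    | h₀ => rw [map_zero, map_zero, map_zero, map_zero]
    | h₂ z z' h₁ h₂ => rw [map_add, map_add, map_add, map_add, h₁, h₂]
    | h₁ i m => rw [← KMod.ap_map, dsumDescL_incl, dsumDescL_incl, KMod.ap_map]

theorem dsumIncl_desc (f : ∀ i, N i ⟶ M) (i : I) : dsumIncl N i ≫ dsumDesc f = f i :=
  KMod.hom_ext fun x m => dsumDescL_incl f x i m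

theorem dsum_hom_ext {f g : dsum N ⟶ M} (h : ∀ i, dsumIncl N i ≫ f = dsumIncl N i ≫ g) :
    f = g := by
  refine KMod.hom_ext fun x z => ?_
  induction z using dsum_induction with
  | h₀ => simp
  | h₂ z z' h₁ h₂ => simp only [map_add, h₁, h₂]
  | h₁ i m => rw [← KMod.ap_comp, h, KMod.ap_comp]

theorem isDirectSum_dsum (N : I → KMod k C) : IsDirectSum N (dsum N) (dsumIncl N) :=
  ⟨Cofan.IsColimit.mk _ (fun s => dsumDesc s.inj) (fun s i => dsumIncl_desc s.inj i)
    fun s m h => dsum_hom_ext fun i => (h i).trans (dsumIncl_desc s.inj i).symm⟩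

theorem isDirectSum_of_iso {incl : ∀ i, N i ⟶ M} (e : dsum N ≅ M)
    (h : ∀ i, dsumIncl N i ≫ e.hom = incl i) : IsDirectSum N M incl := by
  obtain ⟨c⟩ := isDirectSum_dsum N
  exact ⟨c.ofIsoColimit (Cofan.ext e h)⟩

/-- With its converse `isDirectSum_of_proj`, this replaces the universal property by orthogonal
projections that are pointwise finite and jointly injective, conditions which can be checked after
pulling up along `F`. -/
theorem IsDirectSum.exists_proj {incl : ∀ i, N i ⟶ M} (h : IsDirectSum N M incl) :
    ∃ p : ∀ i, M ⟶ N i, (∀ i, incl i ≫ p i = 𝟙 _) ∧ (∀ i j, i ≠ j → incl i ≫ p j = 0) ∧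
      (∀ x (m : M.obj.obj x), {i | KMod.ap (p i) x m ≠ 0}.Finite) ∧
      ∀ x (m : M.obj.obj x), (∀ i, KMod.ap (p i) x m = 0) → m = 0 := by
  obtain ⟨c⟩ := h
  obtain ⟨c'⟩ := isDirectSum_dsum N
  let e : M ≅ dsum N := c.coconePointUniqueUpToIso c'
  have he : ∀ i, incl i ≫ e.hom = dsumIncl N i := fun i =>
    c.comp_coconePointUniqueUpToIso_hom c' ⟨i⟩
  refine ⟨fun i => e.hom ≫ dsumProj N i, fun i => ?_, fun i j hij => ?_, fun x m => ?_,
    fun x m hm => ?_⟩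
  · rw [reassoc_of% (he i), dsumIncl_proj]
  · rw [reassoc_of% (he i), dsumIncl_proj_ne hij]
  · exact dsum_finite (KMod.ap e.hom x m)
  · rw [← KMod.ap_inv_hom e x m]
    have : KMod.ap e.hom x m = 0 := dsum_ext fun i => (hm i).trans (map_zero _).symm
    rw [this, map_zero]

theorem isDirectSum_of_proj {incl : ∀ i, N i ⟶ M} (p : ∀ i, M ⟶ N i)
    (h₁ : ∀ i, incl i ≫ p i = 𝟙 _) (h₂ : ∀ i j, i ≠ j → incl i ≫ p j = 0)
    (h₃ : ∀ x (m : M.obj.obj x), {i | KMod.ap (p i) x m ≠ 0}.Finite)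
    (h₄ : ∀ x (m : M.obj.obj x), (∀ i, KMod.ap (p i) x m = 0) → m = 0) :
    IsDirectSum N M incl := by
  have hp : ∀ j, dsumDesc incl ≫ p j = dsumProj N j := fun j => dsum_hom_ext fun i => by
    rw [← Category.assoc, dsumIncl_desc]
    by_cases h : i = j
    · subst h
      rw [h₁, dsumIncl_proj]
    · rw [h₂ i j h, dsumIncl_proj_ne h]
  have : IsIso (dsumDesc incl) := by
    refine KMod.isIso_of_bijective _ fun x => ⟨?_, fun m => ?_⟩
    · intro z z' hz
      refine dsum_ext fun j => ?_
      rw [← hp, KMod.ap_comp, hz, KMod.ap_comp]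
    · classical
      refine ⟨∑ i ∈ (h₃ x m).toFinset, KMod.ap (dsumIncl N i) x (KMod.ap (p i) x m), ?_⟩
      rw [← sub_eq_zero]
      refine h₄ x _ fun j => ?_
      rw [map_sub, ← KMod.ap_comp, hp, map_sum, sub_eq_zero]
      by_cases hj : KMod.ap (p j) x m = 0
      · rw [hj]
        refine Finset.sum_eq_zero fun i hi => ?_
        rw [← KMod.ap_comp, dsumIncl_proj_ne, KMod.ap_zero]
        rintro rfl
        simp [hj] at hi
      · rw [Finset.sum_eq_single j, ← KMod.ap_comp, dsumIncl_proj, KMod.ap_id]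
        · intro i _ hij
          rw [← KMod.ap_comp, dsumIncl_proj_ne hij, KMod.ap_zero]
        · intro h
          simp [hj] at h
  exact isDirectSum_of_iso (asIso (dsumDesc incl)) fun i => dsumIncl_desc incl i

/-- A morphism from a finite dimensional module to a direct sum involves finitely many summands. -/
theorem exists_finset_sum_of_proj {incl : ∀ i, N i ⟶ M} (p : ∀ i, M ⟶ N i)
    (h₁ : ∀ i, incl i ≫ p i = 𝟙 _) (h₂ : ∀ i j, i ≠ j → incl i ≫ p j = 0)
    (h₃ : ∀ x (m : M.obj.obj x), {i | KMod.ap (p i) x m ≠ 0}.Finite)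
    (h₄ : ∀ x (m : M.obj.obj x), (∀ i, KMod.ap (p i) x m = 0) → m = 0) {X : KMod k C}
    (hX : IsFinDim X) (a : X ⟶ M) : ∃ s : Finset I, a = ∑ i ∈ s, a ≫ p i ≫ incl i := by
  classical
  have : Module.Finite k X.Tot := hX
  have hfin := finite_ne_zero_of_pointwise (k := k) (V := X.Tot)
      (fun i => KMod.totMap (a ≫ p i)) fun z => ?_
  · refine ⟨hfin.toFinset, ?_⟩
    rw [← sub_eq_zero]
    have key : ∀ j, (a - ∑ i ∈ hfin.toFinset, a ≫ p i ≫ incl i) ≫ p j = 0 := by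
      intro j
      rw [Preadditive.sub_comp, Preadditive.sum_comp, sub_eq_zero]
      by_cases hj : a ≫ p j = 0
      · rw [hj]
        refine (Finset.sum_eq_zero fun i hi => ?_).symm
        rw [Category.assoc, Category.assoc, h₂ i j, comp_zero, comp_zero]
        rintro rfl
        refine (Set.Finite.mem_toFinset hfin).1 hi ?_
        rw [hj]
        exact (KMod.totHom X (N i)).map_zero
      · rw [Finset.sum_eq_single j, Category.assoc, Category.assoc, h₁, Category.comp_id]
        · intro i _ hij
          rw [Category.assoc, Category.assoc, h₂ i j hij, comp_zero, comp_zero]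
        · intro h
          refine absurd ?_ hj
          have h' : KMod.totMap (a ≫ p j) = 0 := by
            by_contra hne
            exact h ((Set.Finite.mem_toFinset hfin).2 hne)
          exact KMod.totMap_injective (h'.trans ((KMod.totHom X (N j)).map_zero).symm)
    refine KMod.hom_ext fun x m => h₄ x _ fun j => ?_
    rw [← KMod.ap_comp, key, KMod.ap_zero]
  · induction z using DirectSum.induction_on with
    | zero => simp
    | add z z' h h' =>
      refine (h.union h').subset fun g hg => ?_
      by_contra hne
      simp only [Set.mem_union, Set.mem_ofPred_eq, not_or, not_not] at hne
      exact hg (by rw [map_add, hne.1, hne.2, add_zero])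
    | of x m =>
      refine (h₃ x (KMod.ap a x m)).subset fun i hi h => hi ?_
      refine (DirectSum.lmap_lof (R := k) (f := fun x => KMod.ap (a ≫ p i) x) x m).trans ?_
      rw [KMod.ap_comp, h, map_zero]

end DirectSums

/-! ### Multiplicities in basic modules and finite direct sums -/

section Multiplicity

variable {k : Type u} [Field k] {C : Type u} [Category.{u} C] [Preadditive C] [Linear k C]
  {M : KMod k C}

theorem not_isIso_zero {𝒟 : Type*} [Category 𝒟] [Preadditive 𝒟] {X Y : 𝒟}
    (hX : ¬ IsZero X) : ¬ IsIso (0 : X ⟶ Y) := fun _ =>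
  hX ((IsZero.iff_id_eq_zero X).2 (by rw [← IsIso.hom_inv_id (0 : X ⟶ Y), zero_comp]))

theorem exists_isIso_of_sum {𝒟 : Type*} [Category 𝒟] [Preadditive 𝒟] {X : 𝒟}
    [IsLocalRing (End X)] {ι : Type*} (s : Finset ι) (f : ι → (X ⟶ X))
    (h : IsIso (∑ i ∈ s, f i)) : ∃ i ∈ s, IsIso (f i) := by
  classical
  induction s using Finset.induction_on with
  | empty =>
    rw [Finset.sum_empty] at h
    exact absurd h (not_isIso_zero not_isZero_of_isLocalRing)
  | insert i s hi ih =>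
    rw [Finset.sum_insert hi] at h
    rcases isIso_or_isIso_of_add _ _ h with h | h
    · exact ⟨i, Finset.mem_insert_self _ _, h⟩
    · obtain ⟨j, hj, hj'⟩ := ih h
      exact ⟨j, Finset.mem_insert_of_mem hj, hj'⟩

/-- The square of an indecomposable module is not a direct summand of a basic module. -/
theorem IsBasic.multiplicity (h : IsBasic M) {X : KMod k C} (hX : IsInd X) (i₁ i₂ : X ⟶ M)
    (q₁ q₂ : M ⟶ X) (h₁₁ : i₁ ≫ q₁ = 𝟙 X) (h₂₂ : i₂ ≫ q₂ = 𝟙 X) (h₁₂ : i₁ ≫ q₂ = 0) : False := by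
  classical
  obtain ⟨I, N, incl, hsum, hind, hiso⟩ := h
  obtain ⟨p, hp₁, hp₂, hp₃, hp₄⟩ := hsum.exists_proj
  have hXl := hX.isLocalRing
  have hXz : ¬ IsZero X := hX.2.1
  have hloc := fun i => (hind i).isLocalRing
  have hisoX : ∀ {i} (a : X ⟶ N i) (b : N i ⟶ X), IsIso (a ≫ b) → IsIso a := fun {i} a b _ =>
    have := hloc i
    IsIso.of_local_comp a b hXz
  -- A split embedding of the finite dimensional module `X` involves finitely many summands, and
  -- locality selects one through which the splitting stays invertible.
  have hpair : ∀ (a : X ⟶ M) (b : M ⟶ X), a ≫ b = 𝟙 X → ∃ i, IsIso (a ≫ p i ≫ incl i ≫ b) := by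
    intro a b hab
    obtain ⟨s, hs⟩ := exists_finset_sum_of_proj p hp₁ hp₂ hp₃ hp₄ hX.1 a
    obtain ⟨i, -, hi⟩ := exists_isIso_of_sum s (fun i => a ≫ p i ≫ incl i ≫ b) (by
      have : ∑ i ∈ s, a ≫ p i ≫ incl i ≫ b = 𝟙 X := by
        rw [← hab]
        conv_rhs => rw [hs, Preadditive.sum_comp]
        simp only [Category.assoc]
      rw [this]
      infer_instance)
    exact ⟨i, hi⟩
  have hcomp : ∀ (a : X ⟶ M) (b : M ⟶ X) i, IsIso (a ≫ p i ≫ incl i ≫ b) → IsIso (a ≫ p i) :=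
    fun a b i h => hisoX (a ≫ p i) (incl i ≫ b) (by simpa using h)
  obtain ⟨j₁, hj₁⟩ := hpair i₁ q₁ h₁₁
  obtain ⟨j₂, hj₂⟩ := hpair i₂ q₂ h₂₂
  have e₁ := hcomp _ _ _ hj₁
  have e₂ := hcomp _ _ _ hj₂
  -- Both indices carry a copy of `X`, so they agree because the summands are pairwise
  -- non-isomorphic.
  have hj : j₁ = j₂ := hiso _ _ ⟨(asIso (i₁ ≫ p j₁)).symm ≪≫ asIso (i₂ ≫ p j₂)⟩
  subst hj
  have e₃ : IsIso (incl j₁ ≫ q₂) := by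
    have : IsIso ((i₂ ≫ p j₁) ≫ incl j₁ ≫ q₂) := by simpa using hj₂
    exact IsIso.of_isIso_comp_left (i₂ ≫ p j₁) (incl j₁ ≫ q₂)
  have e₄ : IsIso (i₁ ≫ p j₁ ≫ incl j₁ ≫ q₂) := by
    rw [← Category.assoc]
    infer_instance
  obtain ⟨s, hs⟩ := exists_finset_sum_of_proj p hp₁ hp₂ hp₃ hp₄ hX.1 i₁
  have hsum₀ : ∑ i ∈ s, i₁ ≫ p i ≫ incl i ≫ q₂ = 0 := by
    rw [← h₁₂]
    conv_rhs => rw [hs, Preadditive.sum_comp]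
    simp only [Category.assoc]
  -- The whole sum is zero and its term at `j₁` is invertible, so the remaining terms have an
  -- invertible sum. One of them gives another index carrying `X`.
  have hrest : IsIso (∑ i ∈ s.erase j₁, i₁ ≫ p i ≫ incl i ≫ q₂) := by
    by_cases hjs : j₁ ∈ s
    · rw [← Finset.add_sum_erase s _ hjs, add_comm, add_eq_zero_iff_eq_neg] at hsum₀
      rw [hsum₀]
      exact isIso_neg _
    · exfalso
      have hz : i₁ ≫ p j₁ = 0 := by
        conv_lhs => rw [hs, Preadditive.sum_comp]
        refine Finset.sum_eq_zero fun i hi => ?_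
        rw [Category.assoc, Category.assoc, hp₂ i j₁ (fun h => hjs (h ▸ hi)), comp_zero, comp_zero]
      rw [hz] at e₁
      exact not_isIso_zero hXz e₁
  obtain ⟨l, hl, hl'⟩ := exists_isIso_of_sum _ _ hrest
  have e₅ := hcomp _ _ _ hl'
  have : l = j₁ := hiso _ _ ⟨(asIso (i₁ ≫ p l)).symm ≪≫ asIso (i₁ ≫ p j₁)⟩
  exact (Finset.mem_erase.1 hl).1 this

/-- Direct sums over finite types. -/
theorem IsDirectSum.exists_proj_finite {I : Type w} [Finite I] {N : I → KMod k C}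
    {incl : ∀ i, N i ⟶ M} (h : IsDirectSum N M incl) :
    ∃ p : ∀ i, M ⟶ N i, (∀ i, incl i ≫ p i = 𝟙 _) ∧ (∀ i j, i ≠ j → incl i ≫ p j = 0) ∧
      𝟙 M ∈ AddSubgroup.closure (Set.range fun i => p i ≫ incl i) := by
  classical
  have := Fintype.ofFinite I
  obtain ⟨c⟩ := h
  let p : ∀ i, M ⟶ N i := fun i => c.desc (Cofan.mk (N i) fun j =>
    if h : j = i then eqToHom (congrArg N h) else 0)
  have hp : ∀ i j, incl i ≫ p j = if h : i = j then eqToHom (congrArg N h) else 0 := fun i j =>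
    c.fac _ ⟨i⟩
  have hp₁ : ∀ i, incl i ≫ p i = 𝟙 _ := fun i => by rw [hp, dif_pos rfl, eqToHom_refl]
  have hp₂ : ∀ i j, i ≠ j → incl i ≫ p j = 0 := fun i j h => by rw [hp, dif_neg h]
  refine ⟨p, hp₁, hp₂, ?_⟩
  have : 𝟙 M = ∑ i, p i ≫ incl i := by
    refine c.hom_ext fun ⟨j⟩ => ?_
    change incl j ≫ 𝟙 M = incl j ≫ ∑ i, p i ≫ incl i
    rw [Preadditive.comp_sum, Finset.sum_eq_single j, ← Category.assoc, hp₁, Category.comp_id,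
      Category.id_comp]
    · intro i _ hij
      rw [← Category.assoc, hp₂ j i (Ne.symm hij), zero_comp]
    · simp
  rw [this]
  exact sum_mem fun i _ => AddSubgroup.subset_closure ⟨i, rfl⟩

theorem isSummand_of_retract {N : KMod k C} (r : Retract N M) : IsSummand N M := by
  obtain ⟨K, i, q, hiq, hqi⟩ :=
    IsIdempotentComplete.idempotents_split _ (𝟙 M - r.r ≫ r.i) (by simp)
  have : Mono i := mono_of_mono_fac hiq
  have h₁ : r.i ≫ q = 0 := by
    rw [← cancel_mono i, Category.assoc, hqi]
    simp
  have h₂ : i ≫ r.r = 0 := by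
    have : i = i ≫ (𝟙 M - r.r ≫ r.i) := by rw [← hqi, reassoc_of% hiq]
    rw [this]
    simp
  exact ⟨K, ⟨
    { hom := biprod.lift r.r q
      inv := biprod.desc r.i i
      hom_inv_id := by rw [biprod.lift_desc, hqi]; simp
      inv_hom_id := biprod.hom_ext' _ _ (biprod.hom_ext _ _ (by simp) (by simp [h₁]))
        (biprod.hom_ext _ _ (by simp [h₂]) (by simp [hiq])) }⟩⟩

theorem IsSummand.retract {N : KMod k C} (h : IsSummand N M) : Nonempty (Retract N M) := by
  obtain ⟨K, ⟨e⟩⟩ := h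
  exact ⟨⟨biprod.inl ≫ e.inv, e.hom ≫ biprod.fst, by simp⟩⟩

theorem IsAdd.id_mem {T X : KMod k C} (h : IsAdd T X) :
    𝟙 X ∈ factorIdeal (fun Y => Y = T) X X := by
  obtain ⟨n, N, incl, hsum, hN⟩ := h
  obtain ⟨p, -, -, hp⟩ := hsum.exists_proj_finite
  refine (AddSubgroup.closure_le (factorIdeal (fun Y => Y = T) X X)).2 (fun φ hφ => ?_) hp
  obtain ⟨i, rfl⟩ := hφ
  obtain ⟨r⟩ := (hN i).retract
  have : p i ≫ incl i = (p i ≫ r.i) ≫ r.r ≫ incl i := by simp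
  dsimp only
  rw [this]
  exact comp_mem_factorIdeal (Q := fun Y => Y = T) rfl _ _

end Multiplicity

/-! ### Modules of the first kind with basic pull-up -/

section FirstKind

variable {k : Type u} [Field k]
  {C : Type u} [Category.{u} C] [Preadditive C] [Linear k C]
  {A : Type u} [Category.{u} A] [Preadditive A] [Linear k A]
  {G : Type u} [Group G] {ρ : KAction k C G} {F : C ⥤ A} [F.Additive] [F.Linear k]
  (hF : IsGaloisCovering ρ F) {M N : KMod k C} {T T' : KMod k A}

/-- The inclusion of `N` into `F.F_λ N`. -/
def toPullPush (N : KMod k C) : N ⟶ (pullUp F).obj ((pushDown hF).obj N) :=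
  KMod.ofAp (N := (pullUp F).obj ((pushDown hF).obj N)) (fun x => pinc hF N ⟨x, rfl⟩)
    fun {x y} f m => by
      have h := map_pinc hF (N := N) ⟨x, rfl⟩ ⟨y, rfl⟩ f m
      have e : eqToHom (rfl : F.obj x = F.obj x) ≫ F.map f ≫ eqToHom (rfl : F.obj y = F.obj y) =
        F.map f := by simp
      erw [e] at h
      exact h.symm

/-- The projection of `F.F_λ N` onto `N`. -/
def ofPullPush (N : KMod k C) : (pullUp F).obj ((pushDown hF).obj N) ⟶ N :=
  KMod.ofAp (M := (pullUp F).obj ((pushDown hF).obj N)) (fun x => pcomp hF N ⟨x, rfl⟩)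
    fun f m => pcomp_map hF f m

/-- The embedding of `ᵍN` into `F.F_λ N`. -/
def twistIncl (g : G) (N : KMod k C) :
    (twist ρ g).obj N ⟶ (pullUp F).obj ((pushDown hF).obj N) :=
  toPullPush hF _ ≫ (pullUp F).map (pushDownTwist hF g N).hom

/-- The projection of `F.F_λ N` onto `ᵍN`. -/
def twistProj (g : G) (N : KMod k C) :
    (pullUp F).obj ((pushDown hF).obj N) ⟶ (twist ρ g).obj N :=
  (pullUp F).map (pushDownTwist hF g N).inv ≫ ofPullPush hF _

theorem ap_twistProj (g : G) (N : KMod k C) (x : C)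
    (z : ((pushDown hF).obj N).obj.obj (F.obj x)) :
    KMod.ap (twistProj hF g N) x z = pcomp hF N ((fibEquiv hF g _).symm ⟨x, rfl⟩) z :=
  pcomp_twistIso_inv hF g N ⟨x, rfl⟩ z

/-- Orthogonality of the summands `ᵍN` of `F.F_λ N` thus becomes a statement about degrees. -/
theorem twistIncl_proj_eq (g h : G) (N : KMod k C) :
    twistIncl hF g N ≫ twistProj hF h N =
      degreeOne hF ((pushDownTwist hF g N).hom ≫ (pushDownTwist hF h N).inv) := rfl

theorem twistIncl_proj (g : G) (N : KMod k C) :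
    twistIncl hF g N ≫ twistProj hF g N = 𝟙 _ := by
  rw [twistIncl_proj_eq, Iso.hom_inv_id, degreeOne_id]

/-- The composition sends the summand at `x` of `F_λ ᵍN` to that at `h g⁻¹ x` of `F_λ ʰN`, which
differs from `x` by freeness. -/
theorem degreeOne_twist_ne {g h : G} (hgh : g ≠ h) (N : KMod k C) :
    degreeOne hF ((pushDownTwist hF g N).hom ≫ (pushDownTwist hF h N).inv) = 0 := by
  refine KMod.hom_ext fun x m => ?_
  rw [ap_degreeOne, KMod.ap_comp]
  refine (pcomp_twistIso_inv hF h N ⟨x, rfl⟩ _).trans ?_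
  refine (congrArg (pcomp hF N _) (twistIso_hom_pinc hF g N ⟨x, rfl⟩ m)).trans ?_
  refine pcomp_pinc_ne hF (fun e => hgh ?_) _
  have e' : (ρ.act g⁻¹).obj x = (ρ.act h⁻¹).obj x := congrArg Subtype.val e
  exact inv_injective (hF.act_injective e')

theorem twistIncl_proj_ne {g h : G} (hgh : g ≠ h) (N : KMod k C) :
    twistIncl hF g N ≫ twistProj hF h N = 0 :=
  degreeOne_twist_ne hF hgh N

theorem finite_twistProj_ne_zero (N : KMod k C) (x : C)
    (z : ((pushDown hF).obj N).obj.obj (F.obj x)) :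
    {g | KMod.ap (twistProj hF g N) x z ≠ 0}.Finite := by
  refine Set.Finite.of_injOn (f := fun g => (fibEquiv hF g (F.obj x)).symm ⟨x, rfl⟩)
    (fun g hg => ?_) (fun g _ h _ e => ?_) (finite_pcomp_ne_zero hF z)
  · have hg' : ¬ _ := hg
    rw [ap_twistProj] at hg'
    exact hg'
  · have e' : (ρ.act g⁻¹).obj x = (ρ.act h⁻¹).obj x := congrArg Subtype.val e
    exact inv_injective (hF.act_injective e')

/-- By transitivity, the projections to all the twists see every point of the fibre. -/
theorem eq_zero_of_twistProj (N : KMod k C) (x : C)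
    (z : ((pushDown hF).obj N).obj.obj (F.obj x))
    (h : ∀ g, KMod.ap (twistProj hF g N) x z = 0) : z = 0 := by
  refine push_ext hF fun y => ?_
  obtain ⟨g, rfl⟩ := fib_exists hF x y
  have h' := h g⁻¹
  rw [ap_twistProj] at h'
  have e : (fibEquiv hF g⁻¹ (F.obj x)).symm ⟨x, rfl⟩ = ⟨(ρ.act g).obj x, hF.obj_act g x⟩ :=
    Subtype.ext (congrArg (fun g => (ρ.act g).obj x) (inv_inv g))
  rw [← e, map_zero]
  exact h'

/-- The local retracts of `T` are push-downs of finite dimensional modules. -/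
def HasPreimages (T : KMod k A) : Prop :=
  ∀ Y, IsLocalRing (End Y) → Nonempty (Retract Y T) →
    ∃ Z, IsFinDim Z ∧ Nonempty ((pushDown hF).obj Z ≅ Y)

/-- The modules with push-down a local retract of `T` have trivial stabilizers. -/
def TwistFree (T : KMod k A) : Prop :=
  ∀ Z, IsFinDim Z → IsLocalRing (End ((pushDown hF).obj Z)) →
    Nonempty (Retract ((pushDown hF).obj Z) T) →
      ∀ g h, Nonempty ((twist ρ g).obj Z ≅ (twist ρ h).obj Z) → g = h

/-- For finite dimensional modules, indecomposable summands and local retracts are the same, and a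
preimage is automatically finite dimensional by `isFinDim_pushDown_iff`. -/
theorem isFirstKind_iff (hT : IsFinDim T) : IsFirstKind hF T ↔ HasPreimages hF T := by
  constructor
  · intro h Y hY r
    obtain ⟨r⟩ := r
    obtain ⟨Z, ⟨e⟩⟩ := h Y indecomposable_of_isLocalRing (isSummand_of_retract r)
    exact ⟨Z, (isFinDim_pushDown_iff hF).1 ((hT.of_retract r).of_iso e), ⟨e.symm⟩⟩
  · intro h N hN hs
    obtain ⟨r⟩ := hs.retract
    obtain ⟨Z, -, ⟨e⟩⟩ := h N (IsInd.isLocalRing ⟨hT.of_retract r, hN⟩) ⟨r⟩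
    exact ⟨Z, ⟨e.symm⟩⟩

theorem isLocalRing_end_twist {Z : KMod k C} [IsLocalRing (End ((pushDown hF).obj Z))] (g : G) :
    IsLocalRing (End ((twist ρ g).obj Z)) := by
  have : IsLocalRing (End ((pushDown hF).obj ((twist ρ g).obj Z))) :=
    isLocalRing_end_of_iso (pushDownTwist hF g Z)
  exact (pushOrbit hF).isLocalRing_of_map _

/-- For `g ≠ h'` the modules `ᵍZ` and `ʰ'Z` are independent summands of `F.F_λ Z`, hence of `F.T`.
If they were isomorphic, a square of an indecomposable would be a summand, against
`IsBasic.multiplicity`. -/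
theorem twistFree_of_isBasic (h : IsBasic ((pullUp F).obj T)) : TwistFree hF T := by
  rintro Z hZ hl ⟨r⟩ g h' ⟨φ⟩
  by_contra hne
  have := isLocalRing_end_twist hF (Z := Z) g
  have hr : (pullUp F).map r.i ≫ (pullUp F).map r.r = 𝟙 _ := by
    rw [← CategoryTheory.Functor.map_comp, r.retract, CategoryTheory.Functor.map_id]
  refine h.multiplicity (isInd_of_isLocalRing (hZ.twist g))
    (twistIncl hF g Z ≫ (pullUp F).map r.i) (φ.hom ≫ twistIncl hF h' Z ≫ (pullUp F).map r.i)
    ((pullUp F).map r.r ≫ twistProj hF g Z) ((pullUp F).map r.r ≫ twistProj hF h' Z ≫ φ.inv)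
    ?_ ?_ ?_
  · rw [Category.assoc, reassoc_of% hr, twistIncl_proj]
  · rw [Category.assoc, Category.assoc, reassoc_of% hr, ← Category.assoc (twistIncl hF h' Z),
      twistIncl_proj, Category.id_comp, φ.hom_inv_id]
  · rw [Category.assoc, reassoc_of% hr, ← Category.assoc (twistIncl hF g Z),
      twistIncl_proj_ne hF hne, zero_comp]

/-- If `T` is the direct sum of modules `F_λ Z_i`, then `F.T` is the direct sum of the `ᵍZ_i`; the
proof checks the projection criterion and separates the summands. -/
theorem isBasic_pullUp (hT : IsBasic T) (h₁ : HasPreimages hF T) (h₂ : TwistFree hF T) :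
    IsBasic ((pullUp F).obj T) := by
  obtain ⟨I, N, incl, hsum, hind, hiso⟩ := hT
  obtain ⟨p, hp₁, hp₂, hp₃, hp₄⟩ := hsum.exists_proj
  have hr : ∀ i, Nonempty (Retract (N i) T) := fun i => ⟨⟨incl i, p i, hp₁ i⟩⟩
  choose Z hZ e using fun i => h₁ (N i) (hind i).isLocalRing (hr i)
  have e := fun i => (e i).some
  have hl := fun i => (hind i).isLocalRing
  have hlZ : ∀ i, IsLocalRing (End ((pushDown hF).obj (Z i))) := fun i =>
    isLocalRing_end_of_iso (e i)
  have hrZ : ∀ i, Nonempty (Retract ((pushDown hF).obj (Z i)) T) := fun i =>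
    ⟨(Retract.ofIso (e i)).trans (hr i).some⟩
  refine ⟨I × G, fun q => (twist ρ q.2).obj (Z q.1),
    fun q => twistIncl hF q.2 (Z q.1) ≫ (pullUp F).map ((e q.1).hom ≫ incl q.1),
    isDirectSum_of_proj (fun q => (pullUp F).map (p q.1 ≫ (e q.1).inv) ≫ twistProj hF q.2 (Z q.1))
      ?_ ?_ ?_ ?_, ?_, ?_⟩
  · intro q
    have : ((e q.1).hom ≫ incl q.1) ≫ p q.1 ≫ (e q.1).inv = 𝟙 _ := by
      rw [Category.assoc, reassoc_of% hp₁ q.1, Iso.hom_inv_id]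
    rw [Category.assoc, ← CategoryTheory.Functor.map_comp_assoc, this,
      CategoryTheory.Functor.map_id, Category.id_comp, twistIncl_proj]
  · rintro ⟨i, g⟩ ⟨j, h⟩ hne
    rw [Category.assoc, ← CategoryTheory.Functor.map_comp_assoc]
    dsimp only
    by_cases hij : i = j
    · subst hij
      have : ((e i).hom ≫ incl i) ≫ p i ≫ (e i).inv = 𝟙 _ := by
        rw [Category.assoc, reassoc_of% hp₁ i, Iso.hom_inv_id]
      rw [this, CategoryTheory.Functor.map_id, Category.id_comp,
        twistIncl_proj_ne hF fun h => hne (by rw [h])]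
    · have : ((e i).hom ≫ incl i) ≫ p j ≫ (e j).inv = 0 := by
        rw [Category.assoc, ← Category.assoc (incl i), hp₂ i j hij, zero_comp, comp_zero]
      rw [this, Functor.map_zero, zero_comp, comp_zero]
  · intro x m
    refine ((hp₃ (F.obj x) m).biUnion fun i _ => ((finite_twistProj_ne_zero hF (Z i) x
      (KMod.ap (p i ≫ (e i).inv) (F.obj x) m)).image fun g => (i, g))).subset ?_
    rintro ⟨i, g⟩ hq
    refine Set.mem_biUnion (x := i) (fun h => hq ?_) ⟨g, hq, rfl⟩
    have h' : KMod.ap (p i ≫ (e i).inv) (F.obj x) m = 0 :=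
      (congrArg (KMod.ap (e i).inv (F.obj x)) h).trans (map_zero _)
    exact (congrArg (KMod.ap (twistProj hF g (Z i)) x) h').trans (map_zero _)
  · intro x m hm
    refine hp₄ (F.obj x) m fun i => ?_
    have h' : KMod.ap (e i).inv (F.obj x) (KMod.ap (p i) (F.obj x) m) = 0 :=
      eq_zero_of_twistProj hF (Z i) x _ fun g => hm (i, g)
    exact (KMod.ap_hom_inv (e i) (F.obj x) _).symm.trans
      ((congrArg (KMod.ap (e i).hom (F.obj x)) h').trans (map_zero _))
  · intro q
    have := isLocalRing_end_twist hF (Z := Z q.1) q.2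
    exact isInd_of_isLocalRing ((hZ q.1).twist q.2)
  · rintro ⟨i, g⟩ ⟨j, h⟩ ⟨φ⟩
    -- Push-down forgets the twist, so `i = j` since `T` is basic; equality of the group elements is
    -- then the triviality of stabilizers.
    have hij : i = j := hiso _ _ ⟨(e i).symm ≪≫ (pushDownTwist hF g (Z i)).symm ≪≫
      (pushDown hF).mapIso φ ≪≫ pushDownTwist hF h (Z j) ≪≫ e j⟩
    subst hij
    rw [h₂ (Z i) (hZ i) (hlZ i) (hrZ i) g h ⟨φ⟩]

theorem isBasic_pullUp_iff (hT : IsBasic T) (h₁ : HasPreimages hF T) :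
    IsBasic ((pullUp F).obj T) ↔ TwistFree hF T :=
  ⟨twistFree_of_isBasic hF, isBasic_pullUp hF hT h₁⟩

theorem HasPreimages.of_iso (e : T ≅ T') (h : HasPreimages hF T) : HasPreimages hF T' :=
  fun Y hY r => h Y hY (r.map fun r => r.trans (Retract.ofIso e.symm))

theorem TwistFree.of_iso (e : T ≅ T') (h : TwistFree hF T) : TwistFree hF T' :=
  fun Z hZ hl r => h Z hZ hl (r.map fun r => r.trans (Retract.ofIso e.symm))

end FirstKind

/-! ### Extensions -/

section Extensions

variable {𝒟 : Type u₁} [Category.{v} 𝒟] [Abelian 𝒟] [HasExt.{w} 𝒟] {X Y V T : 𝒟}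

theorem subsingleton_ext_of_retract (r : Retract X T) (s : Retract Y V) (n : ℕ)
    (h : Subsingleton (Abelian.Ext.{w} T V n)) : Subsingleton (Abelian.Ext.{w} X Y n) := by
  refine subsingleton_of_forall_eq 0 fun α => ?_
  have e : α = (Abelian.Ext.mk₀ r.i).comp (((Abelian.Ext.mk₀ r.r).comp
      (α.comp (Abelian.Ext.mk₀ s.i) (add_zero n)) (zero_add n)).comp
        (Abelian.Ext.mk₀ s.r) (add_zero n)) (zero_add n) := by
    simp
  rw [e, Subsingleton.elim ((Abelian.Ext.mk₀ r.r).comp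
      (α.comp (Abelian.Ext.mk₀ s.i) (add_zero n)) (zero_add n)) 0]
  simp

theorem exists_extension_of_ext {S : ShortComplex 𝒟} (hS : S.ShortExact)
    (h : Subsingleton (Abelian.Ext.{w} S.X₃ V 1)) (a : S.X₁ ⟶ V) : ∃ l : S.X₂ ⟶ V, S.f ≫ l = a := by
  obtain ⟨β, hβ⟩ := Abelian.Ext.contravariant_sequence_exact₁ hS V (Abelian.Ext.mk₀ a)
    (add_zero 1) (Subsingleton.elim _ _)
  obtain ⟨l, rfl⟩ := (Abelian.Ext.mk₀_bijective S.X₂ V).2 β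
  exact ⟨l, (Abelian.Ext.mk₀_bijective S.X₁ V).1 (by rw [← hβ, Abelian.Ext.mk₀_comp_mk₀])⟩

theorem exists_lifting_of_ext {S : ShortComplex 𝒟} (hS : S.ShortExact)
    (h : Subsingleton (Abelian.Ext.{w} V S.X₁ 1)) (a : V ⟶ S.X₃) : ∃ l : V ⟶ S.X₂, l ≫ S.g = a := by
  obtain ⟨β, hβ⟩ := Abelian.Ext.covariant_sequence_exact₃ V hS (Abelian.Ext.mk₀ a)
    (zero_add 1) (Subsingleton.elim _ _)
  obtain ⟨l, rfl⟩ := (Abelian.Ext.mk₀_bijective V S.X₂).2 β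
  exact ⟨l, (Abelian.Ext.mk₀_bijective V S.X₃).1 (by rw [← hβ, Abelian.Ext.mk₀_comp_mk₀])⟩

end Extensions

/-! ### Arrows of the quiver of tilting modules -/

section Arrows

variable {k : Type u} [Field k]
  {C : Type u} [Category.{u} C] [Preadditive C] [Linear k C]
  {A : Type u} [Category.{u} A] [Preadditive A] [Linear k A]
  {G : Type u} [Group G] {ρ : KAction k C G} {F : C ⥤ A} [F.Additive] [F.Linear k]
  (hF : IsGaloisCovering ρ F) {T T' : KMod k A}

/-- A local retract of `X ⊞ R`, with `X` local, is a retract of `R` or isomorphic to `X`. -/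
theorem retract_or_iso_of_biprod {𝒟 : Type*} [Category 𝒟] [Abelian 𝒟] {V X R T : 𝒟}
    (e : T ≅ X ⊞ R) (hX : IsLocalRing (End X)) [IsLocalRing (End V)] (r : Retract V T) :
    Nonempty (Retract V R) ∨ Nonempty (V ≅ X) := by
  have hX' : 𝟙 (X ⊞ R) ∈ factorIdeal (fun Y => Y = X ∨ Y = R) (X ⊞ R) (X ⊞ R) :=
    id_mem_factorIdeal_biprod (id_mem_factorIdeal (Or.inl rfl)) (id_mem_factorIdeal (Or.inr rfl))
  obtain ⟨_, rfl | rfl, ⟨s⟩⟩ := exists_retract_of_id_mem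
    (id_mem_factorIdeal_of_retract (r.trans (Retract.ofIso e)) hX')
  · exact Or.inr (iso_of_retract s not_isZero_of_isLocalRing)
  · exact Or.inl ⟨s⟩

theorem HasPreimages.of_retract (r : Retract T T') (h : HasPreimages hF T') : HasPreimages hF T :=
  fun Y hY s => h Y hY (s.map fun s => s.trans r)

/-- The modules whose push-downs are local retracts of `R`. -/
def preimageProp (R : KMod k A) : ObjectProperty (KMod k C) := fun Z =>
  IsFinDim Z ∧ IsLocalRing (End ((pushDown hF).obj Z)) ∧
    Nonempty (Retract ((pushDown hF).obj Z) R)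

theorem HasPreimages.id_mem {R X : KMod k A} (h : HasPreimages hF R) (hR : IsFinDim R)
    (hX : IsAdd R X) : 𝟙 X ∈ factorIdeal (imageProp (pushDown hF) (preimageProp hF R)) X X := by
  refine factorIdeal_le ?_ hX.id_mem
  rintro _ rfl
  refine factorIdeal_le ?_ hR.isDecomposable.id_mem
  rintro L ⟨hL, ⟨r⟩⟩
  obtain ⟨Z, hZ, ⟨e⟩⟩ := h L hL ⟨r⟩
  have := comp_mem_factorIdeal (Q := imageProp (pushDown hF) (preimageProp hF _))
    ⟨Z, ⟨hZ, isLocalRing_end_of_iso e, ⟨(Retract.ofIso e).trans r⟩⟩, rfl⟩ e.inv e.hom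
  rwa [e.inv_hom_id] at this

/-- The exchange sequence of an arrow. -/
theorem HasArrow.exists_isExchange (h : HasArrow T T')
    (h' : HasPreimages hF T ∨ HasPreimages hF T') :
    ∃ (R : KMod k A) (S : ShortComplex (KMod k A)), HasPreimages hF R ∧
      IsExchange (pushOrbit hF) (preimageProp hF R) S ∧
      Nonempty (Retract R T) ∧ Nonempty (Retract R T') ∧
      Nonempty (Retract S.X₁ T) ∧ Nonempty (Retract S.X₃ T') ∧
      (∀ V, IsLocalRing (End V) → Nonempty (Retract V T) →
        Nonempty (Retract V R) ∨ Nonempty (V ≅ S.X₁)) ∧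
      ∀ V, IsLocalRing (End V) → Nonempty (Retract V T') →
        Nonempty (Retract V R) ∨ Nonempty (V ≅ S.X₃) := by
  obtain ⟨⟨hT, -⟩, ⟨hT', -⟩, X, Y, R, hX, hY, ⟨e⟩, ⟨e'⟩, S, hS, hns, ⟨eX⟩, ⟨eY⟩, hadd⟩ := h
  have rR : Retract R T := ⟨biprod.inr ≫ e.inv, e.hom ≫ biprod.snd, by simp⟩
  have rR' : Retract R T' := ⟨biprod.inr ≫ e'.inv, e'.hom ≫ biprod.snd, by simp⟩
  have rX : Retract S.X₁ T := ⟨eX.hom ≫ biprod.inl ≫ e.inv, e.hom ≫ biprod.fst ≫ eX.inv, by simp⟩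
  have rY : Retract S.X₃ T' :=
    ⟨eY.hom ≫ biprod.inl ≫ e'.inv, e'.hom ≫ biprod.fst ≫ eY.inv, by simp⟩
  have hR : HasPreimages hF R := h'.elim (fun h => h.of_retract hF rR) fun h => h.of_retract hF rR'
  have hlX := hX.isLocalRing
  have hlY := hY.isLocalRing
  refine ⟨R, S, hR, ?_, ⟨rR⟩, ⟨rR'⟩, ⟨rX⟩, ⟨rY⟩, fun V hV r => ?_, fun V hV r => ?_⟩
  · let := HasExt.standard (KMod k A)
    exact
    { fd := fun Z hZ => hZ.1
      twist := fun g Z hZ => ⟨hZ.1.twist g,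
        have := hZ.2.1
        isLocalRing_end_of_iso (pushDownTwist hF g Z),
        hZ.2.2.map fun r => (Retract.ofIso (pushDownTwist hF g Z)).trans r⟩
      local_obj := fun Z hZ => hZ.2.1
      exact := hS
      nonsplit := hns
      mem := hR.id_mem hF (hT.finDim.of_retract rR) hadd
      -- `R` and the right term are summands of `T'`, so maps to `R` extend; in the next field, `R`
      -- and the left term are summands of `T`, so maps from `R` lift.
      left := fun Z hZ a => exists_extension_of_ext hS (subsingleton_ext_of_retract rY
        (hZ.2.2.some.trans rR') 1 (hT'.selfOrthogonal 1 one_pos)) a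
      right := fun Z hZ a => exists_lifting_of_ext hS (subsingleton_ext_of_retract
        (hZ.2.2.some.trans rR) rX 1 (hT.selfOrthogonal 1 one_pos)) a
      local_left := isLocalRing_end_of_iso eX
      local_right := isLocalRing_end_of_iso eY }
  · obtain ⟨r⟩ := r
    exact (retract_or_iso_of_biprod e hlX r).imp_right fun h => h.map fun i => i ≪≫ eX.symm
  · obtain ⟨r⟩ := r
    exact (retract_or_iso_of_biprod e' hlY r).imp_right fun h => h.map fun i => i ≪≫ eY.symm

/-- The two tilting modules share the summands of `R`, so only the exchanged summand needs a
preimage, which comes from lifting the exchange sequence. -/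
theorem HasArrow.hasPreimages_iff (h : HasArrow T T') :
    HasPreimages hF T ↔ HasPreimages hF T' := by
  constructor
  · intro hT V hV hr
    obtain ⟨R, S, hR, hS, -, -, rX, -, -, hV'⟩ := h.exists_isExchange hF (Or.inl hT)
    obtain ⟨X, hX, ⟨e⟩⟩ := hT S.X₁ hS.local_left rX
    obtain ⟨Z, hZ, ⟨κ⟩⟩ := hS.exists_iso_right hX e
    rcases hV' V hV hr with r | ⟨⟨i⟩⟩
    · exact hR V hV r
    · exact ⟨Z, hZ, ⟨κ ≪≫ i.symm⟩⟩
  · intro hT V hV hr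
    obtain ⟨R, S, hR, hS, -, -, -, rY, hV', -⟩ := h.exists_isExchange hF (Or.inr hT)
    obtain ⟨Z, hZ, ⟨κ⟩⟩ := hT S.X₃ hS.local_right rY
    obtain ⟨X, hX, ⟨e⟩⟩ := hS.exists_iso_left hZ κ
    rcases hV' V hV hr with r | ⟨⟨i⟩⟩
    · exact hR V hV r
    · exact ⟨X, hX, ⟨e ≪≫ i.symm⟩⟩

/-- Again only the exchanged summand matters. The Schanuel argument changes its preimage by a twist
`l`, which is harmless since the condition is imposed on all preimages. -/
theorem HasArrow.twistFree_iff (h : HasArrow T T') (hT : HasPreimages hF T) :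
    TwistFree hF T ↔ TwistFree hF T' := by
  have hT' := (h.hasPreimages_iff hF).1 hT
  obtain ⟨R, S, hR, hS, ⟨rR⟩, ⟨rR'⟩, ⟨rX⟩, ⟨rY⟩, hV, hV'⟩ := h.exists_isExchange hF (Or.inl hT)
  obtain ⟨X, hX, ⟨e⟩⟩ := hT S.X₁ hS.local_left ⟨rX⟩
  obtain ⟨Y, hY, ⟨κ⟩⟩ := hT' S.X₃ hS.local_right ⟨rY⟩
  have := hS.local_left
  have := hS.local_right
  constructor
  · rintro hfree Z hZ hl hr g g' ⟨φ⟩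
    rcases hV' _ hl hr with ⟨⟨r⟩⟩ | ⟨⟨i⟩⟩
    · exact hfree Z hZ hl ⟨r.trans rR⟩ g g' ⟨φ⟩
    · obtain ⟨l, hl'⟩ := hS.iso_left_of_iso_right hX e hZ i φ
      let i' : (pushDown hF).obj ((twist ρ l).obj X) ≅ S.X₁ := pushDownTwist hF l X ≪≫ e
      exact hfree _ (hX.twist l) (isLocalRing_end_of_iso i') ⟨(Retract.ofIso i').trans rX⟩ g g' hl'
  · rintro hfree Z hZ hl hr g g' ⟨φ⟩
    rcases hV _ hl hr with ⟨⟨r⟩⟩ | ⟨⟨i⟩⟩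
    · exact hfree Z hZ hl ⟨r.trans rR'⟩ g g' ⟨φ⟩
    · obtain ⟨l, hl'⟩ := hS.iso_right_of_iso_left hZ i hY κ φ
      let i' : (pushDown hF).obj ((twist ρ l).obj Y) ≅ S.X₃ := pushDownTwist hF l Y ≪≫ κ
      exact hfree _ (hY.twist l) (isLocalRing_end_of_iso i') ⟨(Retract.ofIso i').trans rY⟩ g g' hl'

theorem hasPreimages_twistFree_iff_of_eqvGen
    (h : Relation.EqvGen (fun S S' => Nonempty (S ≅ S') ∨ HasArrow S S') T T') :
    (HasPreimages hF T ↔ HasPreimages hF T') ∧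
      (HasPreimages hF T → (TwistFree hF T ↔ TwistFree hF T')) := by
  induction h with
  | rel T T' h =>
    rcases h with ⟨⟨e⟩⟩ | h
    · exact ⟨⟨.of_iso hF e, .of_iso hF e.symm⟩, fun _ => ⟨.of_iso hF e, .of_iso hF e.symm⟩⟩
    · exact ⟨h.hasPreimages_iff hF, h.twistFree_iff hF⟩
  | refl T => exact ⟨Iff.rfl, fun _ => Iff.rfl⟩
  | symm T T' _ ih => exact ⟨ih.1.symm, fun h => (ih.2 (ih.1.2 h)).symm⟩
  | trans T T' T'' _ _ ih ih' =>
    exact ⟨ih.1.trans ih'.1, fun h => (ih.2 h).trans (ih'.2 (ih.1.1 h))⟩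

end Arrows

/-! ### Indecomposable projective and injective modules -/

section Representable

variable {𝒟 ℰ : Type*} [Category 𝒟] [Category ℰ] [Preadditive 𝒟] [Preadditive ℰ]

theorem isLocalRing_end_of_fullyFaithful (Φ : 𝒟 ⥤ ℰ) [Φ.Full] [Φ.Faithful] [Φ.Additive] (X : 𝒟)
    [IsLocalRing (End X)] : IsLocalRing (End (Φ.obj X)) := by
  refine isLocalRing_end_of_forall (fun h => not_isZero_of_isLocalRing (X := X) ?_) fun a => ?_
  · rw [IsZero.iff_id_eq_zero] at h ⊢
    exact Φ.map_injective (by rw [Φ.map_id, Φ.map_zero, h])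
  · obtain ⟨b, rfl⟩ := Φ.map_surjective a
    refine (isIso_or_isIso_of_add_eq_id b (𝟙 X - b) (by simp)).imp
      (fun h => by have := h; exact Functor.map_isIso Φ b) fun h => ?_
    have h' : IsIso (𝟙 X - b) := h
    rw [← Φ.map_id, ← Φ.map_sub]
    exact Functor.map_isIso Φ _

end Representable

section ProjInj

variable (k : Type u) [Field k] {C : Type u} [Category.{u} C] [Preadditive C] [Linear k C]

/-- The module `Hom(x, -)`. -/
def projMod (x : C) : KMod k C where
  obj :=
    { obj := fun y => ModuleCat.of k (x ⟶ y)
      map := fun f => ModuleCat.ofHom (Linear.rightComp k x f)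
      map_id := fun y => by ext; simp
      map_comp := fun f g => by ext; simp }
  property := by
    refine ⟨⟨fun {X Y} a b => ?_⟩, ⟨fun {X Y} a r => ?_⟩⟩
    · ext; simp
    · ext; simp

/-- The module `D Hom(-, x)`. -/
def injMod (x : C) : KMod k C where
  obj :=
    { obj := fun y => ModuleCat.of k (Module.Dual k (y ⟶ x))
      map := fun f => ModuleCat.ofHom (Module.Dual.transpose (R := k) (Linear.leftComp k x f))
      map_id := fun y => by ext φ g; simp [Module.Dual.transpose]
      map_comp := fun f g => by ext φ h; simp [Module.Dual.transpose] }
  property := by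
    refine ⟨⟨fun {X Y} a b => ?_⟩, ⟨fun {X Y} a r => ?_⟩⟩
    · ext φ g; simp [Module.Dual.transpose]
    · ext φ g; simp [Module.Dual.transpose]

variable {k}

/-- The morphism `Hom(x, -) ⟶ M` defined by an element of `M(x)`. -/
def fromProj {M : KMod k C} (x : C) (m : M.obj.obj x) : projMod k x ⟶ M :=
  KMod.ofAp (M := projMod k x) (fun y => (M.mapL x y).flip m) fun u f =>
    KMod.map_comp_apply (M := M) f u m

theorem ap_fromProj {M : KMod k C} (x : C) (m : M.obj.obj x) {y : C} (f : x ⟶ y) :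
    KMod.ap (fromProj x m) y f = M.obj.map f m := rfl

theorem fromProj_ap {M : KMod k C} (x : C) (φ : projMod k x ⟶ M) :
    fromProj x (KMod.ap φ x (𝟙 x)) = φ :=
  KMod.hom_ext fun y (f : x ⟶ y) => by
    refine (ap_fromProj x _ f).trans ((KMod.ap_map φ f (𝟙 x)).symm.trans ?_)
    exact congrArg (KMod.ap φ y) (Category.id_comp f)

/-- The morphism `M ⟶ D Hom(-, x)` defined by a linear form on `M(x)`. -/
def toInj {M : KMod k C} (x : C) (l : Module.Dual k (M.obj.obj x)) : M ⟶ injMod k x :=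
  KMod.ofAp (N := injMod k x) (fun y => ((M.mapL y x).compr₂ l).flip) fun u m =>
    LinearMap.ext fun f => congrArg l (KMod.map_comp_apply (M := M) u f m).symm

variable (k C)

/-- The functor `x ↦ Hom(x, -)`. -/
def projFunctor : Cᵒᵖ ⥤ KMod k C where
  obj x := projMod k x.unop
  map {x y} c := fromProj (M := projMod k y.unop) x.unop c.unop
  map_id x := KMod.hom_ext fun y (f : x.unop ⟶ y) => Category.id_comp f
  map_comp {x y z} c d := KMod.hom_ext fun w (f : x.unop ⟶ w) => Category.assoc d.unop c.unop f

instance : (projFunctor k C).Additive where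
  map_add {x y c d} := KMod.hom_ext fun w (f : x.unop ⟶ w) => Preadditive.add_comp _ _ _ c.unop d.unop f

instance : (projFunctor k C).Faithful where
  map_injective {x y c d} h := Quiver.Hom.unop_inj (by
    have : c.unop ≫ 𝟙 _ = d.unop ≫ 𝟙 _ :=
      congrArg (fun φ : projMod k x.unop ⟶ projMod k y.unop => KMod.ap φ x.unop (𝟙 x.unop)) h
    simpa using this)

instance : (projFunctor k C).Full where
  map_surjective {x y} φ :=
    ⟨Quiver.Hom.op (KMod.ap (M := projMod k x.unop) (N := projMod k y.unop) φ x.unop (𝟙 x.unop) :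
      y.unop ⟶ x.unop), fromProj_ap x.unop φ⟩

/-- The functor `x ↦ D Hom(-, x)`. -/
def injFunctor : Cᵒᵖ ⥤ KMod k C where
  obj x := injMod k x.unop
  map {x y} c := toInj (M := injMod k x.unop) y.unop (Module.Dual.eval k _ c.unop)
  map_id x := KMod.hom_ext fun y (ξ : Module.Dual k (y ⟶ x.unop)) =>
    LinearMap.ext fun f => congrArg ξ (Category.comp_id f)
  map_comp {x y z} c d := KMod.hom_ext fun w (ξ : Module.Dual k (w ⟶ x.unop)) =>
    LinearMap.ext fun f => congrArg ξ (Category.assoc f d.unop c.unop).symm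

instance : (injFunctor k C).Additive where
  map_add {x y c d} := KMod.hom_ext fun w (ξ : Module.Dual k (w ⟶ x.unop)) =>
    LinearMap.ext fun f => (congrArg ξ (Preadditive.comp_add _ _ _ f c.unop d.unop)).trans
      (map_add ξ _ _)

instance : (injFunctor k C).Faithful where
  map_injective {x y c d} h := Quiver.Hom.unop_inj (by
    refine sub_eq_zero.1 ((Module.forall_dual_apply_eq_zero_iff k _).1 fun ξ => ?_)
    have h' : ξ (𝟙 _ ≫ c.unop) = ξ (𝟙 _ ≫ d.unop) :=
      congrArg (fun φ : injMod k x.unop ⟶ injMod k y.unop =>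
        (show Module.Dual k (y.unop ⟶ y.unop) from KMod.ap φ y.unop ξ) (𝟙 y.unop)) h
    rw [map_sub, sub_eq_zero]
    simpa using h')

/-- Finite dimensionality identifies `Hom(y, x)` with its bidual: evaluating the components of `φ`
at the identity of `y` is evaluation at some morphism `c`, and naturality shows that `c` induces
`φ`. -/
theorem injFunctor_full (h : ∀ x y : C, Module.Finite k (x ⟶ y)) : (injFunctor k C).Full where
  map_surjective {x y} φ := by
    have := h y.unop x.unop
    let φ' : injMod k x.unop ⟶ injMod k y.unop := φ
    obtain ⟨c, hc⟩ := (Module.evalEquiv k (y.unop ⟶ x.unop)).surjective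
      (Module.Dual.eval k (y.unop ⟶ y.unop) (𝟙 _) ∘ₗ KMod.ap φ' y.unop)
    refine ⟨c.op, KMod.hom_ext fun w (ξ : Module.Dual k (w ⟶ x.unop)) =>
      LinearMap.ext fun f : w ⟶ y.unop => ?_⟩
    let ξ' : (injMod k x.unop).obj.obj y.unop := (injMod k x.unop).obj.map f ξ
    have h₁ : (show Module.Dual k (y.unop ⟶ x.unop) from ξ') c =
        (show Module.Dual k (y.unop ⟶ y.unop) from KMod.ap φ' y.unop ξ') (𝟙 _) :=
      LinearMap.congr_fun hc ξ'
    have h₂ : KMod.ap φ' y.unop ξ' = (injMod k y.unop).obj.map f (KMod.ap φ' w ξ) :=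
      KMod.ap_map φ' f ξ
    refine h₁.trans ?_
    rw [h₂]
    exact congrArg (show Module.Dual k (w ⟶ y.unop) from KMod.ap φ' w ξ) (Category.comp_id f)

variable {k C}

theorem IsLocallyBounded.finite_hom (hC : IsLocallyBounded k C) (x y : C) :
    Module.Finite k (x ⟶ y) := by
  classical
  have := hC.finite_out x
  exact Module.Finite.of_surjective (DirectSum.component k C (fun y => (x ⟶ y)) y) fun f =>
    ⟨DirectSum.lof k C _ y f, DirectSum.component.lof_self k y f⟩

theorem isFinDim_projMod (hC : IsLocallyBounded k C) (x : C) : IsFinDim (projMod k x) :=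
  hC.finite_out x

/-- The direct sum of the duals embeds into the dual of the direct sum. -/
theorem isFinDim_injMod (hC : IsLocallyBounded k C) (x : C) : IsFinDim (injMod k x) := by
  classical
  have := hC.finite_in x
  have : Module.Finite k (Module.Dual k (⨁ y, (y ⟶ x))) := inferInstance
  refine Module.Finite.of_injective (M := ⨁ y, Module.Dual k (y ⟶ x))
    (DirectSum.toModule k C (Module.Dual k (⨁ y, (y ⟶ x))) fun y =>
      Module.Dual.transpose (DirectSum.component k C (fun y => (y ⟶ x)) y)) ?_
  intro z z' h
  have key : ∀ (z : ⨁ y, Module.Dual k (y ⟶ x)) y (f : y ⟶ x),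
      DirectSum.toModule k C (Module.Dual k (⨁ y, (y ⟶ x))) (fun y =>
        Module.Dual.transpose (R := k) (DirectSum.component k C (fun y => (y ⟶ x)) y)) z
          (DirectSum.lof k C (fun y => (y ⟶ x)) y f) = z y f := by
    intro z y f
    induction z using DirectSum.induction_on with
    | zero => simp
    | add z z' h h' => rw [map_add, LinearMap.add_apply, h, h']; rfl
    | of y' ξ =>
      have e := DirectSum.toModule_lof k (M := fun y => Module.Dual k (y ⟶ x))
        (φ := fun y => Module.Dual.transpose (R := k)
          (DirectSum.component k C (fun y => (y ⟶ x)) y)) y' ξ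
      refine (LinearMap.congr_fun e _).trans ?_
      change ξ (DirectSum.component k C (fun y => (y ⟶ x)) y'
        (DirectSum.lof k C (fun y => (y ⟶ x)) y f)) = _
      by_cases hy : y = y'
      · subst hy
        rw [DirectSum.component.lof_self]
        exact (LinearMap.congr_fun (DirectSum.of_eq_same (β := fun y => Module.Dual k (y ⟶ x))
          y ξ) f).symm
      · have e₁ : DirectSum.component k C (fun y => (y ⟶ x)) y'
            (DirectSum.lof k C (fun y => (y ⟶ x)) y f) = 0 :=
          DirectSum.of_eq_of_ne (β := fun y => (y ⟶ x)) _ _ _ (Ne.symm hy)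
        rw [e₁, map_zero]
        exact (LinearMap.congr_fun (DirectSum.of_eq_of_ne
          (β := fun y => Module.Dual k (y ⟶ x)) _ _ ξ hy) f).symm
  refine DFinsupp.ext fun y => LinearMap.ext fun f => ?_
  exact (key z y f).symm.trans ((LinearMap.congr_fun h _).trans (key z' y f))

theorem KMod.ap_sum {M N : KMod k C} {ι : Type*} (s : Finset ι) (φ : ι → (M ⟶ N)) (x : C)
    (m : M.obj.obj x) : KMod.ap (∑ i ∈ s, φ i) x m = ∑ i ∈ s, KMod.ap (φ i) x m := by
  classical
  induction s using Finset.induction_on with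
  | empty => rfl
  | insert i s hi ih => rw [Finset.sum_insert hi, Finset.sum_insert hi, KMod.ap_add, ih]

theorem regular_id_mem [Finite C] : 𝟙 (regular k C) ∈
    factorIdeal (fun Y => ∃ x, Y = (projFunctor k C).obj x) (regular k C) (regular k C) := by
  classical
  have := Fintype.ofFinite C
  let p : ∀ x, regular k C ⟶ projMod k x := fun x =>
    KMod.ofAp (M := regular k C) (N := projMod k x)
      (fun y => LinearMap.proj (R := k) (φ := fun x => (x ⟶ y)) x) fun _ _ => rfl
  let i : ∀ x, projMod k x ⟶ regular k C := fun x =>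
    fromProj (M := regular k C) x (Pi.single (M := fun x' => (x' ⟶ x)) x (𝟙 x))
  have : 𝟙 (regular k C) = ∑ x, p x ≫ i x := by
    refine KMod.hom_ext fun y (f : ∀ x, (x ⟶ y)) => ?_
    refine Eq.trans ?_ (KMod.ap_sum Finset.univ (fun x => p x ≫ i x) y f).symm
    refine funext fun x' => ?_
    refine Eq.trans ?_ (Finset.sum_apply (M := fun x => (x ⟶ y)) x' Finset.univ
      fun x => (fun x'' => Pi.single (M := fun x' => (x' ⟶ x)) x (𝟙 x) x'' ≫ f x)).symm
    rw [Finset.sum_eq_single x', Pi.single_eq_same, Category.id_comp]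
    · rfl
    · intro x _ hx
      rw [Pi.single_eq_of_ne (Ne.symm hx), zero_comp]
    · simp
  rw [this]
  exact sum_mem fun x _ => comp_mem_factorIdeal
    (Q := fun Y => ∃ x, Y = (projFunctor k C).obj x) ⟨Opposite.op x, rfl⟩ (p x) (i x)

theorem dualRegular_id_mem [Finite C] : 𝟙 (dualRegular k C) ∈
    factorIdeal (fun Y => ∃ x, Y = (injFunctor k C).obj x) (dualRegular k C) (dualRegular k C) := by
  classical
  have := Fintype.ofFinite C
  let p : ∀ x, dualRegular k C ⟶ injMod k x := fun x =>
    KMod.ofAp (M := dualRegular k C) (N := injMod k x)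
      (fun y => LinearMap.proj (R := k) (φ := fun x => Module.Dual k (y ⟶ x)) x) fun _ _ => rfl
  let i : ∀ x, injMod k x ⟶ dualRegular k C := fun x =>
    KMod.ofAp (M := injMod k x) (N := dualRegular k C)
      (fun y => LinearMap.single k (fun x => Module.Dual k (y ⟶ x)) x) fun {y z} u ξ => by
        refine funext fun x' => ?_
        let m : ∀ x, Module.Dual k (y ⟶ x) → Module.Dual k (z ⟶ x) := fun x =>
          Module.Dual.transpose (R := k) (Linear.leftComp k x u)
        exact (Pi.apply_single m (fun x => map_zero _) x ξ x').symm
  have : 𝟙 (dualRegular k C) = ∑ x, p x ≫ i x := by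
    refine KMod.hom_ext fun y (f : ∀ x, Module.Dual k (y ⟶ x)) => ?_
    refine Eq.trans ?_ (KMod.ap_sum Finset.univ (fun x => p x ≫ i x) y f).symm
    exact (Finset.univ_sum_single f).symm
  rw [this]
  exact sum_mem fun x _ => comp_mem_factorIdeal
    (Q := fun Y => ∃ x, Y = (injFunctor k C).obj x) ⟨Opposite.op x, rfl⟩ (p x) (i x)

end ProjInj

open Classical in
theorem inMap_lof {k : Type w} [Field k] {C : Type u₁} [Category.{v} C] [Preadditive C] [Linear k C]
    {A : Type u₂} [Category.{v} A] [Preadditive A] [Linear k A] (F : C ⥤ A) [F.Additive]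
    [F.Linear k] (a : A) (y : C) (x : Fib F a) (f : x.1 ⟶ y) :
    inMap k F a y (DirectSum.lof k (Fib F a) (fun x => (x.1 ⟶ y)) x f) =
      eqToHom x.2.symm ≫ F.map f := by
  unfold inMap
  exact DirectSum.toModule_lof k (M := fun x : Fib F a => (x.1 ⟶ y)) x f

/-! ### Push-downs and twists of projective and injective modules -/

section Push

variable {k : Type u} [Field k]
  {C : Type u} [Category.{u} C] [Preadditive C] [Linear k C]
  {A : Type u} [Category.{u} A] [Preadditive A] [Linear k A]
  {G : Type u} [Group G] {ρ : KAction k C G} {F : C ⥤ A} [F.Additive] [F.Linear k]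
  (hF : IsGaloisCovering ρ F)

/-- The Yoneda map of the element `𝟙 x` is inverse to `outMap`, bijective by the covering property.
-/
theorem nonempty_pushDown_projMod_iso (x : C) :
    Nonempty ((pushDown hF).obj (projMod k x) ≅ projMod k (F.obj x)) := by
  classical
  let φ : projMod k (F.obj x) ⟶ (pushDown hF).obj (projMod k x) :=
    fromProj (M := (pushDown hF).obj (projMod k x)) (F.obj x)
      (pinc hF (projMod k x) ⟨x, rfl⟩ (𝟙 x))
  have key : ∀ b (s : ⨁ y : Fib F b, (x ⟶ y.1)), KMod.ap φ b (outMap k F x b s) = s := by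
    intro b s
    have : KMod.ap φ b ∘ₗ outMap k F x b = LinearMap.id := by
      refine DirectSum.linearMap_ext _ fun y => LinearMap.ext fun f : x ⟶ y.1 => ?_
      have h₁ := map_pinc hF (N := projMod k x) ⟨x, rfl⟩ y f (𝟙 x)
      have h₂ : outMap k F x b (DirectSum.lof k (Fib F b) (fun y => (x ⟶ y.1)) y f) =
          eqToHom (rfl : F.obj x = F.obj x) ≫ F.map f ≫ eqToHom y.2 :=
        (outMap_lof k F x b y f).trans (by simp)
      refine (congrArg (KMod.ap φ b) h₂).trans (h₁.trans ?_)
      exact congrArg (pinc hF (projMod k x) y) (Category.id_comp f)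
    exact LinearMap.congr_fun this s
  have : IsIso φ := KMod.isIso_of_bijective φ fun b => by
    constructor
    · intro u u' h
      obtain ⟨s, rfl⟩ := (hF.bijective x b).2 u
      obtain ⟨s', rfl⟩ := (hF.bijective x b).2 u'
      exact congrArg (outMap k F x b) ((key b s).symm.trans (h.trans (key b s')))
    · exact fun s => ⟨outMap k F x b s, key b s⟩
  exact ⟨(asIso φ).symm⟩

/-- The map is given by the linear form that evaluates the component at `x` on `𝟙 x`. It is
determined on the images of morphisms `y ⟶ x`, and these span by the covering property. -/
theorem nonempty_pushDown_injMod_iso (hC : IsLocallyBounded k C) (x : C) :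
    Nonempty ((pushDown hF).obj (injMod k x) ≅ injMod k (F.obj x)) := by
  classical
  let l : Module.Dual k (((pushDown hF).obj (injMod k x)).obj.obj (F.obj x)) :=
    Module.Dual.eval k (x ⟶ x) (𝟙 x) ∘ₗ pcomp hF (injMod k x) ⟨x, rfl⟩
  let φ : (pushDown hF).obj (injMod k x) ⟶ injMod k (F.obj x) :=
    toInj (M := (pushDown hF).obj (injMod k x)) (F.obj x) l
  have key : ∀ b (z : ((pushDown hF).obj (injMod k x)).obj.obj b) (y : Fib F b) (f : y.1 ⟶ x),
      (show Module.Dual k (b ⟶ F.obj x) from KMod.ap φ b z) (eqToHom y.2.symm ≫ F.map f) =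
        (show Module.Dual k (y.1 ⟶ x) from pcomp hF (injMod k x) y z) f := by
    rintro _ z ⟨y, rfl⟩ f
    rw [eqToHom_refl, Category.id_comp]
    have h := pcomp_map hF (N := injMod k x) f z
    refine (congrArg (fun ξ : Module.Dual k (x ⟶ x) => ξ (𝟙 x)) h).trans ?_
    exact congrArg (show Module.Dual k (y ⟶ x) from pcomp hF (injMod k x) ⟨y, rfl⟩ z)
      (Category.comp_id f)
  have hbij : ∀ b, Function.Bijective (inMap k F b x) := fun b => by
    obtain ⟨y, rfl⟩ := hF.surjective b
    exact hF.covering.bijective_in y x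
  -- Surjectivity needs a finitely supported family of linear forms; local boundedness leaves only
  -- finitely many `y` with `Hom(y, x) ≠ 0`.
  have hfin : {y : C | ¬ Subsingleton (y ⟶ x)}.Finite := by
    have := hC.finite_in x
    have := finite_ne_zero_of_pointwise (k := k) (V := ⨁ y, (y ⟶ x))
      (fun y => DirectSum.component k C (fun y => (y ⟶ x)) y) fun v =>
        DFinsupp.finite_support (β := fun y => (y ⟶ x)) v
    refine this.subset fun y hy h => hy ⟨fun f g => ?_⟩
    have e : ∀ f : y ⟶ x, f = 0 := fun f => by
      rw [← DirectSum.component.lof_self k (M := fun y => (y ⟶ x)) y f, h, LinearMap.zero_apply]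
    rw [e f, e g]
  have : IsIso φ := KMod.isIso_of_bijective φ fun b => by
    constructor
    · intro z z' h
      refine push_ext hF fun y => LinearMap.ext fun f : y.1 ⟶ x => ?_
      exact (key b z y f).symm.trans ((congrArg (fun ξ : Module.Dual k (b ⟶ F.obj x) =>
        ξ (eqToHom y.2.symm ≫ F.map f)) h).trans (key b z' y f))
    · intro (η : Module.Dual k (b ⟶ F.obj x))
      have hfin' : {y : Fib F b | ¬ Subsingleton (y.1 ⟶ x)}.Finite :=
        hfin.preimage Subtype.val_injective.injOn
      let ξ : ∀ y : Fib F b, Module.Dual k (y.1 ⟶ x) := fun y =>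
        η ∘ₗ Linear.leftComp k (F.obj x) (eqToHom y.2.symm) ∘ₗ F.mapLinearMap k
      let z : ((pushDown hF).obj (injMod k x)).obj.obj b :=
        ∑ y ∈ hfin'.toFinset, pinc hF (injMod k x) y (ξ y)
      refine ⟨z, ?_⟩
      have hz : ∀ y, pcomp hF (injMod k x) y z = ξ y := by
        intro y
        rw [map_sum]
        by_cases hy : Subsingleton (y.1 ⟶ x)
        · exact LinearMap.ext fun f => by
            rw [Subsingleton.elim f 0, map_zero]
            exact map_zero _
        · rw [Finset.sum_eq_single y]
          · exact pcomp_pinc hF (N := injMod k x) y (ξ y)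
          · exact fun y' _ hne => pcomp_pinc_ne hF hne _
          · exact fun h => absurd (hfin'.mem_toFinset.2 hy) h
      have hη : ∀ s, (show Module.Dual k (b ⟶ F.obj x) from KMod.ap φ b z) (inMap k F b x s) =
          η (inMap k F b x s) := by
        intro s
        have : (show Module.Dual k (b ⟶ F.obj x) from KMod.ap φ b z) ∘ₗ inMap k F b x =
            η ∘ₗ inMap k F b x := by
          refine DirectSum.linearMap_ext _ fun y => LinearMap.ext fun f : y.1 ⟶ x => ?_
          have e := inMap_lof (k := k) F b x y f
          refine (congrArg (show Module.Dual k (b ⟶ F.obj x) from KMod.ap φ b z) e).trans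
            (Eq.trans ?_ (congrArg η e).symm)
          exact (key b z y f).trans (LinearMap.congr_fun (hz y) f)
        exact LinearMap.congr_fun this s
      refine LinearMap.ext fun u : b ⟶ F.obj x => ?_
      obtain ⟨s, rfl⟩ := (hbij b).2 u
      exact hη s
  exact ⟨asIso φ⟩

/-- The action of `g` as an equivalence of categories. -/
def KAction.equivalence (ρ : KAction k C G) (g : G) : C ≌ C :=
  CategoryTheory.Equivalence.mk (ρ.act g) (ρ.act g⁻¹)
    (eqToIso (by rw [← ρ.act_mul, inv_mul_cancel, ρ.act_one]))
    (eqToIso (by rw [← ρ.act_mul, mul_inv_cancel, ρ.act_one]))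

theorem KAction.bijective_map (ρ : KAction k C G) (g : G) (x y : C) :
    Function.Bijective fun f : x ⟶ y => (ρ.act g).map f :=
  ⟨(ρ.equivalence g).functor.map_injective, (ρ.equivalence g).functor.map_surjective⟩

theorem nonempty_twist_projMod_iso (ρ : KAction k C G) (g : G) (x : C) :
    Nonempty ((twist ρ g).obj (projMod k x) ≅ projMod k ((ρ.act g).obj x)) := by
  let φ : projMod k ((ρ.act g).obj x) ⟶ (twist ρ g).obj (projMod k x) :=
    fromProj (M := (twist ρ g).obj (projMod k x)) ((ρ.act g).obj x)
      (eqToHom (ρ.act_inv_act g x).symm : x ⟶ (ρ.act g⁻¹).obj ((ρ.act g).obj x))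
  have : IsIso φ := KMod.isIso_of_bijective φ fun y => by
    have h : Function.Bijective fun f : (ρ.act g⁻¹).obj ((ρ.act g).obj x) ⟶ (ρ.act g⁻¹).obj y =>
        eqToHom (ρ.act_inv_act g x).symm ≫ f :=
      ⟨fun f f' h => (cancel_epi _).1 h, fun f => ⟨eqToHom (ρ.act_inv_act g x) ≫ f, by simp⟩⟩
    exact h.comp (ρ.bijective_map g⁻¹ _ _)
  exact ⟨(asIso φ).symm⟩

theorem nonempty_twist_injMod_iso (ρ : KAction k C G) (g : G) (x : C) :
    Nonempty ((twist ρ g).obj (injMod k x) ≅ injMod k ((ρ.act g).obj x)) := by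
  let e : (ρ.act g⁻¹).obj ((ρ.act g).obj x) ⟶ x := eqToHom (ρ.act_inv_act g x)
  let l : Module.Dual k (((twist ρ g).obj (injMod k x)).obj.obj ((ρ.act g).obj x)) :=
    Module.Dual.eval k ((ρ.act g⁻¹).obj ((ρ.act g).obj x) ⟶ x) e
  let φ : (twist ρ g).obj (injMod k x) ⟶ injMod k ((ρ.act g).obj x) :=
    toInj (M := (twist ρ g).obj (injMod k x)) ((ρ.act g).obj x) l
  have : IsIso φ := KMod.isIso_of_bijective φ fun y => by
    have h : Function.Bijective fun f : (ρ.act g⁻¹).obj y ⟶ (ρ.act g⁻¹).obj ((ρ.act g).obj x) =>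
        f ≫ e :=
      ⟨fun f f' h => (cancel_mono _).1 h, fun f => ⟨f ≫ eqToHom (ρ.act_inv_act g x).symm, by
        simp [e]⟩⟩
    let E : (y ⟶ (ρ.act g).obj x) ≃ₗ[k] ((ρ.act g⁻¹).obj y ⟶ x) :=
      LinearEquiv.ofBijective (Linear.rightComp k _ e ∘ₗ (ρ.act g⁻¹).mapLinearMap k)
        (h.comp (ρ.bijective_map g⁻¹ _ _))
    exact E.dualMap.bijective
  exact ⟨asIso φ⟩

variable (ΦC : Cᵒᵖ ⥤ KMod k C) (ΦA : Aᵒᵖ ⥤ KMod k A) [ΦC.Full] [ΦC.Faithful] [ΦA.Full]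
  [ΦA.Faithful] [ΦA.Additive]

/-- Stated for an arbitrary fully faithful family so as to treat projectives and injectives at once.
A local retract of `W` is some `ΦA a`, and `a` lifts along the surjection `F.obj`. -/
theorem hasPreimages_of_fullyFaithful (hA : IsLocallyBounded k A)
    (hP : ∀ x, Nonempty ((pushDown hF).obj (ΦC.obj (Opposite.op x)) ≅
      ΦA.obj (Opposite.op (F.obj x))))
    {W : KMod k A} (hW : 𝟙 W ∈ factorIdeal (fun Y => ∃ a, Y = ΦA.obj a) W W) :
    ∀ V, IsLocalRing (End V) → Nonempty (Retract V W) →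
      ∃ x, Nonempty ((pushDown hF).obj (ΦC.obj (Opposite.op x)) ≅ V) := by
  rintro V hV ⟨r⟩
  obtain ⟨_, ⟨⟨a⟩, rfl⟩, ⟨s⟩⟩ := exists_retract_of_id_mem (id_mem_factorIdeal_of_retract r hW)
  have := hA.isLocalRing_end a
  have : IsLocalRing (End (Opposite.op a)) := isLocalRing_end_op
  have := isLocalRing_end_of_fullyFaithful ΦA (Opposite.op a)
  obtain ⟨e⟩ := iso_of_retract s not_isZero_of_isLocalRing
  obtain ⟨x, rfl⟩ := hF.surjective a
  exact ⟨x, ⟨(hP x).some ≪≫ e.symm⟩⟩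

/-- Any preimage `Z` is isomorphic to some `ΦC (g x)`, so isomorphic twists of `Z` give isomorphic
objects of `C`. These are equal by local boundedness, and freeness identifies the group elements. -/
theorem twistFree_of_fullyFaithful (hC : IsLocallyBounded k C)
    (hfd : ∀ x, IsFinDim (ΦC.obj (Opposite.op x)))
    (ht : ∀ g x, Nonempty ((twist ρ g).obj (ΦC.obj (Opposite.op x)) ≅
      ΦC.obj (Opposite.op ((ρ.act g).obj x))))
    {W : KMod k A} (hW : ∀ V, IsLocalRing (End V) → Nonempty (Retract V W) →
      ∃ x, Nonempty ((pushDown hF).obj (ΦC.obj (Opposite.op x)) ≅ V)) :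
    TwistFree hF W := by
  rintro Z hZ hl hr h h' ⟨φ⟩
  obtain ⟨x, ⟨e⟩⟩ := hW _ hl hr
  obtain ⟨g, ⟨i⟩⟩ := (pushOrbit hF).exists_iso_twist hZ (hfd x) e.symm
  have key : ∀ h, Nonempty ((twist ρ h).obj Z ≅
      ΦC.obj (Opposite.op ((ρ.act h).obj ((ρ.act g).obj x)))) := fun h =>
    ⟨(twist ρ h).mapIso (i ≪≫ (ht g x).some) ≪≫ (ht h _).some⟩
  have j := ΦC.preimageIso ((key h).some.symm ≪≫ φ ≪≫ (key h').some)
  exact hF.act_injective (hC.eq_of_iso _ _ ⟨j.unop.symm⟩)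

variable [Finite A]

theorem hasPreimages_regular (hA : IsLocallyBounded k A) (hC : IsLocallyBounded k C) :
    HasPreimages hF (regular k A) ∧ TwistFree hF (regular k A) := by
  have h := hasPreimages_of_fullyFaithful hF (projFunctor k C) (projFunctor k A) hA
    (fun x => nonempty_pushDown_projMod_iso hF x) regular_id_mem
  refine ⟨fun V hV r => ?_, twistFree_of_fullyFaithful hF (projFunctor k C) hC
    (fun x => isFinDim_projMod hC x) (fun g x => nonempty_twist_projMod_iso ρ g x) h⟩
  obtain ⟨x, e⟩ := h V hV r
  exact ⟨_, isFinDim_projMod hC x, e⟩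

theorem hasPreimages_dualRegular (hA : IsLocallyBounded k A) (hC : IsLocallyBounded k C) :
    HasPreimages hF (dualRegular k A) ∧ TwistFree hF (dualRegular k A) := by
  have := injFunctor_full k C hC.finite_hom
  have := injFunctor_full k A hA.finite_hom
  have h := hasPreimages_of_fullyFaithful hF (injFunctor k C) (injFunctor k A) hA
    (fun x => nonempty_pushDown_injMod_iso hF hC x) dualRegular_id_mem
  refine ⟨fun V hV r => ?_, twistFree_of_fullyFaithful hF (injFunctor k C) hC
    (fun x => isFinDim_injMod hC x) (fun g x => nonempty_twist_injMod_iso ρ g x) h⟩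
  obtain ⟨x, e⟩ := h V hV r
  exact ⟨_, isFinDim_injMod hC x, e⟩

end Push

/-! ### The covering of the endomorphism category -/

section CoverCat

variable {k : Type u} [Field k]
  {C : Type u} [Category.{u} C] [Preadditive C] [Linear k C]
  {A : Type u} [Category.{u} A] [Preadditive A] [Linear k A]
  {G : Type u} [Group G] {ρ : KAction k C G} {F : C ⥤ A} [F.Additive] [F.Linear k]
  (hF : IsGaloisCovering ρ F)

theorem ap_eqToHom_pullUp {Φ Ψ : C ⥤ C} [Φ.Additive] [Φ.Linear k] [Ψ.Additive] [Ψ.Linear k]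
    (h : Φ = Ψ) (M : KMod k C) (e : (pullUp (k := k) Φ).obj M = (pullUp Ψ).obj M) (x : C)
    (m : M.obj.obj (Φ.obj x)) :
    KMod.ap (k := k) (C := C) (eqToHom e) x m = M.obj.map (eqToHom (Functor.congr_obj h x)) m := by
  subst h
  rw [eqToHom_refl, eqToHom_refl]
  exact (KMod.map_id_apply (M := M) _ m).symm

theorem pinc_map_eqToHom (M : KMod k C) {a : A} (x y : Fib F a) (h : x.1 = y.1)
    (m : M.obj.obj x.1) : pinc hF M y (M.obj.map (eqToHom h) m) = pinc hF M x m := by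
  obtain ⟨x, hx⟩ := x
  obtain ⟨y, hy⟩ := y
  obtain rfl : x = y := h
  rw [eqToHom_refl, KMod.map_id_apply]

/-- The cocycle relation: both sides move the summand at `x` to that at `(g h)⁻¹ x` without changing
elements. It makes the covering functor invariant under `G`. -/
theorem pushDownTwist_mul (g h : G) (M : KMod k C) :
    (pushDown hF).map (eqToHom (twist_twist_obj ρ g h M)) ≫
        (pushDownTwist hF g ((twist ρ h).obj M)).hom ≫ (pushDownTwist hF h M).hom =
      (pushDownTwist hF (g * h) M).hom := by
  refine KMod.hom_ext fun a => LinearMap.congr_fun (push_linearMap_ext hF fun x m => ?_)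
  have hΦ : ρ.act (g * h)⁻¹ = ρ.act g⁻¹ ⋙ ρ.act h⁻¹ := by rw [mul_inv_rev, ρ.act_mul]
  have e₀ := ap_eqToHom_pullUp hΦ M (twist_twist_obj ρ g h M) x.1 m
  have e₁ := ap_push_pinc hF (eqToHom (twist_twist_obj ρ g h M)) x m
  have e₂ := twistIso_hom_pinc hF g ((twist ρ h).obj M) x
    (KMod.ap (eqToHom (twist_twist_obj ρ g h M)) x.1 m)
  have e₃ := twistIso_hom_pinc hF h M ((fibEquiv hF g a).symm x)
    (KMod.ap (eqToHom (twist_twist_obj ρ g h M)) x.1 m)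
  have e₄ := twistIso_hom_pinc hF (g * h) M x m
  refine (congrArg (fun z => KMod.ap (pushDownTwist hF h M).hom a
    (KMod.ap (pushDownTwist hF g ((twist ρ h).obj M)).hom a z)) e₁).trans ?_
  refine (congrArg (KMod.ap (pushDownTwist hF h M).hom a) e₂).trans (e₃.trans (Eq.trans ?_ e₄.symm))
  refine (congrArg (pinc hF M ((fibEquiv hF h a).symm ((fibEquiv hF g a).symm x))) e₀).trans ?_
  exact pinc_map_eqToHom hF M ((fibEquiv hF (g * h) a).symm x) _ _ m

variable {n : ℕ} {T : Fin n → KMod k A} {T' : Fin n → KMod k C}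
  (lam : ∀ i, (pushDown hF).obj (T' i) ≅ T i)

/-- The component of a morphism `T_i ⟶ T_j` corresponding to a pair of objects over `T_i`, `T_j`. -/
def coverComp (p q : G × Fin n) :
    (T p.2 ⟶ T q.2) →+ ((twist ρ p.1).obj (T' p.2) ⟶ (twist ρ q.1).obj (T' q.2)) where
  toFun φ := degreeOne hF ((coverIso hF lam p).hom ≫ φ ≫ (coverIso hF lam q).inv)
  map_zero' := by simp
  map_add' := by simp

theorem coverComp_map {p q : G × Fin n}
    (f : (twist ρ p.1).obj (T' p.2) ⟶ (twist ρ q.1).obj (T' q.2)) :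
    coverComp hF lam p q ((coverIso hF lam p).inv ≫ (pushDown hF).map f ≫
      (coverIso hF lam q).hom) = f := by
  change degreeOne hF _ = _
  simp only [Category.assoc, Iso.hom_inv_id_assoc, Iso.hom_inv_id, Category.comp_id]
  exact (pushOrbit hF).E_map f

theorem coverIso_hom_inv (g h : G) (i : Fin n) :
    (coverIso hF lam (g, i)).hom ≫ (coverIso hF lam (h, i)).inv =
      (pushDownTwist hF g (T' i)).hom ≫ (pushDownTwist hF h (T' i)).inv := by
  simp [coverIso]

theorem coverComp_map_ne_right {p : G × Fin n} {g h : G} (hgh : g ≠ h) (j : Fin n)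
    (f : (twist ρ p.1).obj (T' p.2) ⟶ (twist ρ g).obj (T' j)) :
    coverComp hF lam p (h, j) ((coverIso hF lam p).inv ≫ (pushDown hF).map f ≫
      (coverIso hF lam (g, j)).hom) = 0 := by
  change degreeOne hF _ = _
  simp only [Category.assoc, Iso.hom_inv_id_assoc]
  rw [coverIso_hom_inv, degreeOne_map_comp, degreeOne_twist_ne hF hgh, comp_zero]

theorem coverComp_map_ne_left {q : G × Fin n} {g h : G} (hgh : g ≠ h) (i : Fin n)
    (f : (twist ρ g).obj (T' i) ⟶ (twist ρ q.1).obj (T' q.2)) :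
    coverComp hF lam (h, i) q ((coverIso hF lam (g, i)).inv ≫ (pushDown hF).map f ≫
      (coverIso hF lam q).hom) = 0 := by
  change degreeOne hF _ = _
  simp only [Category.assoc, Iso.hom_inv_id, Category.comp_id]
  rw [← Category.assoc, coverIso_hom_inv, degreeOne_comp_map, degreeOne_twist_ne hF hgh.symm,
    zero_comp]

theorem coverAction_comp (g : G) :
    (coverAction ρ T').act g ⋙ coverFunctor hF lam = coverFunctor hF lam := by
  refine CategoryTheory.Functor.ext (fun p => rfl) fun p q f => ?_
  change _ = 𝟙 _ ≫ (coverFunctor hF lam).map f ≫ 𝟙 _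
  rw [Category.comp_id, Category.id_comp]
  ext : 1
  change (coverIso hF lam (g * p.1, p.2)).inv ≫ (pushDown hF).map
      (eqToHom (twist_twist_obj ρ g p.1 (T' p.2)) ≫ (twist ρ g).map f.hom ≫
          eqToHom (twist_twist_obj ρ g q.1 (T' q.2)).symm) ≫ (coverIso hF lam (g * q.1, q.2)).hom =
    (coverIso hF lam p).inv ≫ (pushDown hF).map f.hom ≫ (coverIso hF lam q).hom
  have key : ∀ r : G × Fin n, (coverIso hF lam (g * r.1, r.2)).hom =
      (pushDown hF).map (eqToHom (twist_twist_obj ρ g r.1 (T' r.2))) ≫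
        (pushDownTwist hF g ((twist ρ r.1).obj (T' r.2))).hom ≫ (coverIso hF lam r).hom := by
    intro r
    simp only [coverIso, Iso.trans_hom]
    rw [← pushDownTwist_mul]
    simp only [Category.assoc]
  rw [Iso.inv_comp_eq, key p, key q]
  simp only [CategoryTheory.Functor.map_comp, Category.assoc, Iso.hom_inv_id_assoc]
  rw [← CategoryTheory.Functor.map_comp_assoc, ← CategoryTheory.Functor.map_comp_assoc,
    ← CategoryTheory.Functor.map_comp_assoc]
  simp only [Category.assoc, eqToHom_trans, eqToHom_refl, Category.comp_id]
  rw [CategoryTheory.Functor.map_comp, Category.assoc,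
    reassoc_of% (twistIso_natural hF g f.hom)]

open Classical in
-- The components of a family can be recovered from its image, which gives injectivity in the
-- covering property.
theorem coverFunctor_component_out (x : CoverCat ρ T') (b : EndCat T)
    (s : ⨁ y : Fib (coverFunctor hF lam) b, (x ⟶ y.1)) (z : Fib (coverFunctor hF lam) b) :
    coverComp hF lam x z.1 (outMap k (coverFunctor hF lam) x b s ≫ eqToHom z.2.symm).hom =
      (s z).hom := by
  induction s using DirectSum.induction_on with
  | zero => 
    rw [map_zero, zero_comp]
    exact map_zero (coverComp hF lam x z.1)
  | add s t hs ht =>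
    rw [map_add, Preadditive.add_comp]
    exact (map_add (coverComp hF lam x z.1) _ _).trans (congrArg₂ (· + ·) hs ht)
  | of y f =>
    have e := outMap_lof k (coverFunctor hF lam) x b y f
    refine (congrArg (fun φ => coverComp hF lam x z.1 (φ ≫ eqToHom z.2.symm).hom) e).trans ?_
    obtain ⟨⟨g, j⟩, rfl⟩ := z
    obtain ⟨⟨h, j'⟩, hy⟩ := y
    obtain rfl : j' = j := hy
    simp only [eqToHom_refl]
    by_cases hgh : h = g
    · subst hgh
      refine (coverComp_map hF lam f.hom).trans ?_
      exact (congrArg InducedCategory.Hom.hom (DirectSum.of_eq_same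
        (β := fun y : Fib (coverFunctor hF lam) j' => (x ⟶ y.1)) ⟨(h, j'), rfl⟩ f)).symm
    · refine (coverComp_map_ne_right hF lam hgh j' f.hom).trans ?_
      exact (congrArg InducedCategory.Hom.hom (DirectSum.of_eq_of_ne
        (β := fun y : Fib (coverFunctor hF lam) j' => (x ⟶ y.1)) ⟨(h, j'), rfl⟩ ⟨(g, j'), rfl⟩ f
        fun e => hgh (congrArg (fun z => z.1.1) e).symm)).symm

open Classical in
theorem coverFunctor_component_in (a : EndCat T) (y : CoverCat ρ T')
    (s : ⨁ x : Fib (coverFunctor hF lam) a, (x.1 ⟶ y)) (z : Fib (coverFunctor hF lam) a) :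
    coverComp hF lam z.1 y (eqToHom z.2 ≫ inMap k (coverFunctor hF lam) a y s).hom =
      (s z).hom := by
  induction s using DirectSum.induction_on with
  | zero => 
    rw [map_zero, comp_zero]
    exact map_zero (coverComp hF lam z.1 y)
  | add s t hs ht =>
    rw [map_add, Preadditive.comp_add]
    exact (map_add (coverComp hF lam z.1 y) _ _).trans (congrArg₂ (· + ·) hs ht)
  | of x f =>
    have e := inMap_lof (k := k) (coverFunctor hF lam) a y x f
    refine (congrArg (fun φ => coverComp hF lam z.1 y (eqToHom z.2 ≫ φ).hom) e).trans ?_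
    obtain ⟨⟨g, j⟩, rfl⟩ := z
    obtain ⟨⟨h, j'⟩, hy⟩ := x
    obtain rfl : j' = j := hy
    simp only [eqToHom_refl]
    by_cases hgh : h = g
    · subst hgh
      refine (coverComp_map hF lam f.hom).trans ?_
      exact (congrArg InducedCategory.Hom.hom (DirectSum.of_eq_same
        (β := fun x : Fib (coverFunctor hF lam) j' => (x.1 ⟶ y)) ⟨(h, j'), rfl⟩ f)).symm
    · refine (coverComp_map_ne_left hF lam hgh j' f.hom).trans ?_
      exact (congrArg InducedCategory.Hom.hom (DirectSum.of_eq_of_ne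
        (β := fun x : Fib (coverFunctor hF lam) j' => (x.1 ⟶ y)) ⟨(h, j'), rfl⟩ ⟨(g, j'), rfl⟩ f
        fun e => hgh (congrArg (fun z => z.1.1) e).symm)).symm

theorem iso_conj {𝒟 : Type*} [Category 𝒟] {X X' Y Y' : 𝒟} (e : X ≅ X') (e' : Y ≅ Y')
    (φ : X' ⟶ Y') : e.inv ≫ (e.hom ≫ φ ≫ e'.inv) ≫ e'.hom = φ := by
  simp

/-- Surjectivity is the decomposition of a morphism between push-downs into homogeneous components.
-/
theorem coverFunctor_bijective_out (hT' : ∀ i, IsFinDim (T' i)) (x : CoverCat ρ T')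
    (b : EndCat T) : Function.Bijective (outMap k (coverFunctor hF lam) x b) := by
  classical
  constructor
  · intro s t h
    refine DFinsupp.ext fun z => InducedCategory.hom_ext ?_
    rw [← coverFunctor_component_out hF lam x b s z, h, coverFunctor_component_out]
  · intro φ
    have h := pushDown_span_left hF ((hT' x.2).twist x.1) (N := T' b)
      ((coverIso hF lam x).hom ≫ φ.hom ≫ (lam b).inv)
    have key : ∀ ψ ∈ AddSubgroup.closure {ψ | ∃ (g : G)
        (f : (twist ρ x.1).obj (T' x.2) ⟶ (twist ρ g).obj (T' b)),
        ψ = (pushDown hF).map f ≫ (pushDownTwist hF g (T' b)).hom},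
        ∃ s, (outMap k (coverFunctor hF lam) x b s).hom =
          (coverIso hF lam x).inv ≫ ψ ≫ (lam b).hom := by
      intro ψ hψ
      induction hψ using AddSubgroup.closure_induction with
      | mem ψ h =>
        obtain ⟨g, f, rfl⟩ := h
        let y : CoverCat ρ T' := (g, b)
        let f' : x ⟶ y := InducedCategory.homMk f
        have e := outMap_lof k (coverFunctor hF lam) x b ⟨y, rfl⟩ f'
        refine ⟨_, (congrArg InducedCategory.Hom.hom e).trans ?_⟩
        change ((coverIso hF lam x).inv ≫ (pushDown hF).map f ≫ (coverIso hF lam (g, b)).hom) ≫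
          𝟙 _ = _
        simp [coverIso]
      | zero =>
        refine ⟨0, ?_⟩
        rw [map_zero, zero_comp, comp_zero]
        rfl
      | add ψ ψ' _ _ h₁ h₂ =>
        obtain ⟨s, hs⟩ := h₁
        obtain ⟨t, ht⟩ := h₂
        refine ⟨s + t, ?_⟩
        rw [map_add, Preadditive.add_comp, Preadditive.comp_add, ← hs, ← ht]
        rfl
      | neg ψ _ h =>
        obtain ⟨s, hs⟩ := h
        refine ⟨-s, ?_⟩
        rw [map_neg, Preadditive.neg_comp, Preadditive.comp_neg, ← hs]
        rfl
    obtain ⟨s, hs⟩ := key _ h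
    exact ⟨s, InducedCategory.hom_ext (hs.trans (iso_conj _ (lam b) φ.hom))⟩

theorem coverFunctor_bijective_in (hT' : ∀ i, IsFinDim (T' i)) (a : EndCat T)
    (y : CoverCat ρ T') : Function.Bijective (inMap k (coverFunctor hF lam) a y) := by
  classical
  constructor
  · intro s t h
    refine DFinsupp.ext fun z => InducedCategory.hom_ext ?_
    rw [← coverFunctor_component_in hF lam a y s z, h, coverFunctor_component_in]
  · intro φ
    have h := pushDown_span_right hF (hT' a) (N := (twist ρ y.1).obj (T' y.2))
      ((lam a).hom ≫ φ.hom ≫ (coverIso hF lam y).inv)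
    have key : ∀ ψ ∈ AddSubgroup.closure {ψ | ∃ (g : G)
        (f : (twist ρ g).obj (T' a) ⟶ (twist ρ y.1).obj (T' y.2)),
        ψ = (pushDownTwist hF g (T' a)).inv ≫ (pushDown hF).map f},
        ∃ s, (inMap k (coverFunctor hF lam) a y s).hom =
          (lam a).inv ≫ ψ ≫ (coverIso hF lam y).hom := by
      intro ψ hψ
      induction hψ using AddSubgroup.closure_induction with
      | mem ψ h =>
        obtain ⟨g, f, rfl⟩ := h
        let x : CoverCat ρ T' := (g, a)
        let f' : x ⟶ y := InducedCategory.homMk f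
        have e := inMap_lof (k := k) (coverFunctor hF lam) a y ⟨x, rfl⟩ f'
        refine ⟨_, (congrArg InducedCategory.Hom.hom e).trans ?_⟩
        change 𝟙 _ ≫ (coverIso hF lam (g, a)).inv ≫ (pushDown hF).map f ≫
          (coverIso hF lam y).hom = _
        simp [coverIso]
      | zero =>
        refine ⟨0, ?_⟩
        rw [map_zero, zero_comp, comp_zero]
        rfl
      | add ψ ψ' _ _ h₁ h₂ =>
        obtain ⟨s, hs⟩ := h₁
        obtain ⟨t, ht⟩ := h₂
        refine ⟨s + t, ?_⟩
        rw [map_add, Preadditive.add_comp, Preadditive.comp_add, ← hs, ← ht]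
        rfl
      | neg ψ _ h =>
        obtain ⟨s, hs⟩ := h
        refine ⟨-s, ?_⟩
        rw [map_neg, Preadditive.neg_comp, Preadditive.comp_neg, ← hs]
        rfl
    obtain ⟨s, hs⟩ := key _ h
    exact ⟨s, InducedCategory.hom_ext (hs.trans (iso_conj (lam a) _ φ.hom))⟩

/-- Freeness is automatic because the objects are pairs `(g, i)` rather than isomorphism classes;
trivial stabilizers only enter in local boundedness. -/
theorem isGaloisCovering_coverFunctor (hT' : ∀ i, IsFinDim (T' i)) :
    IsGaloisCovering (coverAction ρ T') (coverFunctor hF lam) where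
  free g x h := by
    have : g * x.1 = x.1 := congrArg Prod.fst h
    simpa using this
  comp_eq := coverAction_comp hF lam
  surjective i := ⟨((1 : G), i), rfl⟩
  transitive x y h := ⟨y.1 * x.1⁻¹, Prod.ext (by
    change y.1 * x.1⁻¹ * x.1 = y.1
    simp) h⟩
  covering := ⟨fun x y => coverFunctor_bijective_out hF lam hT' x _,
    fun x y => coverFunctor_bijective_in hF lam hT' _ y⟩

theorem isLocalRing_end_of_isLocalRing_map {𝒟 ℰ : Type*} [Category 𝒟] [Category ℰ]
    [Preadditive 𝒟] [Preadditive ℰ] (Φ : 𝒟 ⥤ ℰ) [Φ.Full] [Φ.Faithful] [Φ.Additive] (X : 𝒟)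
    [IsLocalRing (End (Φ.obj X))] : IsLocalRing (End X) := by
  refine isLocalRing_end_of_forall (fun h => not_isZero_of_isLocalRing (Φ.map_isZero h)) fun a => ?_
  have h : Φ.map a + Φ.map (𝟙 X - a) = 𝟙 _ := by rw [← Φ.map_add, add_sub_cancel, Φ.map_id]
  refine (isIso_or_isIso_of_add_eq_id _ _ h).imp (fun h => ?_) fun h => ?_
  · have h' : IsIso (Φ.map a) := h
    exact isIso_of_reflects_iso a Φ
  · have h' : IsIso (Φ.map (𝟙 X - a)) := h
    exact isIso_of_reflects_iso (𝟙 X - a) Φ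

/-- The action of the covering on morphisms, as a linear map. -/
def coverMapL (x y : CoverCat ρ T') : (x ⟶ y) →ₗ[k] (T x.2 ⟶ T y.2) where
  toFun f := (coverIso hF lam x).inv ≫ (pushDown hF).map f.hom ≫ (coverIso hF lam y).hom
  map_add' f f' := by
    change _ ≫ (pushDown hF).map (f.hom + f'.hom) ≫ _ = _
    simp
  map_smul' r f := by
    change _ ≫ (pushDown hF).map (r • f.hom) ≫ _ = _
    simp

/-- The morphisms out of `x` embed into the finite product of the spaces `Hom(T_i, T_j)`: targets
over the same `j` contribute distinct degrees. -/
theorem finite_out_coverCat (hF : IsGaloisCovering ρ F)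
    (lam : ∀ i, (pushDown hF).obj (T' i) ≅ T i)
    (hfin : ∀ i j, Module.Finite k (T i ⟶ T j)) (x : CoverCat ρ T') :
    Module.Finite k (⨁ y, (x ⟶ y)) := by
  classical
  let L : (⨁ y, (x ⟶ y)) →ₗ[k] ∀ j, T x.2 ⟶ T j :=
    DirectSum.toModule k (CoverCat ρ T') _ fun y =>
      LinearMap.single k (fun j => T x.2 ⟶ T j) y.2 ∘ₗ coverMapL hF lam x y
  have key : ∀ s z, coverComp hF lam x z (L s z.2) = (s z).hom := by
    intro s z
    induction s using DirectSum.induction_on with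
    | zero =>
      rw [map_zero]
      exact map_zero (coverComp hF lam x z)
    | add s t hs ht =>
      rw [map_add]
      exact (map_add (coverComp hF lam x z) _ _).trans (congrArg₂ (· + ·) hs ht)
    | of y f =>
      have e : L (DirectSum.of _ y f) = Pi.single y.2 (coverMapL hF lam x y f) :=
        DirectSum.toModule_lof k (M := fun y : CoverCat ρ T' => (x ⟶ y)) y f
      rw [e]
      by_cases hyz : y = z
      · subst hyz
        rw [Pi.single_eq_same]
        refine (coverComp_map hF lam f.hom).trans ?_
        exact (congrArg InducedCategory.Hom.hom (DirectSum.of_eq_same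
          (β := fun y : CoverCat ρ T' => (x ⟶ y)) y f)).symm
      · have h₀ : (DirectSum.of (fun y : CoverCat ρ T' => (x ⟶ y)) y f) z = 0 :=
          DirectSum.of_eq_of_ne _ _ _ (Ne.symm hyz)
        rw [h₀]
        obtain ⟨g, j⟩ := z
        obtain ⟨h, j'⟩ := y
        by_cases hj : j' = j
        · subst hj
          rw [Pi.single_eq_same]
          exact coverComp_map_ne_right hF lam (fun e => hyz (congrArg (·, j') e)) j' f.hom
        · rw [Pi.single_eq_of_ne (Ne.symm hj)]
          exact map_zero (coverComp hF lam x (g, j))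
  exact Module.Finite.of_injective L fun s t h => DFinsupp.ext fun z =>
    InducedCategory.hom_ext (by rw [← key s z, h, key])

theorem finite_in_coverCat (hF : IsGaloisCovering ρ F)
    (lam : ∀ i, (pushDown hF).obj (T' i) ≅ T i)
    (hfin : ∀ i j, Module.Finite k (T i ⟶ T j)) (y : CoverCat ρ T') :
    Module.Finite k (⨁ x, (x ⟶ y)) := by
  classical
  let L : (⨁ x, (x ⟶ y)) →ₗ[k] ∀ i, T i ⟶ T y.2 :=
    DirectSum.toModule k (CoverCat ρ T') _ fun x =>
      LinearMap.single k (fun i => T i ⟶ T y.2) x.2 ∘ₗ coverMapL hF lam x y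
  have key : ∀ s z, coverComp hF lam z y (L s z.2) = (s z).hom := by
    intro s z
    induction s using DirectSum.induction_on with
    | zero =>
      rw [map_zero]
      exact map_zero (coverComp hF lam z y)
    | add s t hs ht =>
      rw [map_add]
      exact (map_add (coverComp hF lam z y) _ _).trans (congrArg₂ (· + ·) hs ht)
    | of x f =>
      have e : L (DirectSum.of _ x f) = Pi.single x.2 (coverMapL hF lam x y f) :=
        DirectSum.toModule_lof k (M := fun x : CoverCat ρ T' => (x ⟶ y)) x f
      rw [e]
      by_cases hxz : x = z
      · subst hxz
        rw [Pi.single_eq_same]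
        refine (coverComp_map hF lam f.hom).trans ?_
        exact (congrArg InducedCategory.Hom.hom (DirectSum.of_eq_same
          (β := fun x : CoverCat ρ T' => (x ⟶ y)) x f)).symm
      · have h₀ : (DirectSum.of (fun x : CoverCat ρ T' => (x ⟶ y)) x f) z = 0 :=
          DirectSum.of_eq_of_ne _ _ _ (Ne.symm hxz)
        rw [h₀]
        obtain ⟨g, j⟩ := z
        obtain ⟨h, j'⟩ := x
        by_cases hj : j' = j
        · subst hj
          rw [Pi.single_eq_same]
          exact coverComp_map_ne_left hF lam (fun e => hxz (congrArg (·, j') e)) j' f.hom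
        · rw [Pi.single_eq_of_ne (Ne.symm hj)]
          exact map_zero (coverComp hF lam (g, j) y)
  exact Module.Finite.of_injective L fun s t h => DFinsupp.ext fun z =>
    InducedCategory.hom_ext (by rw [← key s z, h, key])

/-- Objects over different `T_i` are separated because the sum of the `T_i` is basic, and objects
over the same `T_i` by trivial stabilizers. -/
theorem isLocallyBounded_coverCat (hF : IsGaloisCovering ρ F)
    (lam : ∀ i, (pushDown hF).obj (T' i) ≅ T i)
    {W : KMod k A} (hW : IsBasic W) (hfree : TwistFree hF W)
    {incl : ∀ i, T i ⟶ W} (hsum : IsDirectSum T W incl) (hT : ∀ i, IsInd (T i))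
    (hT' : ∀ i, IsFinDim (T' i)) : IsLocallyBounded k (CoverCat ρ T') := by
  classical
  obtain ⟨p, hp₁, hp₂, -⟩ := hsum.exists_proj_finite
  have hloc := fun i => (hT i).isLocalRing
  have hloc' : ∀ x : G × Fin n, IsLocalRing (End ((pushDown hF).obj ((twist ρ x.1).obj (T' x.2)))) :=
    fun x => isLocalRing_end_of_iso (coverIso hF lam x)
  have hfin : ∀ i j, Module.Finite k (T i ⟶ T j) := fun i j => GalCov.finite_hom (hT i).1 (hT j).1
  refine ⟨fun x y ⟨e⟩ => ?_, fun x => ?_, fun y => ?_, fun x => ?_⟩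
  · have e' : (twist ρ x.1).obj (T' x.2) ≅ (twist ρ y.1).obj (T' y.2) :=
      (inducedFunctor fun p : G × Fin n => (twist ρ p.1).obj (T' p.2)).mapIso e
    have eT : T x.2 ≅ T y.2 :=
      (coverIso hF lam x).symm ≪≫ (pushDown hF).mapIso e' ≪≫ coverIso hF lam y
    have hxy : x.2 = y.2 := by
      by_contra hne
      refine hW.multiplicity (hT x.2) (incl x.2) (eT.hom ≫ incl y.2) (p x.2) (p y.2 ≫ eT.inv)
        (hp₁ _) ?_ ?_
      · rw [Category.assoc, reassoc_of% (hp₁ y.2), Iso.hom_inv_id]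
      · rw [← Category.assoc, hp₂ _ _ hne, zero_comp]
    obtain ⟨g, i⟩ := x
    obtain ⟨h, j⟩ := y
    obtain rfl : i = j := hxy
    rw [hfree (T' i) (hT' i) (isLocalRing_end_of_iso (lam i))
      ⟨(Retract.ofIso (lam i)).trans ⟨incl i, p i, hp₁ i⟩⟩ g h ⟨e'⟩]
  · exact finite_out_coverCat hF lam hfin x
  · exact finite_in_coverCat hF lam hfin y
  · have : IsLocalRing (End ((twist ρ x.1).obj (T' x.2))) :=
      (pushOrbit hF).isLocalRing_of_map _
    exact @isLocalRing_end_of_isLocalRing_map _ _ _ _ _ _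
      (inducedFunctor fun p : G × Fin n => (twist ρ p.1).obj (T' p.2)) _ _ _ x this

end CoverCat

/-! ### Copresentations by approximations -/

section Copresentation

variable {𝒟 : Type*} [Category 𝒟] [Abelian 𝒟]

/-- `0 → X → M₁ → M₂` is exact, the modules `M₁`, `M₂` are in the additive closure of `Q`, and
`f` is a left approximation. -/
structure IsCopresentation (Q : ObjectProperty 𝒟) {X M₁ M₂ : 𝒟} (f : X ⟶ M₁) (d : M₁ ⟶ M₂) :
    Prop where
  mono : Mono f
  zero : f ≫ d = 0
  lift : ∀ (W : 𝒟) (a : W ⟶ M₁), a ≫ d = 0 → ∃ b : W ⟶ X, b ≫ f = a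
  mem₁ : 𝟙 M₁ ∈ factorIdeal Q M₁ M₁
  mem₂ : 𝟙 M₂ ∈ factorIdeal Q M₂ M₂
  left : ∀ R, Q R → ∀ a : X ⟶ R, ∃ b : M₁ ⟶ R, f ≫ b = a

/-- `X` has a copresentation by objects in the additive closure of `Q` which starts with a left
approximation. -/
def HasCopresentation (Q : ObjectProperty 𝒟) (X : 𝒟) : Prop :=
  ∃ (M₁ M₂ : 𝒟) (f : X ⟶ M₁) (d : M₁ ⟶ M₂), IsCopresentation Q f d

variable {Q Q' : ObjectProperty 𝒟} {X Y : 𝒟}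

/-- With `l` extending `(𝟙 - r.r ≫ r.i) ≫ f` along `f`, the kernel of `(d, l)` is the part of `Y`
fixed by the idempotent, namely `X`. -/
theorem HasCopresentation.of_retract (h : HasCopresentation Q Y) (r : Retract X Y) :
    HasCopresentation Q X := by
  obtain ⟨M₁, M₂, f, d, h⟩ := h
  have := h.mono
  obtain ⟨l, hl⟩ := exists_extension f h.left
    (factorIdeal_of_id_right h.mem₁ ((𝟙 Y - r.r ≫ r.i) ≫ f))
  have : Mono r.i := mono_of_mono_fac r.retract
  refine ⟨M₁, M₂ ⊞ M₁, r.i ≫ f, biprod.lift d l, inferInstance, ?_, fun W a ha => ?_, h.mem₁,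
    id_mem_factorIdeal_biprod h.mem₂ h.mem₁, fun R hR a => ?_⟩
  · refine biprod.hom_ext _ _ ?_ ?_
    · simp [h.zero]
    · simp [hl]
  · have h₁ : a ≫ d = 0 := by simpa using congrArg (· ≫ biprod.fst) ha
    have h₂ : a ≫ l = 0 := by simpa using congrArg (· ≫ biprod.snd) ha
    obtain ⟨b, rfl⟩ := h.lift W a h₁
    rw [Category.assoc, hl, ← Category.assoc, ← zero_comp (f := f), cancel_mono,
      Preadditive.comp_sub, Category.comp_id, sub_eq_zero] at h₂
    exact ⟨b ≫ r.r, by rw [Category.assoc, ← Category.assoc r.r, ← Category.assoc, ← h₂]⟩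
  · obtain ⟨b, hb⟩ := h.left R hR (r.r ≫ a)
    exact ⟨b, by rw [Category.assoc, hb, r.retract_assoc]⟩

theorem HasCopresentation.of_factorIdeal (h : HasCopresentation Q X)
    (h₁ : ∀ R, Q R → 𝟙 R ∈ factorIdeal Q' R R) (h₂ : ∀ R, Q' R → 𝟙 R ∈ factorIdeal Q R R) :
    HasCopresentation Q' X := by
  obtain ⟨M₁, M₂, f, d, h⟩ := h
  exact ⟨M₁, M₂, f, d, h.mono, h.zero, h.lift, factorIdeal_le h₁ h.mem₁, factorIdeal_le h₁ h.mem₂,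
    fun R hR a => exists_extension f h.left (factorIdeal_of_id_right (h₂ R hR) a)⟩

theorem HasCopresentation.of_orbitFunctor {𝒳 : Type*} [Category 𝒳] [Abelian 𝒳] {P : 𝒳 ⥤ 𝒟}
    {G : Type*} (O : OrbitFunctor P G) [P.Additive] [PreservesFiniteLimits P]
    [PreservesFiniteColimits P] {𝓡 : ObjectProperty 𝒳} (hfd : ∀ R, 𝓡 R → O.fd R)
    (ht : ∀ g R, 𝓡 R → 𝓡 ((O.t g).obj R)) {X : 𝒳} (hX : O.fd X)
    (h : HasCopresentation (imageProp P 𝓡) (P.obj X)) : HasCopresentation 𝓡 X := by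
  obtain ⟨M₁, M₂, f, d, h⟩ := h
  have := h.mono
  obtain ⟨M, f', w, hM, hM', hw⟩ := O.exists_factor hfd ht hX (factorIdeal_of_id_right h.mem₁ f)
  have hPM : 𝟙 (P.obj M) ∈ factorIdeal (imageProp P 𝓡) (P.obj M) (P.obj M) := by
    have := factorIdeal_map P (Q'' := imageProp P 𝓡) (fun R hR => ⟨R, hR, rfl⟩) hM'
    rwa [P.map_id] at this
  obtain ⟨v, hv⟩ := exists_extension f h.left (factorIdeal_of_id_right hPM (P.map f'))
  have : P.Faithful := ⟨fun h => O.map_injective h⟩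
  have : Mono (P.map f') := mono_of_mono_fac hw
  have : Mono f' := P.mono_of_mono_map this
  have hS : (ShortComplex.mk f' (cokernel.π f') (cokernel.condition f')).ShortExact :=
    { exact := ShortComplex.exact_cokernel f' }
  have hPS := hS.map_of_exact P
  have := hPS.epi_g
  -- The kernel of `δ` is the image of `P.map f'`: the first component forces a factorisation
  -- through `f` after applying `w`, the second says that `w ≫ v` acts as the identity.
  let δ : P.obj M ⟶ M₂ ⊞ P.obj M := biprod.lift (w ≫ d) (𝟙 _ - w ≫ v)
  have hδ : P.map f' ≫ δ = 0 := by
    refine biprod.hom_ext _ _ ?_ ?_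
    · simp [δ, reassoc_of% hw, h.zero]
    · simp [δ, reassoc_of% hw, hv]
  obtain ⟨δ', hδ'⟩ : ∃ δ' : P.obj (cokernel f') ⟶ M₂ ⊞ P.obj M, P.map (cokernel.π f') ≫ δ' = δ :=
    ⟨hPS.exact.desc δ hδ, hPS.exact.g_desc _ _⟩
  obtain ⟨M', z, w', hM₂, hM₂', hw'⟩ := O.exists_factor hfd ht (O.fd_epi (cokernel.π f') hM)
    (factorIdeal_of_id_right (id_mem_factorIdeal_biprod h.mem₂ hPM) δ')
  refine ⟨M, M', f', cokernel.π f' ≫ z, ‹Mono f'›, by simp, fun W a ha => ?_, hM', hM₂',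
    fun R hR a => ?_⟩
  · have h₁ : P.map a ≫ δ = 0 := by
      rw [← hδ', ← hw', ← Category.assoc, ← Category.assoc, ← P.map_comp, ← P.map_comp,
        Category.assoc, ha, P.map_zero, zero_comp]
    have h₂ : (P.map a ≫ w) ≫ d = 0 := by simpa [δ] using congrArg (· ≫ biprod.fst) h₁
    have h₃ : P.map a - P.map a ≫ w ≫ v = 0 := by
      simpa [δ] using congrArg (· ≫ biprod.snd) h₁
    obtain ⟨b, hb⟩ := h.lift _ _ h₂
    refine ⟨O.E b, ?_⟩
    rw [← O.E_comp_map, ← hv, reassoc_of% hb, ← sub_eq_zero.1 h₃, O.E_map]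
  · obtain ⟨b, hb⟩ := h.left _ ⟨R, hR, rfl⟩ (P.map a)
    refine ⟨O.E (w ≫ b), ?_⟩
    rw [← O.E_map_comp, reassoc_of% hw, hb, O.E_map]

theorem factorIdeal_sup {Q₁ Q₂ : ObjectProperty 𝒟} {φ : X ⟶ Y}
    (h : φ ∈ factorIdeal (fun R => Q₁ R ∨ Q₂ R) X Y) :
    ∃ a ∈ factorIdeal Q₁ X Y, ∃ b ∈ factorIdeal Q₂ X Y, a + b = φ := by
  induction h using AddSubgroup.closure_induction with
  | mem _ h =>
    obtain ⟨R, hR | hR, a, b, rfl⟩ := h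
    · exact ⟨_, comp_mem_factorIdeal hR a b, 0, zero_mem _, add_zero _⟩
    · exact ⟨0, zero_mem _, _, comp_mem_factorIdeal hR a b, zero_add _⟩
  | zero => exact ⟨0, zero_mem _, 0, zero_mem _, add_zero _⟩
  | add _ _ _ _ h₁ h₂ =>
    obtain ⟨a, ha, b, hb, rfl⟩ := h₁
    obtain ⟨a', ha', b', hb', rfl⟩ := h₂
    exact ⟨a + a', add_mem ha ha', b + b', add_mem hb hb', by abel⟩
  | neg _ _ h =>
    obtain ⟨a, ha, b, hb, rfl⟩ := h
    exact ⟨-a, neg_mem ha, -b, neg_mem hb, by abel⟩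

theorem factorIdeal_eq_zero_of_hom (h : ∀ R, Q R → ∀ f : X ⟶ R, f = 0) {φ : X ⟶ Y}
    (hφ : φ ∈ factorIdeal Q X Y) : φ = 0 := by
  induction hφ using AddSubgroup.closure_induction with
  | mem _ h' =>
    obtain ⟨R, hR, a, b, rfl⟩ := h'
    rw [h R hR a, zero_comp]
  | zero => rfl
  | add _ _ _ _ h₁ h₂ => rw [h₁, h₂, add_zero]
  | neg _ _ h => rw [h, neg_zero]

theorem factorIdeal_comp_eq_zero {Q₁ Q₂ : ObjectProperty 𝒟}
    (h : ∀ R R', Q₁ R → Q₂ R' → ∀ f : R ⟶ R', f = 0) {Z : 𝒟} {φ : X ⟶ Y} {ψ : Y ⟶ Z}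
    (hφ : φ ∈ factorIdeal Q₁ X Y) (hψ : ψ ∈ factorIdeal Q₂ Y Z) : φ ≫ ψ = 0 := by
  induction hφ using AddSubgroup.closure_induction with
  | mem _ h' =>
    obtain ⟨R, hR, a, b, rfl⟩ := h'
    rw [Category.assoc, factorIdeal_eq_zero_of_hom (fun R' hR' f => h R R' hR hR' f)
      (comp_factorIdeal b hψ), comp_zero]
  | zero => exact zero_comp
  | add _ _ _ _ h₁ h₂ => rw [Preadditive.add_comp, h₁, h₂, add_zero]
  | neg _ _ h => rw [Preadditive.neg_comp, h, neg_zero]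

/-- If the additive closure of `Q₁` and `Q₂` is the orthogonal sum of those of `Q₁` and `Q₂`, then
a local object with a copresentation is orthogonal to one of `Q₁` and `Q₂`. -/
theorem hom_eq_zero_of_hasCopresentation {Q₁ Q₂ : ObjectProperty 𝒟}
    (h₁₂ : ∀ R R', Q₁ R → Q₂ R' → ∀ f : R ⟶ R', f = 0)
    (h₂₁ : ∀ R R', Q₂ R → Q₁ R' → ∀ f : R ⟶ R', f = 0) [IsLocalRing (End X)]
    (h : HasCopresentation (fun R => Q₁ R ∨ Q₂ R) X) :
    (∀ R, Q₁ R → ∀ f : X ⟶ R, f = 0) ∨ ∀ R, Q₂ R → ∀ f : X ⟶ R, f = 0 := by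
  obtain ⟨M₁, M₂, f, d, h⟩ := h
  have := h.mono
  obtain ⟨a, ha, b, hb, hab⟩ := factorIdeal_sup h.mem₁
  obtain ⟨a', ha', b', hb', hab'⟩ := factorIdeal_sup h.mem₂
  have hz₁ : a ≫ b = 0 := factorIdeal_comp_eq_zero h₁₂ ha hb
  have hz₂ : b ≫ a = 0 := factorIdeal_comp_eq_zero h₂₁ hb ha
  -- `a` and `b` are complementary idempotents, and orthogonality of the classes makes `d` commute
  -- with them and with `a'`, `b'`. They therefore restrict to the kernel `X` as `α` and `β`.
  have had : a ≫ d = d ≫ a' := by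
    have e₁ : a ≫ d = a ≫ d ≫ a' + a ≫ d ≫ b' := by
      rw [← Preadditive.comp_add, ← Preadditive.comp_add, hab', Category.comp_id]
    have e₂ : d ≫ a' = a ≫ d ≫ a' + b ≫ d ≫ a' := by
      rw [← Preadditive.add_comp, hab, Category.id_comp]
    rw [factorIdeal_comp_eq_zero h₁₂ ha (comp_factorIdeal d hb'), add_zero] at e₁
    rw [factorIdeal_comp_eq_zero h₂₁ hb (comp_factorIdeal d ha'), add_zero] at e₂
    exact e₁.trans e₂.symm
  have hbd : b ≫ d = d ≫ b' := by
    rw [eq_sub_of_add_eq' hab, eq_sub_of_add_eq' hab', Preadditive.sub_comp, Preadditive.comp_sub,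
      had, Category.comp_id, Category.id_comp]
  obtain ⟨α, hα⟩ := h.lift X (f ≫ a) (by rw [Category.assoc, had, reassoc_of% h.zero, zero_comp])
  obtain ⟨β, hβ⟩ := h.lift X (f ≫ b) (by rw [Category.assoc, hbd, reassoc_of% h.zero, zero_comp])
  have hsum : α + β = 𝟙 X := by
    rw [← cancel_mono f, Preadditive.add_comp, hα, hβ, ← Preadditive.comp_add, hab,
      Category.comp_id, Category.id_comp]
  have hαβ : α ≫ β = 0 := by
    rw [← cancel_mono f, Category.assoc, hβ, reassoc_of% hα, hz₁, comp_zero, zero_comp]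
  have hβα : β ≫ α = 0 := by
    rw [← cancel_mono f, Category.assoc, hα, reassoc_of% hβ, hz₂, comp_zero, zero_comp]
  -- One of the two orthogonal maps is invertible, so the other is zero; the approximation property
  -- then kills every map from `X` to the corresponding class.
  rcases isIso_or_isIso_of_add_eq_id α β hsum with hi | hi
  · right
    have hβ₀ : β = 0 := by rwa [← cancel_epi α, comp_zero]
    have hfb : f ≫ b = 0 := by rw [← hβ, hβ₀, zero_comp]
    intro R hR g
    obtain ⟨l, rfl⟩ := h.left R (Or.inr hR) g
    have hal : a ≫ l = 0 := by
      simpa using factorIdeal_comp_eq_zero h₁₂ ha (comp_factorIdeal l (id_mem_factorIdeal hR))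
    rw [← Category.id_comp l, ← hab, Preadditive.add_comp, hal, zero_add, ← Category.assoc, hfb,
      zero_comp]
  · left
    have hα₀ : α = 0 := by rwa [← cancel_epi β, comp_zero]
    have hfa : f ≫ a = 0 := by rw [← hα, hα₀, zero_comp]
    intro R hR g
    obtain ⟨l, rfl⟩ := h.left R (Or.inl hR) g
    have hbl : b ≫ l = 0 := by
      simpa using factorIdeal_comp_eq_zero h₂₁ hb (comp_factorIdeal l (id_mem_factorIdeal hR))
    rw [← Category.id_comp l, ← hab, Preadditive.add_comp, hbl, add_zero, ← Category.assoc, hfa,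
      zero_comp]

/-- The objects of `Q` detect the morphisms to an object with a copresentation. -/
theorem HasCopresentation.eq_zero (h : HasCopresentation Q Y) (a : X ⟶ Y)
    (h' : ∀ R, Q R → ∀ b : Y ⟶ R, a ≫ b = 0) : a = 0 := by
  obtain ⟨M₁, M₂, f, d, h⟩ := h
  have := h.mono
  rw [← cancel_mono f, zero_comp]
  have key : ∀ φ ∈ factorIdeal Q Y M₁, a ≫ φ = 0 := by
    intro φ hφ
    induction hφ using AddSubgroup.closure_induction with
    | mem _ h'' =>
      obtain ⟨R, hR, b, c, rfl⟩ := h''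
      rw [← Category.assoc, h' R hR b, zero_comp]
    | zero => exact comp_zero
    | add _ _ _ _ h₁ h₂ => rw [Preadditive.comp_add, h₁, h₂, add_zero]
    | neg _ _ h => rw [Preadditive.comp_neg, h, neg_zero]
  exact key f (factorIdeal_of_id_right h.mem₁ f)

end Copresentation

/-! ### The coresolution of a tilting module -/

section Coresolution

variable {𝒟 : Type u₁} [Category.{v} 𝒟] [Abelian 𝒟]

theorem subsingleton_ext_of_id_mem [HasExt.{w} 𝒟] {Q : ObjectProperty 𝒟} {X V : 𝒟} (n : ℕ)
    (hX : 𝟙 X ∈ factorIdeal Q X X) (h : ∀ R, Q R → Subsingleton (Abelian.Ext.{w} R V n)) :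
    Subsingleton (Abelian.Ext.{w} X V n) := by
  refine subsingleton_of_forall_eq 0 fun α => ?_
  have key : ∀ φ ∈ factorIdeal Q X X, (Abelian.Ext.mk₀ φ).comp α (zero_add n) = 0 := by
    intro φ hφ
    induction hφ using AddSubgroup.closure_induction with
    | mem _ h' =>
      obtain ⟨R, hR, a, b, rfl⟩ := h'
      have := h R hR
      rw [← Abelian.Ext.mk₀_comp_mk₀_assoc,
        Subsingleton.elim ((Abelian.Ext.mk₀ b).comp α (zero_add n)) 0, Abelian.Ext.comp_zero]
    | zero => simp
    | add _ _ _ _ h₁ h₂ => rw [Abelian.Ext.mk₀_add, Abelian.Ext.add_comp, h₁, h₂, add_zero]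
    | neg _ _ h => rw [Abelian.Ext.mk₀_neg, Abelian.Ext.neg_comp, h, neg_zero]
  simpa using key _ hX

variable (K : CochainComplex 𝒟 ℕ)

theorem kernel_lift_epi (hK : K.Acyclic) (i : ℕ) :
    Epi (kernel.lift (K.d (i + 1) (i + 2)) (K.d i (i + 1)) (K.d_comp_d _ _ _)) := by
  have hex : (ShortComplex.mk (K.d i (i + 1)) (K.d (i + 1) (i + 2)) (K.d_comp_d _ _ _)).Exact :=
    (K.exactAt_iff' i (i + 1) (i + 2) (by simp) (by simp)).1 (hK (i + 1))
  exact (ShortComplex.exact_iff_epi_kernel_lift _).1 hex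

theorem comp_kernel_lift_eq_zero (i : ℕ) {Z : 𝒟} (f : Z ⟶ K.X i) (w : f ≫ K.d i (i + 1) = 0) :
    f ≫ kernel.lift (K.d (i + 1) (i + 2)) (K.d i (i + 1)) (K.d_comp_d _ _ _) = 0 := by
  rw [← cancel_mono (kernel.ι (K.d (i + 1) (i + 2)))]
  simp [w]

theorem shortExact_kernel_lift (hK : K.Acyclic) (i : ℕ) {Z : 𝒟} (f : Z ⟶ K.X i) [Mono f]
    (w : f ≫ K.d i (i + 1) = 0) (h : (ShortComplex.mk f (K.d i (i + 1)) w).Exact) :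
    (ShortComplex.mk _ _ (comp_kernel_lift_eq_zero K i f w)).ShortExact := by
  let φ : ShortComplex.mk _ _ (comp_kernel_lift_eq_zero K i f w) ⟶ ShortComplex.mk f (K.d i (i + 1)) w :=
    { τ₁ := 𝟙 _
      τ₂ := 𝟙 _
      τ₃ := kernel.ι _ }
  have : Epi φ.τ₁ := inferInstanceAs (Epi (𝟙 _))
  have : IsIso φ.τ₂ := inferInstanceAs (IsIso (𝟙 _))
  have : Mono φ.τ₃ := inferInstanceAs (Mono (kernel.ι _))
  exact
    { exact := (ShortComplex.exact_iff_of_epi_of_isIso_of_mono φ).2 h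
      mono_f := ‹Mono f›
      epi_g := kernel_lift_epi K hK i }

/-- Dimension shifting along `0 → ker d_i → K_i → ker d_{i+1} → 0`; `n` bounds the number of steps
until the kernels vanish beyond degree `r`. -/
theorem subsingleton_ext_kernel [HasExt.{w} 𝒟] (hK : K.Acyclic) (r : ℕ)
    (hr : ∀ i, r < i → IsZero (K.X i)) {V : 𝒟}
    (hV : ∀ i j, 0 < i → 0 < j → Subsingleton (Abelian.Ext.{w} (K.X i) V j)) (n : ℕ) :
    ∀ i j, 0 < i → 0 < j → r < i + n →
      Subsingleton (Abelian.Ext.{w} (kernel (K.d i (i + 1))) V j) := by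
  induction n with
  | zero =>
    intro i j hi hj hrn
    refine subsingleton_of_forall_eq 0 fun α => ?_
    have hz : IsZero (kernel (K.d i (i + 1))) := (hr i hrn).of_mono (kernel.ι _)
    have h₁ : (Abelian.Ext.mk₀ (𝟙 (kernel (K.d i (i + 1))))).comp α (zero_add j) = α := by simp
    rw [← h₁, hz.eq_zero_of_src (𝟙 _), Abelian.Ext.mk₀_zero, Abelian.Ext.zero_comp]
  | succ n ih =>
    intro i j hi hj hrn
    have hS := shortExact_kernel_lift K hK i (kernel.ι (K.d i (i + 1)))
      (kernel.condition _) (ShortComplex.exact_kernel _)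
    have := ih (i + 1) (1 + j) (by omega) (by omega) (by omega)
    have := hV i j hi hj
    refine subsingleton_of_forall_eq 0 fun α => ?_
    obtain ⟨β, rfl⟩ := Abelian.Ext.contravariant_sequence_exact₁ hS V α rfl
      (Subsingleton.elim _ _)
    rw [Subsingleton.elim β 0, Abelian.Ext.comp_zero]

theorem hasCopresentation_of_acyclic [HasExt.{w} 𝒟] (hK : K.Acyclic) (r : ℕ)
    (hr : ∀ i, r < i → IsZero (K.X i)) {Q : ObjectProperty 𝒟}
    (hQ : ∀ i, 0 < i → 𝟙 (K.X i) ∈ factorIdeal Q (K.X i) (K.X i))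
    (hext : ∀ R R', Q R → Q R' → ∀ j, 0 < j → Subsingleton (Abelian.Ext.{w} R R' j)) :
    HasCopresentation Q (K.X 0) := by
  have hex : (ShortComplex.mk (K.d 0 1) (K.d 1 2) (K.d_comp_d _ _ _)).Exact :=
    (K.exactAt_iff' 0 1 2 (by simp) (by simp)).1 (hK 1)
  have hm : Mono (K.d 0 1) := by
    have h := (K.exactAt_iff' 0 0 1 (by simp) (by simp)).1 (hK 0)
    exact h.mono_g (K.shape 0 0 (by simp))
  refine ⟨_, _, K.d 0 1, K.d 1 2, hm, K.d_comp_d _ _ _, fun W a ha => ⟨hex.lift a ha, hex.lift_f _ _⟩,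
    hQ 1 one_pos, hQ 2 two_pos, fun R hR a => ?_⟩
  -- The cokernel of `K.X 0 ⟶ K.X 1` is the kernel of `K.d 2 3`, so `i = 2` and `j = 1`; the bound
  -- `r < 2 + r` allows `n = r`.
  have := subsingleton_ext_kernel K hK r hr (V := R) (fun i j hi hj =>
    subsingleton_ext_of_id_mem j (hQ i hi) fun R' hR' => hext R' R hR' hR j hj) r 2 1 two_pos
      one_pos (by omega)
  exact exists_extension_of_ext (shortExact_kernel_lift K hK 1 (K.d 0 1) _ hex) this a

end Coresolution

/-! ### Connectedness of the covering of the endomorphism category -/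

section Connected

variable {k : Type u} [Field k]
  {C : Type u} [Category.{u} C] [Preadditive C] [Linear k C]
  {A : Type u} [Category.{u} A] [Preadditive A] [Linear k A]

theorem IsTilting.hasCopresentation {T : KMod k A} (hT : IsTilting T) :
    HasCopresentation (fun Y => Y = T) (regular k A) := by
  let := HasExt.standard (KMod k A)
  obtain ⟨K, r, hK, ⟨e⟩, hadd, hzero⟩ := hT.coresolution
  refine (hasCopresentation_of_acyclic K hK r hzero (fun i hi => ?_) ?_).of_retract
    (Retract.ofIso e.symm)
  · rcases le_or_gt i r with h | h
    · exact (hadd i hi h).id_mem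
    · exact id_mem_factorIdeal_of_isZero (hzero i h)
  · rintro R R' rfl hR' j hj
    subst hR'
    exact hT.selfOrthogonal j hj

theorem nonempty_retract_projMod_regular (x : A) :
    Nonempty (Retract (projMod k x) (regular k A)) := by
  classical
  refine ⟨⟨fromProj (M := regular k A) x (Pi.single (M := fun x' => (x' ⟶ x)) x (𝟙 x)),
    KMod.ofAp (M := regular k A) (N := projMod k x)
      (fun y => LinearMap.proj (R := k) (φ := fun x => (x ⟶ y)) x) fun _ _ => rfl, ?_⟩⟩
  refine KMod.hom_ext fun y (f : x ⟶ y) => ?_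
  change (Pi.single (M := fun x' => (x' ⟶ x)) x (𝟙 x) x) ≫ f = f
  rw [Pi.single_eq_same, Category.id_comp]

variable {G : Type u} [Group G] {ρ : KAction k C G} {F : C ⥤ A} [F.Additive] [F.Linear k]
  (hF : IsGaloisCovering ρ F)

/-- The modules `ᵍT'_i`. -/
def coverProp (ρ : KAction k C G) {n : ℕ} (T' : Fin n → KMod k C) (S : Set (G × Fin n)) :
    ObjectProperty (KMod k C) :=
  fun R => ∃ p ∈ S, R = (twist ρ p.1).obj (T' p.2)

variable {n : ℕ} {W : KMod k A} {T : Fin n → KMod k A} {incl : ∀ i, T i ⟶ W}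
  {T' : Fin n → KMod k C} (lam : ∀ i, (pushDown hF).obj (T' i) ≅ T i)

include hF lam in
-- The push-down of `Hom(x, -)` is a summand of the module `A`, hence is copresented by `add T`;
-- this copresentation lifts because the modules `ᵍT'_i` are stable under twists.
theorem hasCopresentation_projMod (hW : IsTilting W)
    (hsum : IsDirectSum T W incl) (hT' : ∀ i, IsFinDim (T' i)) (hC : IsLocallyBounded k C) (x : C) :
    HasCopresentation (coverProp ρ T' Set.univ) (projMod k x) := by
  obtain ⟨r⟩ := nonempty_retract_projMod_regular (k := k) (F.obj x)
  obtain ⟨e⟩ := nonempty_pushDown_projMod_iso hF x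
  obtain ⟨p, hp, -, hW'⟩ := hsum.exists_proj_finite
  refine HasCopresentation.of_orbitFunctor (pushOrbit hF) ?_ ?_ (isFinDim_projMod hC x)
    ((hW.hasCopresentation.of_retract ((Retract.ofIso e).trans r)).of_factorIdeal ?_ ?_)
  · rintro _ ⟨q, -, rfl⟩
    exact (pushOrbit hF).fd_t q.1 (hT' q.2)
  · rintro g _ ⟨q, -, rfl⟩
    exact ⟨(g * q.1, q.2), trivial, (twist_twist_obj ρ g q.1 (T' q.2)).symm⟩
  · intro R hR
    rw [hR]
    refine (AddSubgroup.closure_le (factorIdeal (imageProp (pushDown hF)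
      (coverProp ρ T' Set.univ)) W W)).2 (fun φ hφ => ?_) hW'
    obtain ⟨i, rfl⟩ := hφ
    have : p i ≫ incl i = (p i ≫ (coverIso hF lam (1, i)).inv) ≫
      (coverIso hF lam (1, i)).hom ≫ incl i := by simp
    change p i ≫ incl i ∈ factorIdeal _ _ _
    rw [this]
    exact comp_mem_factorIdeal ⟨_, ⟨(1, i), trivial, rfl⟩, rfl⟩ _ _
  · rintro _ ⟨_, ⟨q, -, rfl⟩, rfl⟩
    exact id_mem_factorIdeal_of_retract
      ((Retract.ofIso (coverIso hF lam q)).trans ⟨incl q.2, p q.2, hp q.2⟩) (id_mem_factorIdeal rfl)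

include hF lam in
-- A partition of the `ᵍT'_i` into orthogonal classes induces a partition of the objects of `C`,
-- according to the class to which `Hom(x, -)` can map non-trivially.
theorem isConnectedKCat_coverCat (hW : IsTilting W) (hsum : IsDirectSum T W incl)
    (hT : ∀ i, IsInd (T i)) (hT' : ∀ i, IsFinDim (T' i))
    (hC : IsLocallyBounded k C) (hCc : IsConnectedKCat C) :
    IsConnectedKCat (CoverCat ρ T') := by
  intro S hS
  have h₁₂ : ∀ R R', coverProp ρ T' S R → coverProp ρ T' Sᶜ R' → ∀ f : R ⟶ R', f = 0 := by
    rintro _ _ ⟨p, hp, rfl⟩ ⟨q, hq, rfl⟩ f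
    exact congrArg InducedCategory.Hom.hom ((hS p hp q hq).1 (InducedCategory.homMk f))
  have h₂₁ : ∀ R R', coverProp ρ T' Sᶜ R → coverProp ρ T' S R' → ∀ f : R ⟶ R', f = 0 := by
    rintro _ _ ⟨q, hq, rfl⟩ ⟨p, hp, rfl⟩ f
    exact congrArg InducedCategory.Hom.hom ((hS p hp q hq).2 (InducedCategory.homMk f))
  have hsub : coverProp ρ T' Set.univ = fun R => coverProp ρ T' S R ∨ coverProp ρ T' Sᶜ R := by
    funext R
    refine propext ⟨fun ⟨p, _, h⟩ => ?_, ?_⟩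
    · by_cases hp : p ∈ S
      · exact Or.inl ⟨p, hp, h⟩
      · exact Or.inr ⟨p, hp, h⟩
    · rintro (⟨p, -, h⟩ | ⟨p, -, h⟩) <;> exact ⟨p, trivial, h⟩
  have hcop : ∀ x : C, HasCopresentation (fun R => coverProp ρ T' S R ∨ coverProp ρ T' Sᶜ R)
      (projMod k x) := fun x =>
    hsub ▸ hasCopresentation_projMod hF lam hW hsum hT' hC x
  have hloc : ∀ x : C, IsLocalRing (End (projMod k x)) := fun x => by
    have := hC.isLocalRing_end x
    have : IsLocalRing (End (Opposite.op x)) := isLocalRing_end_op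
    exact isLocalRing_end_of_fullyFaithful (projFunctor k C) (Opposite.op x)
  -- Each `ᵍT'_i` is non-zero, so by Yoneda it receives a non-zero map from a projective; this
  -- transfers triviality from the partition of `C` back to `S`.
  have hne : ∀ p : G × Fin n, ∃ (x : C) (f : projMod k x ⟶ (twist ρ p.1).obj (T' p.2)), f ≠ 0 := by
    intro p
    by_contra! h
    have := (hT p.2).isLocalRing
    have : IsLocalRing (End ((pushDown hF).obj (T' p.2))) := isLocalRing_end_of_iso (lam p.2)
    have := isLocalRing_end_twist hF (Z := T' p.2) p.1
    refine not_isZero_of_isLocalRing (X := (twist ρ p.1).obj (T' p.2))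
      (KMod.isZero_iff.2 fun x m => ?_)
    have h' := (congrArg (fun φ => KMod.ap φ x (𝟙 x)) (h x (fromProj x m))).trans (KMod.ap_zero _ _)
    exact (KMod.map_id_apply x m).symm.trans h'
  let U : Set C := {x | ∀ R, coverProp ρ T' Sᶜ R → ∀ f : projMod k x ⟶ R, f = 0}
  have hU : ∀ x ∉ U, ∀ R, coverProp ρ T' S R → ∀ f : projMod k x ⟶ R, f = 0 := fun x hx => by
    have := hloc x
    exact (hom_eq_zero_of_hasCopresentation h₁₂ h₂₁ (hcop x)).resolve_right hx
  have hconn : U = ∅ ∨ U = Set.univ := by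
    refine hCc U ?_
    -- Maps into the copresenting modules detect morphisms between projectives, so a morphism of `C`
    -- between the two parts must vanish.
    have key : ∀ {x y : C} (f : y ⟶ x), (∀ R, (coverProp ρ T' S R ∨ coverProp ρ T' Sᶜ R) →
        ∀ b : projMod k y ⟶ R, (projFunctor k C).map f.op ≫ b = 0) → f = 0 := fun {x y} f h => by
      have h' : (projFunctor k C).map f.op = 0 := (hcop y).eq_zero _ h
      exact Quiver.Hom.op_inj ((projFunctor k C).map_injective
        (h'.trans (Functor.map_zero _ _ _).symm))
    intro x hx y hy
    refine ⟨fun f => key f ?_, fun f => key f ?_⟩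
    · rintro R (hR | hR) b
      · exact hU y hy R hR _
      · rw [hx R hR b]; exact comp_zero
    · rintro R (hR | hR) b
      · rw [hU y hy R hR b]; exact comp_zero
      · exact hx R hR _
  rcases hconn with h | h
  · left
    refine Set.eq_empty_iff_forall_notMem.2 fun p hp => ?_
    obtain ⟨x, f, hf⟩ := hne p
    exact hf (hU x (h ▸ Set.notMem_empty x) _ ⟨p, hp, rfl⟩ f)
  · right
    refine Set.eq_univ_iff_forall.2 fun p => by_contra fun hp => ?_
    obtain ⟨x, f, hf⟩ := hne p
    exact hf ((h ▸ Set.mem_univ x : x ∈ U) _ ⟨p, hp, rfl⟩ f)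

end Connected

end GalCov

end

/-! ### The theorem -/

theorem proposition5p9 {k : Type u} [Field k] [IsAlgClosed k]
    {A : Type u} [Category.{u} A] [Preadditive A] [Linear k A] [Finite A]
    (hA : GalCov.IsLocallyBounded k A) (hAc : GalCov.IsConnectedKCat A)
    {C : Type u} [Category.{u} C] [Preadditive C] [Linear k C]
    (hC : GalCov.IsLocallyBounded k C)
    {G : Type u} [Group G] (ρ : GalCov.KAction k C G)
    (F : C ⥤ A) [F.Additive] [F.Linear k] (hF : GalCov.IsGaloisCovering ρ F) :
    (∀ T T' : GalCov.KMod k A, GalCov.IsFirstKind hF T → GalCov.IsFirstKind hF T' →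
      GalCov.SameComponent T T' →
        (GalCov.IsBasic ((GalCov.pullUp F).obj T) ↔ GalCov.IsBasic ((GalCov.pullUp F).obj T'))) ∧
    (∀ T : GalCov.KMod k A,
      GalCov.SameComponent T (GalCov.regular k A) ∨
        GalCov.SameComponent T (GalCov.dualRegular k A) →
      GalCov.IsFirstKind hF T ∧ GalCov.IsBasic ((GalCov.pullUp F).obj T) ∧
      (GalCov.IsConnectedKCat C →
        ∀ (n : ℕ) (Ti : Fin n → GalCov.KMod k A) (incl : ∀ i, Ti i ⟶ T),
          GalCov.IsDirectSum Ti T incl → (∀ i, GalCov.IsInd (Ti i)) →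
        ∀ (Ti' : Fin n → GalCov.KMod k C), (∀ i, GalCov.IsInd (Ti' i)) →
        ∀ (lam : ∀ i, (GalCov.pushDown hF).obj (Ti' i) ≅ Ti i),
          GalCov.IsGaloisCovering (GalCov.coverAction ρ Ti') (GalCov.coverFunctor hF lam) ∧
          GalCov.IsLocallyBounded k (GalCov.CoverCat ρ Ti') ∧
          GalCov.IsConnectedKCat (GalCov.CoverCat ρ Ti'))) := by
  -- Both invariants are transported from `A` or `DA` along the component; being of the first kind
  -- is a conclusion here.
  have key : ∀ T : GalCov.KMod k A, GalCov.SameComponent T (GalCov.regular k A) ∨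
      GalCov.SameComponent T (GalCov.dualRegular k A) →
      GalCov.IsBasicTilting T ∧ GalCov.HasPreimages hF T ∧ GalCov.TwistFree hF T := by
    rintro T (⟨hT, -, h⟩ | ⟨hT, -, h⟩)
    · obtain ⟨h₁, h₂⟩ := GalCov.hasPreimages_regular hF hA hC
      obtain ⟨e₁, e₂⟩ := GalCov.hasPreimages_twistFree_iff_of_eqvGen hF h
      exact ⟨hT, e₁.2 h₁, (e₂ (e₁.2 h₁)).2 h₂⟩
    · obtain ⟨h₁, h₂⟩ := GalCov.hasPreimages_dualRegular hF hA hC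
      obtain ⟨e₁, e₂⟩ := GalCov.hasPreimages_twistFree_iff_of_eqvGen hF h
      exact ⟨hT, e₁.2 h₁, (e₂ (e₁.2 h₁)).2 h₂⟩
  refine ⟨fun T T' h₁ h₁' ⟨hT, hT', h⟩ => ?_, fun T hT => ?_⟩
  · have p := (GalCov.isFirstKind_iff hF hT.1.finDim).1 h₁
    have p' := (GalCov.isFirstKind_iff hF hT'.1.finDim).1 h₁'
    rw [GalCov.isBasic_pullUp_iff hF hT.2 p, GalCov.isBasic_pullUp_iff hF hT'.2 p']
    exact (GalCov.hasPreimages_twistFree_iff_of_eqvGen hF h).2 p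
  · obtain ⟨⟨hT, hb⟩, hp, ht⟩ := key T hT
    refine ⟨(GalCov.isFirstKind_iff hF hT.finDim).2 hp, GalCov.isBasic_pullUp hF hb hp ht,
      fun hCc n Ti incl hsum hTi Ti' hTi' lam => ?_⟩
    have hfd : ∀ i, GalCov.IsFinDim (Ti' i) := fun i => (hTi' i).1
    exact ⟨GalCov.isGaloisCovering_coverFunctor hF lam hfd,
      GalCov.isLocallyBounded_coverCat hF lam hb ht hsum hTi hfd,
      GalCov.isConnectedKCat_coverCat hF lam hT hsum hTi hfd hC hCc⟩
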